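/- Throughout, manifolds are smooth, finite-dimensional, Hausdorff, $\sigma$-compact and without boundary, and vector bundles are smooth, real and of finite rank. Let $\tau_E:E\to Q$ be a vector bundle, with dual $\tau_{E^*}:E^*\to Q$. An \emph{algebroid structure} $(B_E,\rho^l_E,\rho^r_E)$ on $E$ consists of an $\mathbb R$-bilinear map $B_E:\Gamma(E)\times\Gamma(E)\to\Gamma(E)$ and two vector bundle morphisms $\rho^l_E,\rho^r_E:E\to TQ$ over the identity with $$B_E(f\sigma,f'\sigma')=f\rho^l_E(\sigma)(f')\,\sigma'-f'\rho^r_E(\sigma')(f)\,\sigma+ff'B_E(\sigma,\sigma')$$ for $f,f'\in C^\infty(Q)$ and $\sigma,\sigma'\in\Gamma(E)$. For a section $\theta$ of $E^*$ put $$(d^{lr}\theta)(\sigma,\sigma')=\rho^l_E(\sigma)(\theta(\sigma'))-\rho^r_E(\sigma')(\theta(\sigma))-\theta(B_E(\sigma,\sigma')).$$ The algebroid is \emph{exact symplectic} if, for some section $\theta$ of the dual bundle, the $(0,2)$-tensor $-d^{lr}\theta$ is skew-symmetric and nondegenerate. The same terms are used for vector bundles over other base manifolds. For a vector bundle morphism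 $\rho:E\to TQ$ over the identity, a \emph{$\rho$-connection} is an $\mathbb R$-bilinear map $D:\Gamma(E)\times\Gamma(E)\to\Gamma(E)$ with $D_{f\sigma}\gamma=fD_\sigma\gamma$ and $D_\sigma(f\gamma)=\rho(\sigma)(f)\gamma+fD_\sigma\gamma$. It acts on $\nu\in\Gamma(E^*)$ by $(D_\sigma\nu)(\gamma)=\rho(\sigma)(\nu(\gamma))-\nu(D_\sigma\gamma)$. For $\gamma\in\Gamma(E)$ let $\hat\gamma:E^*\to\mathbb R$, $\hat\gamma(\kappa)=\kappa(\gamma(\tau_{E^*}(\kappa)))$. For $\kappa\in E^*_q$, $e\in E_q$ and $\nu\in E^*_q$, the \emph{$D$-horizontal lift} $e^{Dh}_\kappa\in T_\kappa E^*$ is the tangent vector $X$ with $X(f\circ\tau_{E^*})=\rho(e)(f)$ and $X(\hat\gamma)=\kappa(D_e\gamma)$, and the \emph{vertical lift} $\nu^v_\kappa\in T_\kappa E^*$ is the tangent vector $X$ with $X(f\circ\tau_{E^*})=0$ and $X(\hat\gamma)=\nu(\gamma(q))$, for all $f\in C^\infty(Q)$ and $\gamma\in\Gamma(E)$. Let $(B_E,\rho^l_E,\rho^r_E)$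 be an arbitrary algebroid structure on $E$. The \emph{left $E$-tangent bundle} to $E^*$ is the vector bundle $\mathcal T=\mathcal T^E_lE^*\to E^*$ with fibre $$\mathcal T_\kappa=\{(e,X)\in E_q\times T_\kappa E^*:\rho^l_E(e)=(T_\kappa\tau_{E^*})(X)\},\qquad \kappa\in E^*_q .$$ \textbf{Theorem.} (1) The vector bundle $\mathcal T\to E^*$ admits an exact symplectic algebroid structure. (2) There are a $\rho^l_E$-connection $D^l$ and a $\rho^r_E$-connection $D^r$ on $E$ with $B_E(\sigma,\sigma')=D^l_\sigma\sigma'-D^r_{\sigma'}\sigma$ for all $\sigma,\sigma'\in\Gamma(E)$. (3) Let $D^l,D^r$ be any connections as in (2). Then the horizontal lifts of $D^l$ and $D^r$, the vertical lifts, and the derivatives $D^l_\sigma\nu,D^r_\sigma\nu\in\Gamma(E^*)$ exist and are unique. For $\sigma\in\Gamma(E)$, $\nu\in\Gamma(E^*)$ and a $(1,1)$-tensor $S$ on $E$, $$\sigma^h_l(\kappa)=(\sigma(q),\sigma(q)^{D^lh}_\kappa),\qquad \nu^v_l(\kappa)=(0,\nu(q)^v_\kappa),\qquad S^v_l(\kappa)=(0,(\kappa\circ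 S_q)^v_\kappa)\qquad(\kappa\in E^*_q)$$ define smooth sections of $\mathcal T$. Let $R$ be any $(1,3)$-tensor on $E$. There is a unique algebroid structure $(B_{\mathcal T},\rho^l_{\mathcal T},\rho^r_{\mathcal T})$ on $\mathcal T$ with $$\rho^l_{\mathcal T}(e,X)=X,\qquad \rho^r_{\mathcal T}(e,X)=X-e^{D^lh}_\kappa+e^{D^rh}_\kappa\qquad((e,X)\in\mathcal T_\kappa),$$ $$B_{\mathcal T}(\sigma^h_l,\bar\sigma^h_l)=B_E(\sigma,\bar\sigma)^h_l+R(\sigma,\bar\sigma,\cdot)^v_l,\qquad B_{\mathcal T}(\sigma^h_l,\nu^v_l)=(D^l_\sigma\nu)^v_l,$$ $$B_{\mathcal T}(\nu^v_l,\bar\sigma^h_l)=-(D^r_{\bar\sigma}\nu)^v_l,\qquad B_{\mathcal T}(\nu^v_l,\bar\nu^v_l)=0$$ for all $\sigma,\bar\sigma\in\Gamma(E)$ and $\nu,\bar\nu\in\Gamma(E^*)$. For this structure, the Liouville section $\lambda\in\Gamma(\mathcal T^*)$, $\lambda(\kappa)(e,X)=\kappa(e)$, is smooth, and $\Omega=-d^{lr}\lambda$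 is a smooth skew-symmetric nondegenerate $(0,2)$-tensor on $\mathcal T$. If $\{\sigma_\alpha\}$ is a local frame of $E$ over an open set $U\subseteq Q$ with dual frame $\{\sigma^\alpha\}$, then $\{(\sigma_\alpha)^h_l,(\sigma^\alpha)^v_l\}$ is a local frame of $\mathcal T$ over $\tau_{E^*}^{-1}(U)$ and there $$\Omega=\sum_\alpha\big((\sigma_\alpha)^h_l\big)^*\wedge\big((\sigma^\alpha)^v_l\big)^*,\qquad a\wedge b=a\otimes b-b\otimes a,$$ where $\{((\sigma_\alpha)^h_l)^*,((\sigma^\alpha)^v_l)^*\}$ is the dual frame. -/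

import Mathlib

open Bundle Set
open scoped Manifold ContDiff

set_option linter.unusedSectionVars false
set_option maxSynthPendingDepth 3

noncomputable section

namespace LRAlgebroid

/-! ### Algebroids on a smooth real vector bundle `V → M` with model fibre `F` -/

section Algebroid

variable {EB : Type*} [NormedAddCommGroup EB] [NormedSpace ℝ EB]
  {H : Type*} [TopologicalSpace H] {I : ModelWithCorners ℝ EB H}
  {M : Type*} [TopologicalSpace M] [ChartedSpace H M]
  {F : Type*} [NormedAddCommGroup F] [NormedSpace ℝ F]
  {V : M → Type*} [∀ x, AddCommGroup (V x)] [∀ x, Module ℝ (V x)]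
  [∀ x, TopologicalSpace (V x)] [∀ x, IsTopologicalAddGroup (V x)] [∀ x, ContinuousSMul ℝ (V x)]
  [TopologicalSpace (TotalSpace F V)] [FiberBundle F V] [VectorBundle ℝ F V]

/-- The product `f σ` of a smooth function and a smooth section. -/
instance smulSection : SMul C^∞⟮I, M; ℝ⟯ Cₛ^∞⟮I; F, V⟯ where
  smul f σ := ⟨fun x => f x • σ x, f.contMDiff.smul_section σ.contMDiff⟩

/-- The dual bundle `V* → M`; its model fibre is `F →L[ℝ] ℝ`. -/
abbrev DualBundle (V : M → Type*) [∀ x, AddCommGroup (V x)] [∀ x, Module ℝ (V x)]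
    [∀ x, TopologicalSpace (V x)] : M → Type _ := fun x => V x →L[ℝ] ℝ

variable [IsManifold I ∞ M] [ContMDiffVectorBundle ∞ F V I]

variable (I F V) in
/-- Smooth vector bundle morphisms `V → TM` over the identity (anchor maps), as smooth sections of
`Hom(V, TM)`. -/
abbrev AnchorMap := Cₛ^∞⟮I; F →L[ℝ] EB, fun x => V x →L[ℝ] TangentSpace I x⟯

variable (I F V) in
/-- An algebroid structure `(B, ρˡ, ρʳ)` on `V → M`: an `ℝ`-bilinear bracket of smooth sections and
two anchor maps with
`B(f σ, f' σ') = f ρˡ(σ)(f') σ' - f' ρʳ(σ')(f) σ + f f' B(σ, σ')`. -/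
structure AlgebroidStructure where
  bracket : Cₛ^∞⟮I; F, V⟯ →ₗ[ℝ] Cₛ^∞⟮I; F, V⟯ →ₗ[ℝ] Cₛ^∞⟮I; F, V⟯
  lanchor : AnchorMap I F V
  ranchor : AnchorMap I F V
  leibniz : ∀ (f f' : C^∞⟮I, M; ℝ⟯) (σ σ' : Cₛ^∞⟮I; F, V⟯) (x : M),
    bracket (f • σ) (f' • σ') x =
      (f x * mvfderiv I f' x (lanchor x (σ x))) • σ' x
        - (f' x * mvfderiv I f x (ranchor x (σ' x))) • σ x
        + (f x * f' x) • bracket σ σ' x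

/-- The differential of a section `θ` of the dual bundle, evaluated on two sections:
`(d^{lr}θ)(σ, σ') = ρˡ(σ)(θ(σ')) - ρʳ(σ')(θ(σ)) - θ(B(σ, σ'))`. -/
def AlgebroidStructure.dlr (A : AlgebroidStructure I F V)
    (θ : Cₛ^∞⟮I; F →L[ℝ] ℝ, DualBundle V⟯) (σ σ' : Cₛ^∞⟮I; F, V⟯) (x : M) : ℝ :=
  mvfderiv I (fun y => θ y (σ' y)) x (A.lanchor x (σ x))
    - mvfderiv I (fun y => θ y (σ y)) x (A.ranchor x (σ' x))
    - θ x (A.bracket σ σ' x)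

/-- The smooth `(0,2)`-tensor `Ω` is `-d^{lr}θ`, is skew-symmetric, and is nondegenerate. -/
structure AlgebroidStructure.IsExactSymplecticForm (A : AlgebroidStructure I F V)
    (θ : Cₛ^∞⟮I; F →L[ℝ] ℝ, DualBundle V⟯)
    (Ω : Cₛ^∞⟮I; F →L[ℝ] F →L[ℝ] ℝ, fun x => V x →L[ℝ] V x →L[ℝ] ℝ⟯) : Prop where
  eq_neg_dlr : ∀ (σ σ' : Cₛ^∞⟮I; F, V⟯) (x : M), Ω x (σ x) (σ' x) = -A.dlr θ σ σ' x
  skew : ∀ (x : M) (u w : V x), Ω x u w = -Ω x w u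
  nondegenerate : ∀ (x : M) (u : V x), (∀ w : V x, Ω x u w = 0) → u = 0

/-- An algebroid is exact symplectic if `-d^{lr}θ` is a skew-symmetric nondegenerate
`(0,2)`-tensor for some section `θ` of the dual bundle. -/
def AlgebroidStructure.IsExactSymplectic (A : AlgebroidStructure I F V) : Prop :=
  ∃ θ Ω, A.IsExactSymplecticForm θ Ω

/-- A `ρ`-connection on the anchored vector bundle `(V, ρ)`. -/
structure AnchoredConnection (ρ : AnchorMap I F V) where
  conn : Cₛ^∞⟮I; F, V⟯ →ₗ[ℝ] Cₛ^∞⟮I; F, V⟯ →ₗ[ℝ] Cₛ^∞⟮I; F, V⟯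
  smul_left : ∀ (f : C^∞⟮I, M; ℝ⟯) (σ γ : Cₛ^∞⟮I; F, V⟯), conn (f • σ) γ = f • conn σ γ
  leibniz : ∀ (g : C^∞⟮I, M; ℝ⟯) (σ γ : Cₛ^∞⟮I; F, V⟯) (x : M),
    conn σ (g • γ) x = mvfderiv I g x (ρ x (σ x)) • γ x + g x • conn σ γ x

/-- `μ = D_σ ν` for the induced connection on the dual bundle, i.e.
`μ(γ) = ρ(σ)(ν(γ)) - ν(D_σ γ)` for every section `γ`. -/
def AnchoredConnection.IsDualDerivative {ρ : AnchorMap I F V} (D : AnchoredConnection ρ)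
    (σ : Cₛ^∞⟮I; F, V⟯) (ν μ : Cₛ^∞⟮I; F →L[ℝ] ℝ, DualBundle V⟯) : Prop :=
  ∀ (γ : Cₛ^∞⟮I; F, V⟯) (x : M),
    μ x (γ x) = mvfderiv I (fun y => ν y (γ y)) x (ρ x (σ x)) - ν x (D.conn σ γ x)

/-- The section `D_σ ν` of the dual bundle: the section characterized by `IsDualDerivative`. -/
def AnchoredConnection.dual {ρ : AnchorMap I F V} (D : AnchoredConnection ρ)
    (σ : Cₛ^∞⟮I; F, V⟯) (ν : Cₛ^∞⟮I; F →L[ℝ] ℝ, DualBundle V⟯) :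
    Cₛ^∞⟮I; F →L[ℝ] ℝ, DualBundle V⟯ :=
  Classical.epsilon (D.IsDualDerivative σ ν)

variable (I F V) in
/-- Tensors of type `(1,1)` on `V`. -/
abbrev Tensor11 := Cₛ^∞⟮I; F →L[ℝ] F, fun x => V x →L[ℝ] V x⟯

variable (I F V) in
/-- Tensors of type `(1,3)` on `V`. -/
abbrev Tensor13 :=
  Cₛ^∞⟮I; F →L[ℝ] F →L[ℝ] F →L[ℝ] F, fun x => V x →L[ℝ] V x →L[ℝ] V x →L[ℝ] V x⟯

/-- The `(1,1)`-tensor `R(σ, σ', ·)`. -/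
def Tensor13.eval (R : Tensor13 I F V) (σ σ' : Cₛ^∞⟮I; F, V⟯) : Tensor11 I F V :=
  ⟨fun x => R x (σ x) (σ' x),
    (R.contMDiff.clm_bundle_apply σ.contMDiff).clm_bundle_apply σ'.contMDiff⟩

end Algebroid

/-! ### The manifold `E*`, horizontal and vertical lifts, and the left `E`-tangent bundle to `E*` -/

section LeftTangent

variable {EB : Type*} [NormedAddCommGroup EB] [NormedSpace ℝ EB]
  {H : Type*} [TopologicalSpace H] {I : ModelWithCorners ℝ EB H}
  {Q : Type*} [TopologicalSpace Q] [ChartedSpace H Q]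
  {F : Type*} [NormedAddCommGroup F] [NormedSpace ℝ F]
  {E : Q → Type*} [∀ x, AddCommGroup (E x)] [∀ x, Module ℝ (E x)]
  [∀ x, TopologicalSpace (E x)] [∀ x, IsTopologicalAddGroup (E x)] [∀ x, ContinuousSMul ℝ (E x)]
  [TopologicalSpace (TotalSpace F E)] [FiberBundle F E] [VectorBundle ℝ F E]

variable (F E) in
/-- The total space `E*` of the dual bundle. -/
abbrev DualTotal := TotalSpace (F →L[ℝ] ℝ) (DualBundle E)

variable (I F) in
/-- The model with corners of the manifold `E*`. -/
abbrev dualModel := I.prod 𝓘(ℝ, F →L[ℝ] ℝ)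

variable (F E) in
/-- The projection `τ : E* → Q`. -/
abbrev dualProj : DualTotal F E → Q := π (F →L[ℝ] ℝ) (DualBundle E)

/-- The fibrewise linear function on `E*` induced by a section of `E`. -/
def linearFunction (γ : Cₛ^∞⟮I; F, E⟯) : DualTotal F E → ℝ := fun μ => μ.2 (γ μ.proj)

variable [IsManifold I ∞ Q] [ContMDiffVectorBundle ∞ F E I]

/-- `X ∈ T_κ E*` is the `D`-horizontal lift of `e ∈ E_q` at `κ ∈ E*_q`:
`X(f ∘ τ) = ρ(e)(f)` for all smooth `f` on `Q`, and `X(γ̂) = κ(D_e γ)` for all sections `γ` of `E`,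
where `D_e γ = (D_σ γ)(q)` for any section `σ` with `σ(q) = e`. -/
def IsHorizontalLift {ρ : AnchorMap I F E} (D : AnchoredConnection ρ) (κ : DualTotal F E)
    (e : E κ.proj) (X : TangentSpace (dualModel I F) κ) : Prop :=
  (∀ f : C^∞⟮I, Q; ℝ⟯, mvfderiv (dualModel I F) (fun μ : DualTotal F E => f μ.proj) κ X =
      mvfderiv I f κ.proj (ρ κ.proj e)) ∧
    ∀ σ γ : Cₛ^∞⟮I; F, E⟯, σ κ.proj = e →
      mvfderiv (dualModel I F) (linearFunction γ : DualTotal F E → ℝ) κ X =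
        κ.2 (D.conn σ γ κ.proj)

variable (I) in
/-- `X ∈ T_κ E*` is the vertical lift of `ν ∈ E*_q` at `κ ∈ E*_q`:
`X(f ∘ τ) = 0` for all smooth `f` on `Q`, and `X(γ̂) = ν(γ(q))` for all sections `γ` of `E`. -/
def IsVerticalLift (κ : DualTotal F E) (ν : DualBundle E κ.proj)
    (X : TangentSpace (dualModel I F) κ) : Prop :=
  (∀ f : C^∞⟮I, Q; ℝ⟯, mvfderiv (dualModel I F) (fun μ : DualTotal F E => f μ.proj) κ X = 0) ∧
    ∀ γ : Cₛ^∞⟮I; F, E⟯,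
      mvfderiv (dualModel I F) (linearFunction γ : DualTotal F E → ℝ) κ X = ν (γ κ.proj)

/-- The `D`-horizontal lift of `e` at `κ`: the tangent vector characterized by
`IsHorizontalLift`. -/
def hlift {ρ : AnchorMap I F E} (D : AnchoredConnection ρ) (κ : DualTotal F E) (e : E κ.proj) :
    TangentSpace (dualModel I F) κ :=
  Classical.epsilon (IsHorizontalLift D κ e)

variable (I) in
/-- The vertical lift of `ν` at `κ`: the tangent vector characterized by `IsVerticalLift`. -/
def vlift (κ : DualTotal F E) (ν : DualBundle E κ.proj) : TangentSpace (dualModel I F) κ :=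
  Classical.epsilon (IsVerticalLift I κ ν)

variable (ρ : AnchorMap I F E)

/-- The pairs `(e, X) ∈ E_q × T_κ E*` with `ρ(e) = (T_κ τ)(X)`. -/
def leftTangentSubmodule (κ : DualTotal F E) :
    Submodule ℝ (E κ.proj × TangentSpace (dualModel I F) κ) where
  carrier := {p | ρ κ.proj p.1 = mfderiv (dualModel I F) I (dualProj F E) κ p.2}
  add_mem' ha hb :=
    ((ρ κ.proj).map_add _ _).trans ((congrArg₂ (· + ·) ha hb).trans
      (ContinuousLinearMap.map_add _ _ _).symm)
  zero_mem' := ((ρ κ.proj).map_zero).trans (ContinuousLinearMap.map_zero _).symm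
  smul_mem' c _ ha :=
    ((ρ κ.proj).map_smul c _).trans ((congrArg (c • ·) ha).trans
      (ContinuousLinearMap.map_smul _ c _).symm)

/-- The fibre at `κ` of the left `E`-tangent bundle to `E*` (for the left anchor `ρ`). Below, the
family of these fibres is made into a smooth vector bundle over `E*`. -/
def LeftTangent (κ : DualTotal F E) : Type _ := leftTangentSubmodule ρ κ

namespace LeftTangent

instance (κ : DualTotal F E) : AddCommGroup (LeftTangent ρ κ) :=
  inferInstanceAs (AddCommGroup (leftTangentSubmodule ρ κ))
instance (κ : DualTotal F E) : Module ℝ (LeftTangent ρ κ) :=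
  inferInstanceAs (Module ℝ (leftTangentSubmodule ρ κ))
instance (κ : DualTotal F E) : TopologicalSpace (LeftTangent ρ κ) :=
  inferInstanceAs (TopologicalSpace (leftTangentSubmodule ρ κ))
instance (κ : DualTotal F E) : IsTopologicalAddGroup (LeftTangent ρ κ) :=
  inferInstanceAs (IsTopologicalAddGroup (leftTangentSubmodule ρ κ))
instance (κ : DualTotal F E) : ContinuousSMul ℝ (LeftTangent ρ κ) :=
  inferInstanceAs (ContinuousSMul ℝ (leftTangentSubmodule ρ κ))

variable {ρ}

/-- The component `e` of `(e, X)`. -/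
def vec {κ : DualTotal F E} : LeftTangent ρ κ →L[ℝ] E κ.proj :=
  (ContinuousLinearMap.fst ℝ (E κ.proj) (TangentSpace (dualModel I F) κ)).comp
    (leftTangentSubmodule ρ κ).subtypeL

/-- The component `X` of `(e, X)`. -/
def tan {κ : DualTotal F E} : LeftTangent ρ κ →L[ℝ] TangentSpace (dualModel I F) κ :=
  (ContinuousLinearMap.snd ℝ (E κ.proj) (TangentSpace (dualModel I F) κ)).comp
    (leftTangentSubmodule ρ κ).subtypeL

theorem anchor_vec {κ : DualTotal F E} (p : LeftTangent ρ κ) :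
    ρ κ.proj (vec p) = mfderiv (dualModel I F) I (dualProj F E) κ (tan p) := p.2

theorem ext_vec_tan {κ : DualTotal F E} {p p' : LeftTangent ρ κ} (h : vec p = vec p')
    (h' : tan p = tan p') : p = p' := Subtype.ext (Prod.ext h h')

/-! The smooth vector bundle structure, with model fibre `F × F*`. Over a neighbourhood of `κ₀`
the local trivialization sends `(e, X)` to the coordinates of `e` in the trivialization of `E`
together with the coordinates of `X` along the fibres of `E*`. -/

/-- The trivialization of `E` near `τ(κ₀)`. -/
abbrev trivE (κ₀ : DualTotal F E) := trivializationAt F E κ₀.proj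

variable (I) in
/-- The trivialization of `TQ` near `τ(κ₀)`. -/
abbrev trivQ (κ₀ : DualTotal F E) := trivializationAt EB (TangentSpace I : Q → Type _) κ₀.proj

variable (I) in
/-- The trivialization of `TE*` near `κ₀`. -/
abbrev trivT (κ₀ : DualTotal F E) := trivializationAt (EB × (F →L[ℝ] ℝ))
  (TangentSpace (dualModel I F) : DualTotal F E → Type _) κ₀

variable (I) in
/-- The domain of the local trivialization. -/
def baseSet (κ₀ : DualTotal F E) : Set (DualTotal F E) :=
  (trivT I κ₀).baseSet ∩ (dualProj F E) ⁻¹' ((trivE κ₀).baseSet ∩ (trivQ I κ₀).baseSet)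

variable (I) in
theorem mem_baseSet (κ₀ : DualTotal F E) : κ₀ ∈ baseSet I κ₀ :=
  ⟨mem_baseSet_trivializationAt _ _ _, mem_baseSet_trivializationAt F E _,
    mem_baseSet_trivializationAt EB (TangentSpace I) κ₀.proj⟩

theorem isOpen_baseSet (κ₀ : DualTotal F E) : IsOpen (baseSet I κ₀) :=
  (trivT I κ₀).open_baseSet.inter
    (((trivE κ₀).open_baseSet.inter (trivQ I κ₀).open_baseSet).preimage
      (FiberBundle.continuous_proj _ _))

theorem trivT_fst {κ₀ κ : DualTotal F E} (h : κ ∈ baseSet I κ₀)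
    (X : TangentSpace (dualModel I F) κ) :
    ((trivT I κ₀).continuousLinearMapAt ℝ κ X).1 = (trivQ I κ₀).continuousLinearMapAt ℝ κ.proj
      (mfderiv (dualModel I F) I (dualProj F E) κ X) := by
  obtain ⟨h1, h2, h3⟩ := h
  have h1' : κ ∈ (chartAt (ModelProd H (F →L[ℝ] ℝ)) κ₀).source := h1
  have h3' : κ.proj ∈ (chartAt H κ₀.proj).source := h3
  rw [TangentBundle.continuousLinearMapAt_trivializationAt h1',
    TangentBundle.continuousLinearMapAt_trivializationAt h3']
  have hd1 : MDifferentiableAt (dualModel I F) 𝓘(ℝ, EB × (F →L[ℝ] ℝ))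
      (extChartAt (dualModel I F) κ₀) κ := mdifferentiableAt_extChartAt h1'
  have hd2 : MDifferentiableAt I 𝓘(ℝ, EB) (extChartAt I κ₀.proj) κ.proj :=
    mdifferentiableAt_extChartAt h3'
  have hp : MDifferentiableAt (dualModel I F) I (dualProj F E) κ :=
    (contMDiff_proj (n := 1) (DualBundle E)).mdifferentiable one_ne_zero κ
  have e : (fun μ : DualTotal F E => (extChartAt (dualModel I F) κ₀ μ).1) =ᶠ[nhds κ]
      (extChartAt I κ₀.proj) ∘ (dualProj F E) := by
    filter_upwards [(chartAt (ModelProd H (F →L[ℝ] ℝ)) κ₀).open_source.mem_nhds h1'] with μ hμ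
    simp only [extChartAt, FiberBundle.chartedSpace_chartAt, mfld_simps]
    have hm : μ.proj ∈
        (trivializationAt (F →L[ℝ] ℝ) (fun x => E x →L[ℝ] ℝ) κ₀.proj).baseSet := by
      rw [FiberBundle.chartedSpace_chartAt] at hμ
      exact ((Trivialization.mem_source _).1 hμ.1)
    rw [Trivialization.coe_fst' _ hm]
  have key := e.mfderiv_eq (I := dualModel I F) (I' := 𝓘(ℝ, EB))
  rw [mfderiv_comp κ hd2 hp] at key
  have k2 : mfderiv (dualModel I F) 𝓘(ℝ, EB)
      (fun μ : DualTotal F E => (extChartAt (dualModel I F) κ₀ μ).1) κ =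
      (ContinuousLinearMap.fst ℝ EB (F →L[ℝ] ℝ)).comp
        (mfderiv (dualModel I F) 𝓘(ℝ, EB × (F →L[ℝ] ℝ)) (extChartAt (dualModel I F) κ₀) κ) :=
    (((ContinuousLinearMap.fst ℝ EB (F →L[ℝ] ℝ)).hasMFDerivAt).comp κ hd1.hasMFDerivAt).mfderiv
  rw [k2] at key
  exact congrArg (fun L => L X) key

variable (ρ) (κ₀ κ κ₁ : DualTotal F E)

/-- The coordinates on the fibre at `κ`. -/
def coord : LeftTangent ρ κ →L[ℝ] F × (F →L[ℝ] ℝ) :=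
  (((trivE κ₀).continuousLinearMapAt ℝ κ.proj).comp vec).prod
    ((ContinuousLinearMap.snd ℝ EB (F →L[ℝ] ℝ)).comp
      (((trivT I κ₀).continuousLinearMapAt ℝ κ).comp tan))

/-- The anchor `ρ`, read in the trivializations at `κ₀`. -/
def anchorCoord : F →L[ℝ] EB :=
  ((trivQ I κ₀).continuousLinearMapAt ℝ κ.proj).comp
    ((ρ κ.proj).comp ((trivE κ₀).symmL ℝ κ.proj))

/-- The inverse of `coord`. -/
def coordInv : F × (F →L[ℝ] ℝ) →L[ℝ] E κ.proj × TangentSpace (dualModel I F) κ :=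
  (((trivE κ₀).symmL ℝ κ.proj).comp (ContinuousLinearMap.fst ℝ F (F →L[ℝ] ℝ))).prod
    (((trivT I κ₀).symmL ℝ κ).comp
      (((anchorCoord ρ κ₀ κ).comp (ContinuousLinearMap.fst ℝ F (F →L[ℝ] ℝ))).prod
        (ContinuousLinearMap.snd ℝ F (F →L[ℝ] ℝ))))

variable {κ₀ κ κ₁}

theorem coordInv_mem (h : κ ∈ baseSet I κ₀) (v : F × (F →L[ℝ] ℝ)) :
    coordInv ρ κ₀ κ v ∈ leftTangentSubmodule ρ κ := by
  change ρ κ.proj ((trivE κ₀).symmL ℝ κ.proj v.1) = mfderiv (dualModel I F) I _ κ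
    ((trivT I κ₀).symmL ℝ κ (anchorCoord ρ κ₀ κ v.1, v.2))
  have h1 := trivT_fst h ((trivT I κ₀).symmL ℝ κ (anchorCoord ρ κ₀ κ v.1, v.2))
  rw [Trivialization.continuousLinearMapAt_symmL _ h.1] at h1
  rw [← (trivQ I κ₀).symmL_continuousLinearMapAt (R := ℝ) h.2.2
      (mfderiv (dualModel I F) I (dualProj F E) κ
        ((trivT I κ₀).symmL ℝ κ (anchorCoord ρ κ₀ κ v.1, v.2))), ← h1]
  exact ((trivQ I κ₀).symmL_continuousLinearMapAt (R := ℝ) h.2.2 _).symm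

/-- The point of the fibre at `κ` with given coordinates. -/
def ofCoord (h : κ ∈ baseSet I κ₀) (v : F × (F →L[ℝ] ℝ)) : LeftTangent ρ κ :=
  ⟨coordInv ρ κ₀ κ v, coordInv_mem ρ h v⟩

theorem coord_ofCoord (h : κ ∈ baseSet I κ₀) (v : F × (F →L[ℝ] ℝ)) :
    coord ρ κ₀ κ (ofCoord ρ h v) = v := by
  refine Prod.ext ((trivE κ₀).continuousLinearMapAt_symmL (R := ℝ) h.2.1 v.1) ?_
  have h1 : (trivT I κ₀).continuousLinearMapAt ℝ κ
      ((trivT I κ₀).symmL ℝ κ (anchorCoord ρ κ₀ κ v.1, v.2)) = (anchorCoord ρ κ₀ κ v.1, v.2) :=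
    (trivT I κ₀).continuousLinearMapAt_symmL (R := ℝ) h.1 _
  exact congrArg (Prod.snd : EB × (F →L[ℝ] ℝ) → (F →L[ℝ] ℝ)) h1

theorem coordInv_coord (h : κ ∈ baseSet I κ₀) (p : LeftTangent ρ κ) :
    coordInv ρ κ₀ κ (coord ρ κ₀ κ p) = (vec p, tan p) := by
  have h0 := (trivE κ₀).symmL_continuousLinearMapAt (R := ℝ) h.2.1 (vec p)
  have h1 : (anchorCoord ρ κ₀ κ ((trivE κ₀).continuousLinearMapAt ℝ κ.proj (vec p)),
      ((trivT I κ₀).continuousLinearMapAt ℝ κ (tan p)).2) =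
      (trivT I κ₀).continuousLinearMapAt ℝ κ (tan p) := by
    refine Prod.ext ?_ rfl
    rw [trivT_fst h (tan p), ← anchor_vec p]
    exact congrArg (fun e => (trivQ I κ₀).continuousLinearMapAt ℝ κ.proj (ρ κ.proj e)) h0
  refine Prod.ext h0 ?_
  have h3 := (trivT I κ₀).symmL_continuousLinearMapAt (R := ℝ) h.1 (tan p)
  rw [← h1] at h3
  exact h3

variable (κ₀) in
open Classical in
/-- The local trivialization near `κ₀`. -/
def pretriv : Pretrivialization (F × (F →L[ℝ] ℝ)) (π (F × (F →L[ℝ] ℝ)) (LeftTangent ρ)) where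
  toFun p := (p.proj, coord ρ κ₀ p.proj p.2)
  invFun x := ⟨x.1, if h : x.1 ∈ baseSet I κ₀ then ofCoord ρ h x.2 else 0⟩
  source := π (F × (F →L[ℝ] ℝ)) (LeftTangent ρ) ⁻¹' baseSet I κ₀
  target := baseSet I κ₀ ×ˢ univ
  baseSet := baseSet I κ₀
  map_source' p hp := ⟨hp, mem_univ _⟩
  map_target' x hx := hx.1
  left_inv' := by
    rintro ⟨κ, p⟩ h
    have h' : κ ∈ baseSet I κ₀ := h
    simp only [dif_pos h']
    congr 1
    exact Subtype.ext (coordInv_coord ρ h' p)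
  right_inv' := by
    rintro ⟨κ, v⟩ ⟨h, -⟩
    have h' : κ ∈ baseSet I κ₀ := h
    simp only [dif_pos h']
    exact Prod.ext rfl (coord_ofCoord ρ h' v)
  open_target := (isOpen_baseSet κ₀).prod isOpen_univ
  open_baseSet := isOpen_baseSet κ₀
  source_eq := rfl
  target_eq := rfl
  proj_toFun _ _ := rfl

theorem pretriv_symm (h : κ ∈ baseSet I κ₀) (v : F × (F →L[ℝ] ℝ)) :
    (pretriv ρ κ₀).symm κ v = ofCoord ρ h v := by
  have h1 := (pretriv ρ κ₀).symm_apply_apply_mk h (ofCoord ρ h v)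
  have h2 : (pretriv ρ κ₀ ⟨κ, ofCoord ρ h v⟩).2 = v := coord_ofCoord ρ h v
  rwa [h2] at h1

variable (κ₀ κ₁) in
/-- The coordinate changes. -/
def coordChange (κ : DualTotal F E) : F × (F →L[ℝ] ℝ) →L[ℝ] F × (F →L[ℝ] ℝ) :=
  (((((trivE κ₀).coordChangeL ℝ (trivE κ₁) κ.proj : F →L[ℝ] F))).comp
      (ContinuousLinearMap.fst ℝ F (F →L[ℝ] ℝ))).prod
    ((ContinuousLinearMap.snd ℝ EB (F →L[ℝ] ℝ)).comp
      (((trivT I κ₀).coordChangeL ℝ (trivT I κ₁) κ :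
          (EB × (F →L[ℝ] ℝ)) →L[ℝ] (EB × (F →L[ℝ] ℝ))).comp
        (((anchorCoord ρ κ₀ κ).comp (ContinuousLinearMap.fst ℝ F (F →L[ℝ] ℝ))).prod
          (ContinuousLinearMap.snd ℝ F (F →L[ℝ] ℝ)))))

theorem contMDiffOn_clm_prod {A B C M : Type*} [NormedAddCommGroup A] [NormedSpace ℝ A]
    [NormedAddCommGroup B] [NormedSpace ℝ B] [NormedAddCommGroup C] [NormedSpace ℝ C]
    {E₀ : Type*} [NormedAddCommGroup E₀] [NormedSpace ℝ E₀] {H₀ : Type*} [TopologicalSpace H₀]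
    {J : ModelWithCorners ℝ E₀ H₀} [TopologicalSpace M] [ChartedSpace H₀ M] {s : Set M}
    {f : M → A →L[ℝ] B} {g : M → A →L[ℝ] C}
    (hf : ContMDiffOn J 𝓘(ℝ, A →L[ℝ] B) ∞ f s) (hg : ContMDiffOn J 𝓘(ℝ, A →L[ℝ] C) ∞ g s) :
    ContMDiffOn J 𝓘(ℝ, A →L[ℝ] B × C) ∞ (fun x => (f x).prod (g x)) s :=
  (hf.clm_prodMap hg).clm_comp (f := fun _ =>
    (ContinuousLinearMap.id ℝ A).prod (ContinuousLinearMap.id ℝ A)) contMDiffOn_const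

theorem contMDiffOn_anchorCoord : ContMDiffOn (dualModel I F) 𝓘(ℝ, F →L[ℝ] EB) ∞
    (anchorCoord ρ κ₀) (baseSet I κ₀) := by
  have h1 := ((trivializationAt (F →L[ℝ] EB) (fun x => E x →L[ℝ] TangentSpace I x)
    κ₀.proj).contMDiffOn_section_baseSet_iff (IB := I) (n := ∞) (s := ρ)).1
      ρ.contMDiff.contMDiffOn
  exact h1.comp (contMDiff_proj (DualBundle E)).contMDiffOn (fun κ hκ => hκ.2)

theorem contMDiffOn_coordChange : ContMDiffOn (dualModel I F)
    𝓘(ℝ, (F × (F →L[ℝ] ℝ)) →L[ℝ] (F × (F →L[ℝ] ℝ))) ∞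
    (coordChange ρ κ₀ κ₁) (baseSet I κ₀ ∩ baseSet I κ₁) := by
  have h1 : ContMDiffOn (dualModel I F) 𝓘(ℝ, F →L[ℝ] F) ∞
      (fun κ : DualTotal F E => ((trivE κ₀).coordChangeL ℝ (trivE κ₁) κ.proj : F →L[ℝ] F))
      (baseSet I κ₀ ∩ baseSet I κ₁) :=
    (contMDiffOn_coordChangeL (IB := I) (n := ∞) (trivE κ₀) (trivE κ₁)).comp
      (contMDiff_proj (DualBundle E)).contMDiffOn (fun κ hκ => ⟨hκ.1.2.1, hκ.2.2.1⟩)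
  have h2 : ContMDiffOn (dualModel I F) _ ∞
      (fun κ : DualTotal F E => ((trivT I κ₀).coordChangeL ℝ (trivT I κ₁) κ :
          (EB × (F →L[ℝ] ℝ)) →L[ℝ] (EB × (F →L[ℝ] ℝ))))
      (baseSet I κ₀ ∩ baseSet I κ₁) :=
    (contMDiffOn_coordChangeL (IB := dualModel I F) (n := ∞) (trivT I κ₀) (trivT I κ₁)).mono
      (fun κ hκ => ⟨hκ.1.1, hκ.2.1⟩)
  have h3 := (contMDiffOn_anchorCoord ρ (κ₀ := κ₀)).mono
    (inter_subset_left (t := baseSet I κ₁))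
  exact contMDiffOn_clm_prod (h1.clm_comp contMDiffOn_const)
    (contMDiffOn_const.clm_comp (h2.clm_comp
      (contMDiffOn_clm_prod (h3.clm_comp contMDiffOn_const) contMDiffOn_const)))

theorem coordChangeL_eq {B F : Type*} {V : B → Type*} [NormedAddCommGroup F] [NormedSpace ℝ F]
    [TopologicalSpace B] [TopologicalSpace (TotalSpace F V)] [∀ x, AddCommGroup (V x)]
    [∀ x, Module ℝ (V x)] [∀ x, TopologicalSpace (V x)] [FiberBundle F V]
    (e e' : Trivialization F (π F V)) [e.IsLinear ℝ] [e'.IsLinear ℝ] {b : B}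
    (h : b ∈ e.baseSet) (h' : b ∈ e'.baseSet) (y : F) :
    e.coordChangeL ℝ e' b y = e'.continuousLinearMapAt ℝ b (e.symmL ℝ b y) := by
  rw [e.coordChangeL_apply e' ⟨h, h'⟩, e'.continuousLinearMapAt_apply ℝ,
    e'.coe_linearMapAt_of_mem h', e.symmL_apply h]

theorem coordChange_apply (h : κ ∈ baseSet I κ₀ ∩ baseSet I κ₁) (v : F × (F →L[ℝ] ℝ)) :
    coordChange ρ κ₀ κ₁ κ v = (pretriv ρ κ₁ ⟨κ, (pretriv ρ κ₀).symm κ v⟩).2 := by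
  rw [pretriv_symm ρ h.1]
  change _ = coord ρ κ₁ κ _
  refine Prod.ext ?_ ?_
  · exact coordChangeL_eq (trivE κ₀) (trivE κ₁) h.1.2.1 h.2.2.1 v.1
  · exact congrArg (Prod.snd : EB × (F →L[ℝ] ℝ) → (F →L[ℝ] ℝ))
      (coordChangeL_eq (trivT I κ₀) (trivT I κ₁) h.1.1 h.2.1 (anchorCoord ρ κ₀ κ v.1, v.2))

/-- The bundle atlas of the left `E`-tangent bundle. -/
def vectorPrebundle : VectorPrebundle ℝ (F × (F →L[ℝ] ℝ)) (LeftTangent ρ) where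
  pretrivializationAtlas := range (pretriv ρ)
  pretrivialization_linear' := by
    rintro _ ⟨κ₀, rfl⟩
    exact ⟨fun κ _ => (coord ρ κ₀ κ).isLinear⟩
  pretrivializationAt := pretriv ρ
  mem_base_pretrivializationAt κ := mem_baseSet I κ
  pretrivialization_mem_atlas κ := mem_range_self κ
  exists_coordChange := by
    rintro _ ⟨κ₀, rfl⟩ _ ⟨κ₁, rfl⟩
    exact ⟨coordChange ρ κ₀ κ₁, (contMDiffOn_coordChange ρ).continuousOn,
      fun κ hκ v => coordChange_apply ρ hκ v⟩
  totalSpaceMk_isInducing κ := by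
    have h1 : Topology.IsInducing (coord ρ κ κ) := by
      refine (Topology.IsInducing.of_comp (coord ρ κ κ).continuous (coordInv ρ κ κ).continuous ?_)
      have : (coordInv ρ κ κ) ∘ (coord ρ κ κ) = Subtype.val :=
        funext (coordInv_coord ρ (mem_baseSet I κ))
      rw [this]
      exact Topology.IsInducing.subtypeVal
    exact Topology.isInducing_const_prod.2 h1

instance : TopologicalSpace (TotalSpace (F × (F →L[ℝ] ℝ)) (LeftTangent ρ)) :=
  (vectorPrebundle ρ).totalSpaceTopology

instance : FiberBundle (F × (F →L[ℝ] ℝ)) (LeftTangent ρ) :=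
  (vectorPrebundle ρ).toFiberBundle

instance : VectorBundle ℝ (F × (F →L[ℝ] ℝ)) (LeftTangent ρ) :=
  (vectorPrebundle ρ).toVectorBundle

instance : (vectorPrebundle ρ).IsContMDiff (dualModel I F) ∞ where
  exists_contMDiffCoordChange := by
    rintro _ ⟨κ₀, rfl⟩ _ ⟨κ₁, rfl⟩
    exact ⟨coordChange ρ κ₀ κ₁, contMDiffOn_coordChange ρ,
      fun κ hκ v => coordChange_apply ρ hκ v⟩

instance : ContMDiffVectorBundle ∞ (F × (F →L[ℝ] ℝ)) (LeftTangent ρ) (dualModel I F) :=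
  (vectorPrebundle ρ).contMDiffVectorBundle (dualModel I F)

end LeftTangent

/-! ### Lifts to the left `E`-tangent bundle -/

variable {ρ}

/-- The horizontal lift `e^{hˡ} = (e, e^{D h})` of `e ∈ E_q` at `κ ∈ E*_q`. -/
def hliftT (D : AnchoredConnection ρ) (κ : DualTotal F E) (e : E κ.proj) : LeftTangent ρ κ :=
  Classical.epsilon fun p => LeftTangent.vec p = e ∧ LeftTangent.tan p = hlift D κ e

variable (ρ) in
/-- The vertical lift `ν^{vˡ} = (0, ν^v)` of `ν ∈ E*_q` at `κ ∈ E*_q`. -/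
def vliftT (κ : DualTotal F E) (ν : DualBundle E κ.proj) : LeftTangent ρ κ :=
  Classical.epsilon fun p => LeftTangent.vec p = 0 ∧ LeftTangent.tan p = vlift I κ ν

variable (ρ) in
/-- Smooth sections of the left `E`-tangent bundle. -/
abbrev LeftTangentSection := Cₛ^∞⟮dualModel I F; F × (F →L[ℝ] ℝ), LeftTangent ρ⟯

/-- The horizontal lift `σ^{hˡ}` of a section `σ` of `E`. -/
def hSec (D : AnchoredConnection ρ) (σ : Cₛ^∞⟮I; F, E⟯) : LeftTangentSection ρ :=
  Classical.epsilon fun s => ∀ κ, s κ = hliftT D κ (σ κ.proj)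

variable (ρ) in
/-- The vertical lift `ν^{vˡ}` of a section `ν` of `E*`. -/
def vSec (ν : Cₛ^∞⟮I; F →L[ℝ] ℝ, DualBundle E⟯) : LeftTangentSection ρ :=
  Classical.epsilon fun s => ∀ κ, s κ = vliftT ρ κ (ν κ.proj)

variable (ρ) in
/-- The vertical lift `S^{vˡ}` of a `(1,1)`-tensor `S`: its value at `κ` is the vertical lift of
`κ ∘ S` at `κ`. -/
def tSec (S : Tensor11 I F E) : LeftTangentSection ρ :=
  Classical.epsilon fun s => ∀ κ, s κ = vliftT ρ κ (κ.2.comp (S κ.proj))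

/-- Horizontal lifts, vertical lifts and derivatives of sections of the dual bundle are well defined:
the objects characterizing them exist and are unique. -/
structure LiftsWellDefined (D : AnchoredConnection ρ) : Prop where
  hlift_unique : ∀ (κ : DualTotal F E) (e : E κ.proj), ∃! X, IsHorizontalLift D κ e X
  vlift_unique : ∀ (κ : DualTotal F E) (ν : DualBundle E κ.proj), ∃! X, IsVerticalLift I κ ν X
  dual_unique : ∀ (σ : Cₛ^∞⟮I; F, E⟯) (ν : Cₛ^∞⟮I; F →L[ℝ] ℝ, DualBundle E⟯),
    ∃! μ, D.IsDualDerivative σ ν μ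

/-- The lifts to the left `E`-tangent bundle are well defined: they have the values prescribed by
their definitions, and the lifted sections are smooth. -/
structure BundleLiftsWellDefined (D : AnchoredConnection ρ) : Prop where
  hliftT_eq : ∀ (κ : DualTotal F E) (e : E κ.proj),
    LeftTangent.vec (hliftT D κ e) = e ∧ LeftTangent.tan (hliftT D κ e) = hlift D κ e
  vliftT_eq : ∀ (κ : DualTotal F E) (ν : DualBundle E κ.proj),
    LeftTangent.vec (vliftT ρ κ ν) = 0 ∧ LeftTangent.tan (vliftT ρ κ ν) = vlift I κ ν
  hSec_apply : ∀ (σ : Cₛ^∞⟮I; F, E⟯) (κ : DualTotal F E), hSec D σ κ = hliftT D κ (σ κ.proj)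
  vSec_apply : ∀ (ν : Cₛ^∞⟮I; F →L[ℝ] ℝ, DualBundle E⟯) (κ : DualTotal F E),
    vSec ρ ν κ = vliftT ρ κ (ν κ.proj)
  tSec_apply : ∀ (S : Tensor11 I F E) (κ : DualTotal F E),
    tSec ρ S κ = vliftT ρ κ (κ.2.comp (S κ.proj))

/-- The algebroid structure `𝒜` on the left `E`-tangent bundle is the one determined by the left
connection `Dl`, the right connection `Dr` and the tensor `R`. -/
structure IsLiftedAlgebroid (A : AlgebroidStructure I F E) (Dl : AnchoredConnection A.lanchor)
    (Dr : AnchoredConnection A.ranchor) (R : Tensor13 I F E)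
    (𝒜 : AlgebroidStructure (dualModel I F) (F × (F →L[ℝ] ℝ)) (LeftTangent A.lanchor)) :
    Prop where
  lanchor_apply : ∀ (κ : DualTotal F E) (p : LeftTangent A.lanchor κ),
    𝒜.lanchor κ p = LeftTangent.tan p
  ranchor_apply : ∀ (κ : DualTotal F E) (p : LeftTangent A.lanchor κ),
    𝒜.ranchor κ p =
      LeftTangent.tan p - hlift Dl κ (LeftTangent.vec p) + hlift Dr κ (LeftTangent.vec p)
  bracket_hor_hor : ∀ σ σ' : Cₛ^∞⟮I; F, E⟯,
    𝒜.bracket (hSec Dl σ) (hSec Dl σ') =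
      hSec Dl (A.bracket σ σ') + tSec A.lanchor (R.eval σ σ')
  bracket_hor_ver : ∀ (σ : Cₛ^∞⟮I; F, E⟯) (ν : Cₛ^∞⟮I; F →L[ℝ] ℝ, DualBundle E⟯),
    𝒜.bracket (hSec Dl σ) (vSec A.lanchor ν) = vSec A.lanchor (Dl.dual σ ν)
  bracket_ver_hor : ∀ (ν : Cₛ^∞⟮I; F →L[ℝ] ℝ, DualBundle E⟯) (σ : Cₛ^∞⟮I; F, E⟯),
    𝒜.bracket (vSec A.lanchor ν) (hSec Dl σ) = -vSec A.lanchor (Dr.dual σ ν)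
  bracket_ver_ver : ∀ ν ν' : Cₛ^∞⟮I; F →L[ℝ] ℝ, DualBundle E⟯,
    𝒜.bracket (vSec A.lanchor ν) (vSec A.lanchor ν') = 0

variable (ρ) in
/-- Sections of the dual of the left `E`-tangent bundle. -/
abbrev LeftTangentForm :=
  Cₛ^∞⟮dualModel I F; (F × (F →L[ℝ] ℝ)) →L[ℝ] ℝ, DualBundle (LeftTangent ρ)⟯

/-- `lam` is the Liouville section: `λ(κ)(e, X) = κ(e)`. -/
def IsLiouvilleSection (lam : LeftTangentForm ρ) : Prop :=
  ∀ (κ : DualTotal F E) (p : LeftTangent ρ κ), lam κ p = κ.2 (LeftTangent.vec p)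

variable (ρ) in
/-- Smooth `(0,2)`-tensors on the left `E`-tangent bundle. -/
abbrev LeftTangentTensor02 :=
  Cₛ^∞⟮dualModel I F; (F × (F →L[ℝ] ℝ)) →L[ℝ] (F × (F →L[ℝ] ℝ)) →L[ℝ] ℝ,
    fun κ => LeftTangent ρ κ →L[ℝ] LeftTangent ρ κ →L[ℝ] ℝ⟯

/-- The family of local sections `(σ_α)^{hˡ}, (σ^α)^{vˡ}` induced by local sections `σ_α` of `E`
and `σ^α` of `E*`. -/
def liftedFamily (D : AnchoredConnection ρ) {n : ℕ} (s : Fin n → (x : Q) → E x)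
    (ν : Fin n → (x : Q) → DualBundle E x) :
    Fin n ⊕ Fin n → (κ : DualTotal F E) → LeftTangent ρ κ :=
  Sum.elim (fun i κ => hliftT D κ (s i κ.proj)) (fun i κ => vliftT ρ κ (ν i κ.proj))

end LeftTangent

end LRAlgebroid

end

open LRAlgebroid

/-!
The proof rests on describing every object on `E*` by pairing it with global sections of `E` and `E*`;
over the Hausdorff base `Q` these exist in abundance thanks to cut-off functions, and a map of sections
that is linear over smooth functions comes from a bundle map (`exists_clm_of_tensorial`).

*Connections.* Local connections with a parallel frame, averaged by a partition of unity, give a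
connection `Dˡ` for the left anchor (`nonempty_anchoredConnection`); the Leibniz rule of the bracket
then makes `Dʳ_{σ'} σ = Dˡ_σ σ' - B(σ, σ')` a connection for the right anchor.

*The bundle `𝒯`.* The functions `f ∘ τ` and `γ̂` contain coordinates of `E*` (`exists_coordinates`), so
a tangent vector of `E*` is determined by, and may be prescribed through, its action on them. Hence
`(e, X) ∈ 𝒯_κ` is the same as the pair of `e` and the vertical part `k ∈ E*_q`, where
`k(γ) = X(γ̂) - κ(Dˡ_e γ)` (`LeftTangent.vert`), and a section of `𝒯` is smooth exactly when `e` and `k`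
are. Horizontal lifts have `k = 0`, vertical lifts have `e = 0`.

*The algebroid.* Let `∇ˡ`, `∇ʳ` denote the pullbacks of `Dˡ`, `Dʳ` along `τ`, acting on sections of `E`
and `E*` along `τ`. For sections `s = (e, X)` and `s' = (e', X')` with vertical parts `k`, `k'`, and with
`Y'` the right anchor of `s'`, the bracket of `s` and `s'` has
`E`-component `∇ˡ_X e' - ∇ʳ_{Y'} e` and vertical part `∇ˡ_X k' - ∇ʳ_{Y'} k + κ ∘ R(e, e', ·)`.
The Leibniz rule is the one of `∇ˡ` and `∇ʳ`, and the prescribed values on lifts come out at once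
(`isLiftedAlgebroid_liftedAlgebroid`). Uniqueness holds because lifts span `𝒯` (`eq_zero_of_lifts`).

*The symplectic form.* Differentiating `κ ↦ κ(e')` along `X` gives `κ(∇ˡ_X e') + k(e')`
(`mvfderiv_apply_section`), and likewise on the right; the terms with `∇ˡ`, `∇ʳ` cancel against `λ` of the
bracket. So `-d^{lr}λ (s, s') = k'(e) - k(e')` (`dlr_liouville`), which is skew-symmetric and
nondegenerate, and whose expression in a lifted frame is the canonical one.
-/

namespace LRAlgebroid

open Module Filter Topology

/-! ### Smooth functions and sections: cut-offs and smoothness criteria -/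

section Calculus

variable {EB : Type*} [NormedAddCommGroup EB] [NormedSpace ℝ EB]
  {H : Type*} [TopologicalSpace H] {I : ModelWithCorners ℝ EB H}
  {M : Type*} [TopologicalSpace M] [ChartedSpace H M]

theorem mvfderiv_congr_nhds {G : Type*} [NormedAddCommGroup G] [NormedSpace ℝ G] {f g : M → G}
    {x : M} (h : ∀ᶠ y in 𝓝 x, f y = g y) : mvfderiv I f x = mvfderiv I g x := by
  have h1 : mfderiv I 𝓘(ℝ, G) f x = mfderiv I 𝓘(ℝ, G) g x := Filter.EventuallyEq.mfderiv_eq h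
  ext X
  exact congrArg (fun L => L X) h1

theorem mvfderiv_mul_apply {f g : M → ℝ} {x : M} (hf : ContMDiff I 𝓘(ℝ, ℝ) ∞ f)
    (hg : ContMDiff I 𝓘(ℝ, ℝ) ∞ g) (X : TangentSpace I x) :
    mvfderiv I (fun y => f y * g y) x X = f x * mvfderiv I g x X + g x * mvfderiv I f x X := by
  have := mvfderiv_fun_mul (hf.mdifferentiable (by simp) x) (hg.mdifferentiable (by simp) x)
  rw [this]; rfl

theorem mvfderiv_add_apply {f g : M → ℝ} {x : M} (hf : ContMDiff I 𝓘(ℝ, ℝ) ∞ f)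
    (hg : ContMDiff I 𝓘(ℝ, ℝ) ∞ g) (X : TangentSpace I x) :
    mvfderiv I (fun y => f y + g y) x X = mvfderiv I f x X + mvfderiv I g x X := by
  have := mvfderiv_fun_add (hf.mdifferentiable (by simp) x) (hg.mdifferentiable (by simp) x)
  rw [this]; rfl

theorem mvfderiv_const_mul_apply {f : M → ℝ} {x : M} (c : ℝ) (hf : ContMDiff I 𝓘(ℝ, ℝ) ∞ f)
    (X : TangentSpace I x) :
    mvfderiv I (fun y => c * f y) x X = c * mvfderiv I f x X := by
  rw [mvfderiv_mul_apply contMDiff_const hf, mvfderiv_const]; simp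

theorem mvfderiv_sum_apply {ι : Type*} {f : ι → M → ℝ} {x : M} (s : Finset ι)
    (hf : ∀ i, ContMDiff I 𝓘(ℝ, ℝ) ∞ (f i)) (X : TangentSpace I x) :
    mvfderiv I (fun y => ∑ i ∈ s, f i y) x X = ∑ i ∈ s, mvfderiv I (f i) x X := by
  classical
  induction s using Finset.induction_on with
  | empty => simp [mvfderiv_const]
  | insert a s ha ih =>
    simp only [Finset.sum_insert ha]
    rw [mvfderiv_add_apply (hf a) (contMDiff_finsetSum fun i _ => hf i), ih]

theorem mvfderiv_comp_apply {EB' : Type*} [NormedAddCommGroup EB'] [NormedSpace ℝ EB']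
    {H' : Type*} [TopologicalSpace H'] {I' : ModelWithCorners ℝ EB' H'}
    {M' : Type*} [TopologicalSpace M'] [ChartedSpace H' M'] {p : M' → M} {f : M → ℝ} {x : M'}
    (hf : ContMDiff I 𝓘(ℝ, ℝ) ∞ f) (hp : ContMDiff I' I ∞ p) (X : TangentSpace I' x) :
    mvfderiv I' (fun y => f (p y)) x X = mvfderiv I f (p x) (mfderiv I' I p x X) := by
  have := mfderiv_comp x (hf.mdifferentiable (by simp) (p x)) (hp.mdifferentiable (by simp) x)
  exact congrArg (fun L => L X) this

/-- The derivative of a smooth function along a smooth vector field is smooth. -/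
theorem contMDiffAt_mvfderiv_apply [IsManifold I ∞ M] {f : M → ℝ} (hf : ContMDiff I 𝓘(ℝ, ℝ) ∞ f)
    {X : ∀ x, TangentSpace I x} {x₀ : M}
    (hX : ContMDiffAt I (I.prod 𝓘(ℝ, EB)) ∞ (fun x => TotalSpace.mk' EB x (X x)) x₀) :
    ContMDiffAt I 𝓘(ℝ, ℝ) ∞ (fun x => mvfderiv I f x (X x)) x₀ := by
  have h1 : ContMDiff I.tangent 𝓘(ℝ, ℝ).tangent ∞ (tangentMap I 𝓘(ℝ, ℝ) f) :=
    hf.contMDiff_tangentMap (by simp)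
  have h2 := contMDiff_snd_tangentBundle_modelSpace ℝ 𝓘(ℝ, ℝ) (n := ∞)
  exact ((h2.comp h1).contMDiffAt (x := (⟨x₀, X x₀⟩ : TangentBundle I M))).comp x₀ hX

variable [FiniteDimensional ℝ EB] [IsManifold I ∞ M] [T2Space M]

variable (I) in
/-- A cut-off function: equal to `1` near `x` and supported in a given neighbourhood of `x`. -/
theorem exists_cutoff {x : M} {U : Set M} (hU : U ∈ 𝓝 x) :
    ∃ χ : C^∞⟮I, M; ℝ⟯, (∀ᶠ y in 𝓝 x, χ y = 1) ∧ tsupport χ ⊆ U := by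
  obtain ⟨f, -, hf⟩ := (SmoothBumpFunction.nhds_basis_tsupport (I := I) x).mem_iff.1 hU
  exact ⟨⟨f, f.contMDiff⟩, f.eventuallyEq_one, hf⟩

end Calculus

section Sections

variable {EB : Type*} [NormedAddCommGroup EB] [NormedSpace ℝ EB]
  {H : Type*} [TopologicalSpace H] {I : ModelWithCorners ℝ EB H}
  {M : Type*} [TopologicalSpace M] [ChartedSpace H M] [IsManifold I ∞ M]
  {F : Type*} [NormedAddCommGroup F] [NormedSpace ℝ F]
  {V : M → Type*} [∀ x, AddCommGroup (V x)] [∀ x, Module ℝ (V x)]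
  [∀ x, TopologicalSpace (V x)] [∀ x, IsTopologicalAddGroup (V x)] [∀ x, ContinuousSMul ℝ (V x)]
  [TopologicalSpace (TotalSpace F V)] [FiberBundle F V] [VectorBundle ℝ F V]
  {W' : Type*} [NormedAddCommGroup W'] [NormedSpace ℝ W']
  {W : M → Type*} [∀ x, AddCommGroup (W x)] [∀ x, Module ℝ (W x)]
  [∀ x, TopologicalSpace (W x)] [∀ x, IsTopologicalAddGroup (W x)] [∀ x, ContinuousSMul ℝ (W x)]
  [TopologicalSpace (TotalSpace W' W)] [FiberBundle W' W] [VectorBundle ℝ W' W]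

theorem smulSection_apply (f : C^∞⟮I, M; ℝ⟯) (σ : Cₛ^∞⟮I; F, V⟯) (x : M) :
    (f • σ) x = f x • σ x := rfl

/-- A function into the total space of the trivial line bundle is a function. -/
theorem contMDiffAt_trivial_iff {EB' : Type*} [NormedAddCommGroup EB'] [NormedSpace ℝ EB']
    {H' : Type*} [TopologicalSpace H'] {I' : ModelWithCorners ℝ EB' H'}
    {M' : Type*} [TopologicalSpace M'] [ChartedSpace H' M'] {p : M' → M} {f : M' → ℝ} {x₀ : M'}
    (hp : ContMDiffAt I' I ∞ p x₀) :
    ContMDiffAt I' (I.prod 𝓘(ℝ, ℝ)) ∞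
      (fun y => TotalSpace.mk' ℝ (E := fun _ : M => ℝ) (p y) (f y)) x₀ ↔
    ContMDiffAt I' 𝓘(ℝ, ℝ) ∞ f x₀ := by
  rw [contMDiffAt_totalSpace]
  exact ⟨fun h => h.2, fun h => ⟨hp, h⟩⟩

/-- A family of linear maps on a finite-dimensional space is smooth if its values on a basis are. -/
theorem contMDiffAt_clm_of_basis {EB' : Type*} [NormedAddCommGroup EB'] [NormedSpace ℝ EB']
    {H' : Type*} [TopologicalSpace H'] {I' : ModelWithCorners ℝ EB' H'}
    {M' : Type*} [TopologicalSpace M'] [ChartedSpace H' M'] [FiniteDimensional ℝ F]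
    {L : M' → F →L[ℝ] W'} {x₀ : M'}
    (h : ∀ i, ContMDiffAt I' 𝓘(ℝ, W') ∞ (fun x => L x (finBasis ℝ F i)) x₀) :
    ContMDiffAt I' 𝓘(ℝ, F →L[ℝ] W') ∞ L x₀ := by
  have h1 : L = fun x => ∑ i,
      (ContinuousLinearMap.smulRightL ℝ F W' ((finBasis ℝ F).coord i).toContinuousLinearMap)
        (L x (finBasis ℝ F i)) := by
    funext x
    refine ContinuousLinearMap.coe_injective ((finBasis ℝ F).ext fun j => ?_)
    simp [Finsupp.single_apply, ite_smul]
  rw [h1]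
  exact contMDiffAt_finsetSum fun i _ => contMDiffAt_const.clm_apply (h i)

theorem symm_finBasis_contMDiffAt [FiniteDimensional ℝ F] [ContMDiffVectorBundle ∞ F V I] {x y : M}
    (hy : y ∈ (trivializationAt F V x).baseSet) (v : F) :
    ContMDiffAt I (I.prod 𝓘(ℝ, F)) ∞
      (fun z => TotalSpace.mk' F z ((trivializationAt F V x).symm z v)) y := by
  rw [(trivializationAt F V x).contMDiffAt_section_iff hy]
  refine (contMDiffAt_const (c := v)).congr_of_eventuallyEq ?_
  filter_upwards [(trivializationAt F V x).open_baseSet.mem_nhds hy] with z hz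
  rw [Trivialization.mk_symm _ hz, Trivialization.apply_symm_apply']
  exact hz

/-- A family of fibrewise linear maps is smooth at a point as soon as it sends the frame of a
trivialization to smooth sections. -/
theorem contMDiffAt_hom_of_symm [FiniteDimensional ℝ F] {φ : ∀ x, V x →L[ℝ] W x} {x₀ : M}
    (h : ∀ i, ContMDiffAt I (I.prod 𝓘(ℝ, W')) ∞ (fun z => TotalSpace.mk' W' z
      (φ z ((trivializationAt F V x₀).symm z (finBasis ℝ F i)))) x₀) :
    ContMDiffAt I (I.prod 𝓘(ℝ, F →L[ℝ] W')) ∞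
      (fun x => TotalSpace.mk' (F →L[ℝ] W') (E := fun x => V x →L[ℝ] W x) x (φ x)) x₀ := by
  rw [contMDiffAt_hom_bundle]
  refine ⟨contMDiffAt_id, contMDiffAt_clm_of_basis fun i => ?_⟩
  refine ((contMDiffAt_section x₀).1 (h i)).congr_of_eventuallyEq ?_
  filter_upwards [(trivializationAt F V x₀).open_baseSet.mem_nhds
      (FiberBundle.mem_baseSet_trivializationAt' x₀),
    (trivializationAt W' W x₀).open_baseSet.mem_nhds
      (FiberBundle.mem_baseSet_trivializationAt' x₀)] with z hz hz'
  rw [ContinuousLinearMap.inCoordinates_eq hz hz']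
  simp

/-- Local form of the smoothness criterion for families of fibrewise linear maps. -/
theorem contMDiffAt_hom_of_local [FiniteDimensional ℝ F] [ContMDiffVectorBundle ∞ F V I]
    {φ : ∀ x, V x →L[ℝ] W x} {x₀ : M}
    (h : ∀ s : ∀ x, V x,
      ContMDiffAt I (I.prod 𝓘(ℝ, F)) ∞ (fun x => TotalSpace.mk' F x (s x)) x₀ →
      ContMDiffAt I (I.prod 𝓘(ℝ, W')) ∞ (fun x => TotalSpace.mk' W' x (φ x (s x))) x₀) :
    ContMDiffAt I (I.prod 𝓘(ℝ, F →L[ℝ] W')) ∞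
      (fun x => TotalSpace.mk' (F →L[ℝ] W') (E := fun x => V x →L[ℝ] W x) x (φ x)) x₀ :=
  contMDiffAt_hom_of_symm fun _ => h _
    (symm_finBasis_contMDiffAt (FiberBundle.mem_baseSet_trivializationAt' x₀) _)

variable [FiniteDimensional ℝ EB] [T2Space M]

/-- Every local section agrees near a given point with a global one. -/
theorem exists_section_eventuallyEq {s : ∀ x, V x} {U : Set M} {x : M} (hU : IsOpen U) (hx : x ∈ U)
    (hs : ∀ y ∈ U, ContMDiffAt I (I.prod 𝓘(ℝ, F)) ∞ (fun z => TotalSpace.mk' F z (s z)) y) :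
    ∃ σ : Cₛ^∞⟮I; F, V⟯, ∀ᶠ y in 𝓝 x, σ y = s y := by
  obtain ⟨χ, h1, h2⟩ := exists_cutoff I (hU.mem_nhds hx)
  refine ⟨⟨fun y => χ y • s y, fun y => ?_⟩, ?_⟩
  · by_cases hy : y ∈ tsupport χ
    · exact χ.contMDiff.contMDiffAt.smul_section (hs y (h2 hy))
    · have h3 : ∀ᶠ z in 𝓝 y, χ z = 0 := by
        filter_upwards [(isClosed_tsupport χ).isOpen_compl.mem_nhds hy] with z hz
        exact image_eq_zero_of_notMem_tsupport hz
      refine (contMDiffAt_zeroSection ℝ V (x := y)).congr_of_eventuallyEq ?_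
      filter_upwards [h3] with z hz
      simp [hz, zeroSection]
  · filter_upwards [h1] with y hy
    change χ y • s y = s y
    rw [hy, one_smul]

/-- Every locally defined smooth function agrees near a given point with a global one. -/
theorem exists_fun_eventuallyEq {f : M → ℝ} {U : Set M} {x : M} (hU : IsOpen U) (hx : x ∈ U)
    (hf : ∀ y ∈ U, ContMDiffAt I 𝓘(ℝ, ℝ) ∞ f y) :
    ∃ g : C^∞⟮I, M; ℝ⟯, ∀ᶠ y in 𝓝 x, g y = f y := by
  obtain ⟨χ, h1, h2⟩ := exists_cutoff I (hU.mem_nhds hx)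
  refine ⟨⟨fun y => χ y * f y, fun y => ?_⟩, ?_⟩
  · by_cases hy : y ∈ tsupport χ
    · exact χ.contMDiff.contMDiffAt.mul (hf y (h2 hy))
    · refine (contMDiffAt_const (c := (0 : ℝ))).congr_of_eventuallyEq ?_
      filter_upwards [(isClosed_tsupport χ).isOpen_compl.mem_nhds hy] with z hz
      rw [image_eq_zero_of_notMem_tsupport hz, zero_mul]
  · filter_upwards [h1] with y hy
    change χ y * f y = f y
    rw [hy, one_mul]

variable [FiniteDimensional ℝ F] [ContMDiffVectorBundle ∞ F V I]

/-- Around any point there are global sections of `V` and of `V*` that restrict near the point to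
the frame of a trivialization and its dual frame. -/
theorem exists_dual_frames (I : ModelWithCorners ℝ EB H) [IsManifold I ∞ M]
    [ContMDiffVectorBundle ∞ F V I] (x : M) :
    ∃ (σ : Fin (finrank ℝ F) → Cₛ^∞⟮I; F, V⟯)
      (θ : Fin (finrank ℝ F) → Cₛ^∞⟮I; F →L[ℝ] ℝ, DualBundle V⟯),
      ∀ᶠ y in 𝓝 x, y ∈ (trivializationAt F V x).baseSet ∧
        (∀ i, σ i y = (trivializationAt F V x).symm y (finBasis ℝ F i)) ∧
        ∀ i v, θ i y v = (finBasis ℝ F).repr (trivializationAt F V x ⟨y, v⟩).2 i := by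
  have hx := FiberBundle.mem_baseSet_trivializationAt' (F := F) (E := V) x
  have ho := (trivializationAt F V x).open_baseSet
  have h1 : ∀ i, ∃ σ : Cₛ^∞⟮I; F, V⟯, ∀ᶠ y in 𝓝 x,
      σ y = (trivializationAt F V x).symm y (finBasis ℝ F i) := fun i =>
    exists_section_eventuallyEq ho hx fun y hy => symm_finBasis_contMDiffAt hy _
  let c (i : Fin (finrank ℝ F)) (y : M) : V y →L[ℝ] ℝ :=
    ((finBasis ℝ F).coord i).toContinuousLinearMap.comp
      ((trivializationAt F V x).continuousLinearMapAt ℝ y)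
  have h2 : ∀ i, ∃ θ : Cₛ^∞⟮I; F →L[ℝ] ℝ, DualBundle V⟯, ∀ᶠ y in 𝓝 x, θ y = c i y := fun i =>
    exists_section_eventuallyEq ho hx fun y hy => by
      refine contMDiffAt_hom_of_local fun s hs => ?_
      refine (contMDiffAt_trivial_iff (p := fun z => z) contMDiffAt_id).2 ?_
      rw [(trivializationAt F V x).contMDiffAt_section_iff hy] at hs
      have h3 := (((finBasis ℝ F).coord i).toContinuousLinearMap.contMDiff (n := ∞)).contMDiffAt.comp
        y hs
      refine h3.congr_of_eventuallyEq ?_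
      filter_upwards [ho.mem_nhds hy] with z hz
      simp [c, Trivialization.coe_linearMapAt_of_mem _ hz]
  choose σ hσ using h1
  choose θ hθ using h2
  refine ⟨σ, θ, ?_⟩
  filter_upwards [ho.mem_nhds hx, eventually_all.2 hσ, eventually_all.2 hθ] with y hy h3 h4
  refine ⟨hy, h3, fun i v => ?_⟩
  rw [h4 i]
  simp [c, Trivialization.coe_linearMapAt_of_mem _ hy]

end Sections

/-! ### Tensoriality and duality -/

section Tensoriality

variable {EB : Type*} [NormedAddCommGroup EB] [NormedSpace ℝ EB] [FiniteDimensional ℝ EB]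
  {H : Type*} [TopologicalSpace H] {I : ModelWithCorners ℝ EB H}
  {M : Type*} [TopologicalSpace M] [ChartedSpace H M] [IsManifold I ∞ M] [T2Space M]
  {F : Type*} [NormedAddCommGroup F] [NormedSpace ℝ F] [FiniteDimensional ℝ F]
  {V : M → Type*} [∀ x, AddCommGroup (V x)] [∀ x, Module ℝ (V x)]
  [∀ x, TopologicalSpace (V x)] [∀ x, IsTopologicalAddGroup (V x)] [∀ x, ContinuousSMul ℝ (V x)]
  [TopologicalSpace (TotalSpace F V)] [FiberBundle F V] [VectorBundle ℝ F V]
  [ContMDiffVectorBundle ∞ F V I]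
  {W' : Type*} [NormedAddCommGroup W'] [NormedSpace ℝ W']
  {W : M → Type*} [∀ x, AddCommGroup (W x)] [∀ x, Module ℝ (W x)]
  [∀ x, TopologicalSpace (W x)] [∀ x, IsTopologicalAddGroup (W x)] [∀ x, ContinuousSMul ℝ (W x)]
  [TopologicalSpace (TotalSpace W' W)] [FiberBundle W' W] [VectorBundle ℝ W' W]

/-- A vector is recovered from its coordinates in a trivialization. -/
theorem symm_finBasis_expansion {x y : M} (hy : y ∈ (trivializationAt F V x).baseSet) (v : V y) :
    v = ∑ i, (finBasis ℝ F).repr (trivializationAt F V x ⟨y, v⟩).2 i •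
      (trivializationAt F V x).symm y (finBasis ℝ F i) := by
  simp only [← Trivialization.symmL_apply (R := ℝ) _ hy, ← map_smul, ← map_sum, Basis.sum_repr]
  have := (trivializationAt F V x).symmL_continuousLinearMapAt (R := ℝ) hy v
  rw [Trivialization.continuousLinearMapAt_apply, Trivialization.coe_linearMapAt_of_mem _ hy] at this
  exact this.symm

/-- Around any point the identity of `V` is a sum `∑ θᵢ ⊗ σᵢ` with globally defined smooth sections
`σᵢ` of `V` and `θᵢ` of `V*`. -/
theorem exists_frame_expansion (I : ModelWithCorners ℝ EB H) [IsManifold I ∞ M]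
    [ContMDiffVectorBundle ∞ F V I] (x : M) :
    ∃ (σ : Fin (finrank ℝ F) → Cₛ^∞⟮I; F, V⟯)
      (θ : Fin (finrank ℝ F) → Cₛ^∞⟮I; F →L[ℝ] ℝ, DualBundle V⟯),
      ∀ᶠ y in 𝓝 x, ∀ v : V y, v = ∑ i, θ i y v • σ i y := by
  obtain ⟨σ, θ, h⟩ := exists_dual_frames (F := F) (V := V) I x
  refine ⟨σ, θ, ?_⟩
  filter_upwards [h] with y hy v
  simp only [hy.2.1, hy.2.2]
  exact symm_finBasis_expansion hy.1 v

omit [FiniteDimensional ℝ EB] [T2Space M] [FiniteDimensional ℝ F] in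
theorem sum_section_apply {ι : Type*} (s : Finset ι) (σ : ι → Cₛ^∞⟮I; F, V⟯) (x : M) :
    (∑ i ∈ s, σ i) x = ∑ i ∈ s, σ i x := by
  have h3 := congrFun (map_sum (ContMDiffSection.coeAddHom I F ∞ V) σ s) x
  rw [Finset.sum_apply] at h3
  exact h3

variable (I F) in
theorem exists_section_apply_eq {x : M} (v : V x) : ∃ σ : Cₛ^∞⟮I; F, V⟯, σ x = v := by
  obtain ⟨σ, θ, h⟩ := exists_frame_expansion (F := F) (V := V) I x
  refine ⟨∑ i, θ i x v • σ i, ?_⟩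
  rw [sum_section_apply]
  exact (h.self_of_nhds v).symm

/-- The smooth function `θ(s)`. -/
noncomputable def pairing (θ : Cₛ^∞⟮I; F →L[ℝ] ℝ, DualBundle V⟯) (s : Cₛ^∞⟮I; F, V⟯) : C^∞⟮I, M; ℝ⟯ :=
  ⟨fun y => θ y (s y), fun y => (contMDiffAt_trivial_iff (p := fun z => z) contMDiffAt_id).1
    ((θ.contMDiff y).clm_bundle_apply (s.contMDiff y))⟩

theorem pairing_apply (θ : Cₛ^∞⟮I; F →L[ℝ] ℝ, DualBundle V⟯) (s : Cₛ^∞⟮I; F, V⟯) (y : M) :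
    pairing θ s y = θ y (s y) := rfl

theorem contMDiff_pairing (θ : Cₛ^∞⟮I; F →L[ℝ] ℝ, DualBundle V⟯) (s : Cₛ^∞⟮I; F, V⟯) :
    ContMDiff I 𝓘(ℝ, ℝ) ∞ (fun y => θ y (s y)) := (pairing θ s).contMDiff

/-- The expansion of a section in a local frame, made global with a cut-off. -/
theorem cutoff_smul_eq_sum {σ : Fin (finrank ℝ F) → Cₛ^∞⟮I; F, V⟯}
    {θ : Fin (finrank ℝ F) → Cₛ^∞⟮I; F →L[ℝ] ℝ, DualBundle V⟯} {χ : C^∞⟮I, M; ℝ⟯}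
    (h : ∀ y ∈ tsupport χ, ∀ v : V y, v = ∑ i, θ i y v • σ i y) (s : Cₛ^∞⟮I; F, V⟯) :
    χ • s = ∑ i, (χ * pairing (θ i) s) • σ i := by
  refine ContMDiffSection.ext fun y => ?_
  simp only [sum_section_apply, smulSection_apply, ContMDiffMap.coe_mul, Pi.mul_apply,
    pairing_apply, mul_smul, ← Finset.smul_sum]
  by_cases hy : y ∈ tsupport χ
  · exact congrArg (χ y • ·) (h y hy (s y))
  · rw [image_eq_zero_of_notMem_tsupport hy, zero_smul, zero_smul]

/-- Global smoothness criterion for families of fibrewise linear maps. -/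
theorem contMDiff_hom_of_sections {φ : ∀ x, V x →L[ℝ] W x}
    (h : ∀ s : Cₛ^∞⟮I; F, V⟯,
      ContMDiff I (I.prod 𝓘(ℝ, W')) ∞ (fun x => TotalSpace.mk' W' x (φ x (s x)))) :
    ContMDiff I (I.prod 𝓘(ℝ, F →L[ℝ] W')) ∞
      (fun x => TotalSpace.mk' (F →L[ℝ] W') (E := fun x => V x →L[ℝ] W x) x (φ x)) := by
  intro x
  obtain ⟨σ, θ, hσ⟩ := exists_dual_frames (F := F) (V := V) I x
  refine contMDiffAt_hom_of_symm fun i => ((h (σ i)) x).congr_of_eventuallyEq ?_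
  filter_upwards [hσ] with y hy
  rw [hy.2.1 i]

/-- An `ℝ`-linear map `L` on sections with `L(f s) = f(x) L(s)` is the evaluation of a continuous
linear map on the values of sections at `x`. -/
theorem exists_clm_of_tensorial {G : Type*} [AddCommGroup G] [Module ℝ G] [TopologicalSpace G]
    [IsTopologicalAddGroup G] [ContinuousSMul ℝ G] {x : M} (L : Cₛ^∞⟮I; F, V⟯ →ₗ[ℝ] G)
    (hL : ∀ (f : C^∞⟮I, M; ℝ⟯) (s : Cₛ^∞⟮I; F, V⟯), L (f • s) = f x • L s) :
    ∃ ℓ : V x →L[ℝ] G, ∀ s, L s = ℓ (s x) := by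
  obtain ⟨σ, θ, h⟩ := exists_frame_expansion (F := F) (V := V) I x
  obtain ⟨χ, hχ, hsupp⟩ := exists_cutoff I h
  have hχx : χ x = 1 := hχ.self_of_nhds
  refine ⟨∑ i, (θ i x).smulRight (L (σ i)), fun s => ?_⟩
  have h2 : L s = L (χ • s) := by rw [hL, hχx, one_smul]
  rw [h2, cutoff_smul_eq_sum fun y hy => hsupp hy, map_sum]
  simp [hL, hχx, pairing_apply]

/-- A map of sections that is linear over smooth functions is given by a bundle morphism. -/
theorem exists_hom_of_tensorial (T : Cₛ^∞⟮I; F, V⟯ →ₗ[ℝ] Cₛ^∞⟮I; W', W⟯)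
    (hT : ∀ (f : C^∞⟮I, M; ℝ⟯) (s : Cₛ^∞⟮I; F, V⟯), T (f • s) = f • T s) :
    ∃ φ : Cₛ^∞⟮I; F →L[ℝ] W', fun x => V x →L[ℝ] W x⟯, ∀ s x, T s x = φ x (s x) := by
  have h1 : ∀ x, ∃ ℓ : V x →L[ℝ] W x, ∀ s, T s x = ℓ (s x) := fun x =>
    exists_clm_of_tensorial
      (L := { toFun := fun s => T s x
              map_add' := fun s t => by rw [map_add]; rfl
              map_smul' := fun c s => by rw [map_smul]; rfl })
      (fun f s => congrArg (fun t : Cₛ^∞⟮I; W', W⟯ => t x) (hT f s))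
  choose φ hφ using h1
  refine ⟨⟨φ, contMDiff_hom_of_sections fun s => ?_⟩, fun s x => hφ x s⟩
  simp only [← hφ]
  exact (T s).contMDiff

variable (I F) in
/-- The expansion of a form in the dual frame. -/
theorem form_expansion {x : M} {σ : Fin (finrank ℝ F) → Cₛ^∞⟮I; F, V⟯}
    {θ : Fin (finrank ℝ F) → Cₛ^∞⟮I; F →L[ℝ] ℝ, DualBundle V⟯}
    (h : ∀ v : V x, v = ∑ i, θ i x v • σ i x) (ν : DualBundle V x) :
    ν = ∑ i, ν (σ i x) • θ i x := by
  ext v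
  conv_lhs => rw [h v]
  simp [mul_comm]

variable (F) in
/-- The fibres of `V` are reflexive. -/
theorem exists_forall_form_apply_eq (I : ModelWithCorners ℝ EB H) [IsManifold I ∞ M]
    [ContMDiffVectorBundle ∞ F V I] {x : M} (ℓ : (V x →L[ℝ] ℝ) →ₗ[ℝ] ℝ) :
    ∃ v : V x, ∀ ν : V x →L[ℝ] ℝ, ν v = ℓ ν := by
  obtain ⟨σ, θ, h⟩ := exists_frame_expansion (F := F) (V := V) I x
  refine ⟨∑ i, ℓ (θ i x) • σ i x, fun ν => ?_⟩
  conv_rhs => rw [form_expansion I F h.self_of_nhds ν]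
  simp [mul_comm]

variable (F) in
/-- Continuity of the flipped bilinear map holds because the fibres of `V` have finite frames. -/
theorem exists_flip (I : ModelWithCorners ℝ EB H) [IsManifold I ∞ M]
    [ContMDiffVectorBundle ∞ F V I] {G : Type*} [AddCommGroup G] [Module ℝ G] [TopologicalSpace G]
    [IsTopologicalAddGroup G] [ContinuousSMul ℝ G] {x : M} (ℓ : V x →L[ℝ] G →L[ℝ] ℝ) :
    ∃ ℓ' : G →L[ℝ] V x →L[ℝ] ℝ, ∀ g v, ℓ' g v = ℓ v g := by
  obtain ⟨σ, θ, h⟩ := exists_frame_expansion (F := F) (V := V) I x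
  refine ⟨∑ i, (ℓ (σ i x)).smulRight (θ i x), fun g v => ?_⟩
  conv_rhs => rw [h.self_of_nhds v]
  simp [mul_comm]

variable (F) in
theorem eq_of_forall_form_apply_eq (I : ModelWithCorners ℝ EB H) [IsManifold I ∞ M]
    [ContMDiffVectorBundle ∞ F V I] {x : M} {u v : V x} (h : ∀ ν : V x →L[ℝ] ℝ, ν u = ν v) :
    u = v := by
  obtain ⟨σ, θ, h'⟩ := exists_frame_expansion (F := F) (V := V) I x
  rw [h'.self_of_nhds u, h'.self_of_nhds v]
  simp [h (θ _ x)]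

/-- A map into the total space of `V` is smooth if its base map is and all smooth sections of `V*`
take smooth values on it. -/
theorem contMDiffAt_of_forms {EB' : Type*} [NormedAddCommGroup EB'] [NormedSpace ℝ EB']
    {H' : Type*} [TopologicalSpace H'] {I' : ModelWithCorners ℝ EB' H'}
    {M' : Type*} [TopologicalSpace M'] [ChartedSpace H' M'] {p : M' → M} {v : ∀ y, V (p y)}
    {y₀ : M'} (hp : ContMDiffAt I' I ∞ p y₀)
    (h : ∀ ν : Cₛ^∞⟮I; F →L[ℝ] ℝ, DualBundle V⟯,
      ContMDiffAt I' 𝓘(ℝ, ℝ) ∞ (fun y => ν (p y) (v y)) y₀) :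
    ContMDiffAt I' (I.prod 𝓘(ℝ, F)) ∞ (fun y => TotalSpace.mk' F (p y) (v y)) y₀ := by
  obtain ⟨σ, θ, hθ⟩ := exists_dual_frames (F := F) (V := V) I (p y₀)
  rw [contMDiffAt_totalSpace]
  refine ⟨hp, ?_⟩
  have h1 : ContMDiffAt I' 𝓘(ℝ, F) ∞
      (fun y => ∑ i, θ i (p y) (v y) • finBasis ℝ F i) y₀ :=
    contMDiffAt_finsetSum fun i _ => (h (θ i)).smul contMDiffAt_const
  refine h1.congr_of_eventuallyEq ?_
  filter_upwards [hp.continuousAt.eventually hθ] with y hy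
  simp only [hy.2.2, Basis.sum_repr]

/-- Evaluation of a smooth form on a smooth map into the total space. -/
theorem contMDiffAt_form_apply {EB' : Type*} [NormedAddCommGroup EB'] [NormedSpace ℝ EB']
    {H' : Type*} [TopologicalSpace H'] {I' : ModelWithCorners ℝ EB' H'}
    {M' : Type*} [TopologicalSpace M'] [ChartedSpace H' M'] {p : M' → M}
    {ν : ∀ y, DualBundle V (p y)} {v : ∀ y, V (p y)} {y₀ : M'} (hp : ContMDiffAt I' I ∞ p y₀)
    (hν : ContMDiffAt I' (I.prod 𝓘(ℝ, F →L[ℝ] ℝ)) ∞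
      (fun y => TotalSpace.mk' (F →L[ℝ] ℝ) (E := DualBundle V) (p y) (ν y)) y₀)
    (hv : ContMDiffAt I' (I.prod 𝓘(ℝ, F)) ∞ (fun y => TotalSpace.mk' F (p y) (v y)) y₀) :
    ContMDiffAt I' 𝓘(ℝ, ℝ) ∞ (fun y => ν y (v y)) y₀ :=
  (contMDiffAt_trivial_iff hp).1 (hν.clm_bundle_apply hv)

end Tensoriality

/-! ### The derivatives attached to an anchored connection -/

section Connection

variable {EB : Type*} [NormedAddCommGroup EB] [NormedSpace ℝ EB] [FiniteDimensional ℝ EB]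
  {H : Type*} [TopologicalSpace H] {I : ModelWithCorners ℝ EB H}
  {Q : Type*} [TopologicalSpace Q] [ChartedSpace H Q] [IsManifold I ∞ Q] [T2Space Q]
  {F : Type*} [NormedAddCommGroup F] [NormedSpace ℝ F] [FiniteDimensional ℝ F]
  {E : Q → Type*} [∀ x, AddCommGroup (E x)] [∀ x, Module ℝ (E x)]
  [∀ x, TopologicalSpace (E x)] [∀ x, IsTopologicalAddGroup (E x)] [∀ x, ContinuousSMul ℝ (E x)]
  [TopologicalSpace (TotalSpace F E)] [FiberBundle F E] [VectorBundle ℝ F E]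
  [ContMDiffVectorBundle ∞ F E I]

namespace AnchoredConnection

variable {ρ : AnchorMap I F E} (D : AnchoredConnection ρ)

theorem exists_covDeriv (γ : Cₛ^∞⟮I; F, E⟯) :
    ∃ φ : Tensor11 I F E, ∀ σ x, D.conn σ γ x = φ x (σ x) :=
  exists_hom_of_tensorial (D.conn.flip γ) fun f s => D.smul_left f s γ

/-- The `(1,1)`-tensor `e ↦ D_e γ`. -/
noncomputable def covDeriv (γ : Cₛ^∞⟮I; F, E⟯) : Tensor11 I F E := (D.exists_covDeriv γ).choose

theorem conn_apply (σ γ : Cₛ^∞⟮I; F, E⟯) (x : Q) : D.conn σ γ x = D.covDeriv γ x (σ x) :=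
  (D.exists_covDeriv γ).choose_spec σ x

theorem covDeriv_add (γ γ' : Cₛ^∞⟮I; F, E⟯) (x : Q) (e : E x) :
    D.covDeriv (γ + γ') x e = D.covDeriv γ x e + D.covDeriv γ' x e := by
  obtain ⟨σ, rfl⟩ := exists_section_apply_eq I F e
  simp only [← conn_apply, map_add]
  rfl

theorem covDeriv_const_smul (c : ℝ) (γ : Cₛ^∞⟮I; F, E⟯) (x : Q) (e : E x) :
    D.covDeriv (c • γ) x e = c • D.covDeriv γ x e := by
  obtain ⟨σ, rfl⟩ := exists_section_apply_eq I F e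
  simp only [← conn_apply, map_smul]
  rfl

theorem covDeriv_smul (f : C^∞⟮I, Q; ℝ⟯) (γ : Cₛ^∞⟮I; F, E⟯) (x : Q) (e : E x) :
    D.covDeriv (f • γ) x e = mvfderiv I f x (ρ x e) • γ x + f x • D.covDeriv γ x e := by
  obtain ⟨σ, rfl⟩ := exists_section_apply_eq I F e
  simp only [← conn_apply, D.leibniz]

theorem exists_covDual_at (ν : Cₛ^∞⟮I; F →L[ℝ] ℝ, DualBundle E⟯) (x : Q) :
    ∃ φ : E x →L[ℝ] E x →L[ℝ] ℝ, ∀ (γ : Cₛ^∞⟮I; F, E⟯) (e : E x), φ e (γ x) =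
      mvfderiv I (fun y => ν y (γ y)) x (ρ x e) - ν x (D.covDeriv γ x e) := by
  obtain ⟨ℓ, hℓ⟩ := exists_clm_of_tensorial (I := I) (F := F) (V := E) (x := x)
    (G := E x →L[ℝ] ℝ)
    { toFun := fun γ => (mvfderiv I (fun y => ν y (γ y)) x).comp (ρ x) -
        (ν x).comp (D.covDeriv γ x)
      map_add' := fun γ γ' => by
        ext e
        have h := mvfderiv_add_apply (x := x) (contMDiff_pairing ν γ) (contMDiff_pairing ν γ')
          (ρ x e)
        simp [covDeriv_add, h]
        ring
      map_smul' := fun c γ => by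
        ext e
        have h := mvfderiv_const_mul_apply (x := x) c (contMDiff_pairing ν γ) (ρ x e)
        simp [covDeriv_const_smul, h]
        ring }
    (fun f γ => by
      ext e
      have h := mvfderiv_mul_apply (x := x) f.contMDiff (contMDiff_pairing ν γ) (ρ x e)
      simp [covDeriv_smul, smulSection_apply, h]
      ring)
  obtain ⟨φ, hφ⟩ := exists_flip F I ℓ
  exact ⟨φ, fun γ e => by rw [hφ, ← hℓ]; rfl⟩

theorem exists_covDual (ν : Cₛ^∞⟮I; F →L[ℝ] ℝ, DualBundle E⟯) :
    ∃ φ : Cₛ^∞⟮I; F →L[ℝ] F →L[ℝ] ℝ, fun x => E x →L[ℝ] E x →L[ℝ] ℝ⟯,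
      ∀ (γ : Cₛ^∞⟮I; F, E⟯) x (e : E x), φ x e (γ x) =
      mvfderiv I (fun y => ν y (γ y)) x (ρ x e) - ν x (D.covDeriv γ x e) := by
  choose φ hφ using D.exists_covDual_at ν
  refine ⟨⟨φ, contMDiff_hom_of_sections fun σ =>
    contMDiff_hom_of_sections fun γ => ?_⟩, fun γ x e => hφ x γ e⟩
  intro x
  refine (contMDiffAt_trivial_iff (p := fun z => z) contMDiffAt_id).2 ?_
  simp only [hφ]
  exact (contMDiffAt_mvfderiv_apply (contMDiff_pairing ν γ)
    ((ρ.contMDiff x).clm_bundle_apply (σ.contMDiff x))).sub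
    (contMDiffAt_form_apply contMDiffAt_id (ν.contMDiff x)
      (((D.covDeriv γ).contMDiff x).clm_bundle_apply (σ.contMDiff x)))

/-- The tensor `(e, v) ↦ (D_e ν)(v)`. -/
noncomputable def covDual (ν : Cₛ^∞⟮I; F →L[ℝ] ℝ, DualBundle E⟯) :
    Cₛ^∞⟮I; F →L[ℝ] F →L[ℝ] ℝ, fun x => E x →L[ℝ] E x →L[ℝ] ℝ⟯ := (D.exists_covDual ν).choose

theorem covDual_apply (ν : Cₛ^∞⟮I; F →L[ℝ] ℝ, DualBundle E⟯) (γ : Cₛ^∞⟮I; F, E⟯) (x : Q)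
    (e : E x) : D.covDual ν x e (γ x) =
      mvfderiv I (fun y => ν y (γ y)) x (ρ x e) - ν x (D.covDeriv γ x e) :=
  (D.exists_covDual ν).choose_spec γ x e

theorem existsUnique_isDualDerivative (σ : Cₛ^∞⟮I; F, E⟯)
    (ν : Cₛ^∞⟮I; F →L[ℝ] ℝ, DualBundle E⟯) : ∃! μ, D.IsDualDerivative σ ν μ := by
  refine ⟨⟨fun x => D.covDual ν x (σ x),
    (D.covDual ν).contMDiff.clm_bundle_apply σ.contMDiff⟩, fun γ x => ?_, fun μ hμ => ?_⟩
  · rw [conn_apply]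
    exact D.covDual_apply ν γ x (σ x)
  · refine ContMDiffSection.ext fun x => ContinuousLinearMap.ext fun v => ?_
    obtain ⟨γ, rfl⟩ := exists_section_apply_eq I F v
    rw [hμ γ x, conn_apply]
    exact (D.covDual_apply ν γ x (σ x)).symm

theorem dual_apply (σ γ : Cₛ^∞⟮I; F, E⟯) (ν : Cₛ^∞⟮I; F →L[ℝ] ℝ, DualBundle E⟯) (x : Q) :
    D.dual σ ν x (γ x) =
      mvfderiv I (fun y => ν y (γ y)) x (ρ x (σ x)) - ν x (D.covDeriv γ x (σ x)) := by
  rw [← conn_apply]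
  exact Classical.epsilon_spec (D.existsUnique_isDualDerivative σ ν).exists γ x

theorem covDual_add (ν ν' : Cₛ^∞⟮I; F →L[ℝ] ℝ, DualBundle E⟯) (x : Q) (e v : E x) :
    D.covDual (ν + ν') x e v = D.covDual ν x e v + D.covDual ν' x e v := by
  obtain ⟨γ, rfl⟩ := exists_section_apply_eq I F v
  have h := mvfderiv_add_apply (x := x) (contMDiff_pairing ν γ) (contMDiff_pairing ν' γ) (ρ x e)
  simp [covDual_apply, h]
  ring

theorem covDual_const_smul (c : ℝ) (ν : Cₛ^∞⟮I; F →L[ℝ] ℝ, DualBundle E⟯) (x : Q) (e v : E x) :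
    D.covDual (c • ν) x e v = c * D.covDual ν x e v := by
  obtain ⟨γ, rfl⟩ := exists_section_apply_eq I F v
  have h := mvfderiv_const_mul_apply (x := x) c (contMDiff_pairing ν γ) (ρ x e)
  simp [covDual_apply, h]
  ring

theorem covDual_smul (f : C^∞⟮I, Q; ℝ⟯) (ν : Cₛ^∞⟮I; F →L[ℝ] ℝ, DualBundle E⟯) (x : Q)
    (e v : E x) :
    D.covDual (f • ν) x e v = mvfderiv I f x (ρ x e) * ν x v + f x * D.covDual ν x e v := by
  obtain ⟨γ, rfl⟩ := exists_section_apply_eq I F v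
  have h := mvfderiv_mul_apply (x := x) f.contMDiff (contMDiff_pairing ν γ) (ρ x e)
  simp [covDual_apply, smulSection_apply, h]
  ring

end AnchoredConnection

end Connection

/-! ### Existence of anchored connections -/

section Existence

variable {EB : Type*} [NormedAddCommGroup EB] [NormedSpace ℝ EB] [FiniteDimensional ℝ EB]
  {H : Type*} [TopologicalSpace H] {I : ModelWithCorners ℝ EB H}
  {Q : Type*} [TopologicalSpace Q] [ChartedSpace H Q] [IsManifold I ∞ Q] [T2Space Q]
  {F : Type*} [NormedAddCommGroup F] [NormedSpace ℝ F] [FiniteDimensional ℝ F]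
  {E : Q → Type*} [∀ x, AddCommGroup (E x)] [∀ x, Module ℝ (E x)]
  [∀ x, TopologicalSpace (E x)] [∀ x, IsTopologicalAddGroup (E x)] [∀ x, ContinuousSMul ℝ (E x)]
  [TopologicalSpace (TotalSpace F E)] [FiberBundle F E] [VectorBundle ℝ F E]
  [ContMDiffVectorBundle ∞ F E I]

/-- The expression `∑ ρ(σ)(θᵢ(γ)) sᵢ`. Where `∑ θᵢ ⊗ sᵢ` is the identity, it is the connection for
which the frame `sᵢ` is parallel. -/
noncomputable def frameDeriv (ρ : AnchorMap I F E) {n : ℕ} (s : Fin n → Cₛ^∞⟮I; F, E⟯)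
    (θ : Fin n → Cₛ^∞⟮I; F →L[ℝ] ℝ, DualBundle E⟯) (σ γ : Cₛ^∞⟮I; F, E⟯) (x : Q) : E x :=
  ∑ i, mvfderiv I (fun y => θ i y (γ y)) x (ρ x (σ x)) • s i x

section

variable (ρ : AnchorMap I F E) {n : ℕ} (s : Fin n → Cₛ^∞⟮I; F, E⟯)
  (θ : Fin n → Cₛ^∞⟮I; F →L[ℝ] ℝ, DualBundle E⟯) (σ σ' γ γ' : Cₛ^∞⟮I; F, E⟯) (x : Q)

theorem contMDiff_frameDeriv : ContMDiff I (I.prod 𝓘(ℝ, F)) ∞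
    (fun x => TotalSpace.mk' F x (frameDeriv ρ s θ σ γ x)) :=
  ContMDiff.sum_section fun i _ x => ContMDiffAt.smul_section
    (contMDiffAt_mvfderiv_apply (contMDiff_pairing (θ i) γ)
      ((ρ.contMDiff x).clm_bundle_apply (σ.contMDiff x))) ((s i).contMDiff x)

theorem frameDeriv_add_left :
    frameDeriv ρ s θ (σ + σ') γ x = frameDeriv ρ s θ σ γ x + frameDeriv ρ s θ σ' γ x := by
  simp [frameDeriv, add_smul, Finset.sum_add_distrib]

theorem frameDeriv_smul_left (c : ℝ) (h : σ' x = c • σ x) :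
    frameDeriv ρ s θ σ' γ x = c • frameDeriv ρ s θ σ γ x := by
  simp [frameDeriv, h, mul_smul, Finset.smul_sum]

theorem frameDeriv_add_right :
    frameDeriv ρ s θ σ (γ + γ') x = frameDeriv ρ s θ σ γ x + frameDeriv ρ s θ σ γ' x := by
  simp only [frameDeriv, ← Finset.sum_add_distrib, ← add_smul]
  refine Finset.sum_congr rfl fun i _ => congrArg (· • s i x) ?_
  rw [← mvfderiv_add_apply (contMDiff_pairing (θ i) γ) (contMDiff_pairing (θ i) γ')]
  simp

theorem frameDeriv_const_smul_right (c : ℝ) :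
    frameDeriv ρ s θ σ (c • γ) x = c • frameDeriv ρ s θ σ γ x := by
  simp only [frameDeriv, Finset.smul_sum, smul_smul]
  refine Finset.sum_congr rfl fun i _ => congrArg (· • s i x) ?_
  rw [← mvfderiv_const_mul_apply c (contMDiff_pairing (θ i) γ)]
  simp

theorem frameDeriv_smul_right (h : ∀ v : E x, v = ∑ i, θ i x v • s i x) (g : C^∞⟮I, Q; ℝ⟯) :
    frameDeriv ρ s θ σ (g • γ) x =
      mvfderiv I g x (ρ x (σ x)) • γ x + g x • frameDeriv ρ s θ σ γ x := by
  have h1 : ∀ i, mvfderiv I (fun y => θ i y ((g • γ) y)) x (ρ x (σ x)) =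
      mvfderiv I g x (ρ x (σ x)) * θ i x (γ x) +
        g x * mvfderiv I (fun y => θ i y (γ y)) x (ρ x (σ x)) := fun i => by
    have := mvfderiv_mul_apply (x := x) g.contMDiff (contMDiff_pairing (θ i) γ) (ρ x (σ x))
    simp only [smulSection_apply, map_smul, smul_eq_mul, this]
    ring
  simp only [frameDeriv, h1, add_smul, Finset.sum_add_distrib, mul_smul, ← Finset.smul_sum]
  rw [← h (γ x)]

end

/-- Every anchored vector bundle over a `σ`-compact base carries a connection: the local
connections with a parallel frame are averaged with a partition of unity. -/
theorem nonempty_anchoredConnection [SigmaCompactSpace Q] (ρ : AnchorMap I F E) :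
    Nonempty (AnchoredConnection ρ) := by
  choose s θ h using exists_frame_expansion (F := F) (V := E) I
  let U : Q → Set Q := fun c => interior {y | ∀ v : E y, v = ∑ i, θ c i y v • s c i y}
  obtain ⟨ψ, hψ⟩ := SmoothPartitionOfUnity.exists_isSubordinate I isClosed_univ U
    (fun c => isOpen_interior) fun c _ => mem_iUnion.2 ⟨c, mem_interior_iff_mem_nhds.2 (h c)⟩
  -- only the frames whose cut-off is nonzero near `x` contribute, so the Leibniz rules of the summands
  -- with `∑ ψ c = 1` add up to the one of `D`
  let D (σ γ : Cₛ^∞⟮I; F, E⟯) (x : Q) : E x := ∑ᶠ c, ψ c x • frameDeriv ρ (s c) (θ c) σ γ x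
  have hD (σ γ : Cₛ^∞⟮I; F, E⟯) (x : Q) :
      D σ γ x = ∑ c ∈ ψ.finsupport x, ψ c x • frameDeriv ρ (s c) (θ c) σ γ x := by
    refine finsum_eq_sum_of_support_subset _ fun c hc => ?_
    rw [SmoothPartitionOfUnity.coe_finsupport]
    exact fun h0 => hc (by simp [h0])
  have hsm (σ γ : Cₛ^∞⟮I; F, E⟯) :
      ContMDiff I (I.prod 𝓘(ℝ, F)) ∞ (fun x => TotalSpace.mk' F x (D σ γ x)) := by
    refine ContMDiff.finsum_section_of_locallyFinite
      (ψ.locallyFinite.subset fun c x hx h0 => hx (by simp [h0])) fun c =>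
        (ψ c).contMDiff.smul_section (contMDiff_frameDeriv ρ (s c) (θ c) σ γ)
  let T (σ γ : Cₛ^∞⟮I; F, E⟯) : Cₛ^∞⟮I; F, E⟯ := ⟨D σ γ, hsm σ γ⟩
  have hT (σ γ : Cₛ^∞⟮I; F, E⟯) (x : Q) :
      T σ γ x = ∑ c ∈ ψ.finsupport x, ψ c x • frameDeriv ρ (s c) (θ c) σ γ x := hD σ γ x
  refine ⟨⟨LinearMap.mk₂ ℝ T ?_ ?_ ?_ ?_, ?_, ?_⟩⟩
  · intro σ σ' γ
    refine ContMDiffSection.ext fun x => ?_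
    simp [hT, frameDeriv_add_left, Finset.sum_add_distrib]
  · intro c σ γ
    refine ContMDiffSection.ext fun x => ?_
    simp [hT, frameDeriv_smul_left ρ _ _ σ (c • σ) γ x c rfl, Finset.smul_sum,
      smul_comm c]
  · intro σ γ γ'
    refine ContMDiffSection.ext fun x => ?_
    simp [hT, frameDeriv_add_right, Finset.sum_add_distrib]
  · intro c σ γ
    refine ContMDiffSection.ext fun x => ?_
    simp [hT, frameDeriv_const_smul_right, Finset.smul_sum, smul_comm c]
  · intro f σ γ
    refine ContMDiffSection.ext fun x => ?_
    simp [hT, frameDeriv_smul_left ρ _ _ σ (f • σ) γ x (f x) rfl, Finset.smul_sum,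
      smul_comm (f x), smulSection_apply]
  · intro g σ γ x
    have h1 : ∀ c ∈ ψ.finsupport x, ψ c x • frameDeriv ρ (s c) (θ c) σ (g • γ) x =
        ψ c x • mvfderiv I g x (ρ x (σ x)) • γ x +
          g x • ψ c x • frameDeriv ρ (s c) (θ c) σ γ x := fun c hc => by
      have hx : x ∈ U c := hψ c (subset_tsupport _ ((ψ.mem_finsupport x).1 hc))
      rw [frameDeriv_smul_right ρ _ _ σ γ x (interior_subset hx), smul_add, smul_comm (g x)]
    have h2 : ∑ c ∈ ψ.finsupport x, ψ c x = 1 := ψ.sum_finsupport x (mem_univ x)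
    simp only [LinearMap.mk₂_apply, hT]
    rw [Finset.sum_congr rfl h1, Finset.sum_add_distrib, ← Finset.sum_smul, h2, one_smul,
      ← Finset.smul_sum]

omit [FiniteDimensional ℝ EB] [T2Space Q] [FiniteDimensional ℝ F] in
theorem AlgebroidStructure.ext' {A A' : AlgebroidStructure I F E} (h : A.bracket = A'.bracket)
    (hl : A.lanchor = A'.lanchor) (hr : A.ranchor = A'.ranchor) : A = A' := by
  cases A
  cases A'
  congr

omit [FiniteDimensional ℝ EB] [T2Space Q] [FiniteDimensional ℝ F] in
theorem AlgebroidStructure.bracket_smul_left (A : AlgebroidStructure I F E) (f : C^∞⟮I, Q; ℝ⟯)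
    (σ σ' : Cₛ^∞⟮I; F, E⟯) (x : Q) : A.bracket (f • σ) σ' x =
      f x • A.bracket σ σ' x - mvfderiv I f x (A.ranchor x (σ' x)) • σ x := by
  have h := A.leibniz f 1 σ σ' x
  have h1 : (1 : C^∞⟮I, Q; ℝ⟯) • σ' = σ' := ContMDiffSection.ext fun y => by
    simp [smulSection_apply]
  have h2 : mvfderiv I (1 : C^∞⟮I, Q; ℝ⟯) x = 0 := mvfderiv_const (1 : ℝ)
  rw [h1, h2] at h
  rw [h]
  simp
  abel

omit [FiniteDimensional ℝ EB] [T2Space Q] [FiniteDimensional ℝ F] in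
theorem AlgebroidStructure.bracket_smul_right (A : AlgebroidStructure I F E) (f : C^∞⟮I, Q; ℝ⟯)
    (σ σ' : Cₛ^∞⟮I; F, E⟯) (x : Q) : A.bracket σ (f • σ') x =
      f x • A.bracket σ σ' x + mvfderiv I f x (A.lanchor x (σ x)) • σ' x := by
  have h := A.leibniz 1 f σ σ' x
  have h1 : (1 : C^∞⟮I, Q; ℝ⟯) • σ = σ := ContMDiffSection.ext fun y => by
    simp [smulSection_apply]
  have h2 : mvfderiv I (1 : C^∞⟮I, Q; ℝ⟯) x = 0 := mvfderiv_const (1 : ℝ)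
  rw [h1, h2] at h
  rw [h]
  simp
  abel

/-- The bracket of an algebroid is the difference of a left and a right connection: the left one is
arbitrary, and `D^r_{σ'} σ = D^l_σ σ' - B(σ, σ')` is then a right connection. -/
theorem AlgebroidStructure.exists_connections [SigmaCompactSpace Q]
    (A : AlgebroidStructure I F E) :
    ∃ (Dl : AnchoredConnection A.lanchor) (Dr : AnchoredConnection A.ranchor),
      ∀ σ σ', A.bracket σ σ' = Dl.conn σ σ' - Dr.conn σ' σ := by
  obtain ⟨Dl⟩ := nonempty_anchoredConnection A.lanchor
  refine ⟨Dl, ⟨Dl.conn.flip - A.bracket.flip, fun f σ γ => ?_, fun g σ γ x => ?_⟩, fun σ σ' => ?_⟩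
  · refine ContMDiffSection.ext fun x => ?_
    simp [Dl.leibniz, A.bracket_smul_right, smulSection_apply, smul_sub]
    abel
  · simp [Dl.smul_left, A.bracket_smul_left, smulSection_apply, smul_sub]
    abel
  · simp

end Existence

/-! ### Tangent vectors of the total space `E*` -/

section DualTotalSpace

theorem mvfderiv_sum_smul_const {EB : Type*} [NormedAddCommGroup EB] [NormedSpace ℝ EB]
    {H : Type*} [TopologicalSpace H] {I : ModelWithCorners ℝ EB H}
    {M : Type*} [TopologicalSpace M] [ChartedSpace H M]
    {G : Type*} [NormedAddCommGroup G] [NormedSpace ℝ G]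
    {ι : Type*} (s : Finset ι) {f : ι → M → ℝ} (v : ι → G) {x : M}
    (hf : ∀ i, ContMDiff I 𝓘(ℝ, ℝ) ∞ (f i)) (X : TangentSpace I x) :
    mvfderiv I (fun y => ∑ i ∈ s, f i y • v i) x X = ∑ i ∈ s, mvfderiv I (f i) x X • v i := by
  classical
  induction s using Finset.induction_on with
  | empty => simp [mvfderiv_const]
  | insert a s ha ih =>
    have h1 : ContMDiff I 𝓘(ℝ, G) ∞ (fun y => f a y • v a) := (hf a).smul contMDiff_const
    have h2 : ContMDiff I 𝓘(ℝ, G) ∞ (fun y => ∑ i ∈ s, f i y • v i) :=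
      contMDiff_finsetSum fun i _ => (hf i).smul contMDiff_const
    simp only [Finset.sum_insert ha]
    rw [mvfderiv_fun_add (h1.mdifferentiable (by simp) x) (h2.mdifferentiable (by simp) x),
      mvfderiv_fun_smul ((hf a).mdifferentiable (by simp) x) mdifferentiableAt_const, ← ih]
    simp [mvfderiv_const]

variable {EB : Type*} [NormedAddCommGroup EB] [NormedSpace ℝ EB] [FiniteDimensional ℝ EB]
  {H : Type*} [TopologicalSpace H] {I : ModelWithCorners ℝ EB H}
  {Q : Type*} [TopologicalSpace Q] [ChartedSpace H Q] [IsManifold I ∞ Q] [T2Space Q]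
  {F : Type*} [NormedAddCommGroup F] [NormedSpace ℝ F] [FiniteDimensional ℝ F]
  {E : Q → Type*} [∀ x, AddCommGroup (E x)] [∀ x, Module ℝ (E x)]
  [∀ x, TopologicalSpace (E x)] [∀ x, IsTopologicalAddGroup (E x)] [∀ x, ContinuousSMul ℝ (E x)]
  [TopologicalSpace (TotalSpace F E)] [FiberBundle F E] [VectorBundle ℝ F E]
  [ContMDiffVectorBundle ∞ F E I]

theorem contMDiff_dualProj : ContMDiff (dualModel I F) I ∞ (dualProj F E) :=
  contMDiff_proj (DualBundle E)

theorem contMDiff_comp_proj (f : C^∞⟮I, Q; ℝ⟯) :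
    ContMDiff (dualModel I F) 𝓘(ℝ, ℝ) ∞ (fun μ : DualTotal F E => f μ.proj) :=
  f.contMDiff.comp contMDiff_dualProj

theorem contMDiff_linearFunction (γ : Cₛ^∞⟮I; F, E⟯) :
    ContMDiff (dualModel I F) 𝓘(ℝ, ℝ) ∞ (linearFunction γ : DualTotal F E → ℝ) := fun κ =>
  contMDiffAt_form_apply (p := dualProj F E) (ν := fun μ => μ.2) (contMDiff_dualProj κ)
    contMDiffAt_id
    (ContMDiffAt.comp (f := dualProj F E) (g := fun y => TotalSpace.mk' F y (γ y)) κ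
      (γ.contMDiff _) (contMDiff_dualProj κ))

theorem mvfderiv_comp_proj (f : C^∞⟮I, Q; ℝ⟯) (κ : DualTotal F E)
    (X : TangentSpace (dualModel I F) κ) :
    mvfderiv (dualModel I F) (fun μ : DualTotal F E => f μ.proj) κ X =
      mvfderiv I f κ.proj (mfderiv (dualModel I F) I (dualProj F E) κ X) :=
  mvfderiv_comp_apply f.contMDiff contMDiff_dualProj X

/-- Near each point of `E*` the chart consists of functions `f ∘ τ` and `γ̂` with globally defined
`f` and `γ`. -/
theorem exists_coordinates (I : ModelWithCorners ℝ EB H) [IsManifold I ∞ Q]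
    [ContMDiffVectorBundle ∞ F E I] (κ₀ : DualTotal F E) :
    ∃ (f : Fin (finrank ℝ EB) → C^∞⟮I, Q; ℝ⟯) (σ : Fin (finrank ℝ F) → Cₛ^∞⟮I; F, E⟯)
      (θ : Fin (finrank ℝ F) → Cₛ^∞⟮I; F →L[ℝ] ℝ, DualBundle E⟯),
      (∀ᶠ y in 𝓝 κ₀.proj, ∀ v : E y, v = ∑ i, θ i y v • σ i y) ∧
      (∀ᶠ y in 𝓝 κ₀.proj, extChartAt I κ₀.proj y = ∑ j, f j y • finBasis ℝ EB j) ∧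
      ∀ᶠ μ in 𝓝 κ₀, extChartAt (dualModel I F) κ₀ μ =
        ∑ j, f j μ.proj • ((finBasis ℝ EB j, 0) : EB × (F →L[ℝ] ℝ)) +
        ∑ i, linearFunction (σ i) μ •
          ((0, ((finBasis ℝ F).coord i).toContinuousLinearMap) : EB × (F →L[ℝ] ℝ)) := by
  obtain ⟨σ, θ, h⟩ := exists_dual_frames (F := F) (V := E) I κ₀.proj
  have hs := (chartAt H κ₀.proj).open_source
  have h1 : ∀ j, ∃ f : C^∞⟮I, Q; ℝ⟯, ∀ᶠ y in 𝓝 κ₀.proj,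
      f y = (finBasis ℝ EB).coord j (extChartAt I κ₀.proj y) := fun j =>
    exists_fun_eventuallyEq hs (mem_chart_source H κ₀.proj) fun y hy =>
      (((finBasis ℝ EB).coord j).toContinuousLinearMap.contMDiff).contMDiffAt.comp y
        (contMDiffAt_extChartAt' hy)
  choose f hf using h1
  have h2 : ∀ᶠ y in 𝓝 κ₀.proj, extChartAt I κ₀.proj y = ∑ j, f j y • finBasis ℝ EB j := by
    filter_upwards [eventually_all.2 hf] with y hy
    simp only [hy, Basis.coord_apply, Basis.sum_repr]
  refine ⟨f, σ, θ, ?_, h2, ?_⟩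
  · filter_upwards [h] with y hy v
    simp only [hy.2.1, hy.2.2]
    exact symm_finBasis_expansion hy.1 v
  · have hc : Tendsto (dualProj F E) (𝓝 κ₀) (𝓝 κ₀.proj) :=
      (FiberBundle.continuous_proj _ _).continuousAt
    filter_upwards [hc.eventually h2, hc.eventually h] with μ hμ hμ'
    have h3 : extChartAt (dualModel I F) κ₀ μ =
        (extChartAt I κ₀.proj μ.proj,
          (trivializationAt (F →L[ℝ] ℝ) (DualBundle E) κ₀.proj μ).2) := by
      rw [FiberBundle.extChartAt]
      have : μ.proj ∈ (trivializationAt (F →L[ℝ] ℝ) (DualBundle E) κ₀.proj).baseSet :=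
        ⟨hμ'.1, mem_univ _⟩
      simp [Trivialization.coe_fst' _ this]
    have h4 : (trivializationAt (F →L[ℝ] ℝ) (DualBundle E) κ₀.proj μ).2 =
        ∑ i, linearFunction (σ i) μ • ((finBasis ℝ F).coord i).toContinuousLinearMap := by
      refine ContinuousLinearMap.coe_injective ((finBasis ℝ F).ext fun j => ?_)
      have h5 : (trivializationAt (F →L[ℝ] ℝ) (DualBundle E) κ₀.proj μ).2 =
          ContinuousLinearMap.inCoordinates F E ℝ (fun _ : Q => ℝ) κ₀.proj μ.proj κ₀.proj μ.proj
            μ.2 := rfl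
      rw [h5, ContinuousLinearMap.inCoordinates_eq hμ'.1 (mem_univ _)]
      simp [linearFunction, Finsupp.single_apply, hμ'.2.1]
    rw [h3]
    refine Prod.ext ?_ ?_
    · simpa [Prod.fst_sum] using hμ
    · simpa [Prod.snd_sum] using h4

/-- The derivative of the chart in the coordinates of `exists_coordinates`. -/
theorem eventually_mvfderiv_extChartAt {κ₀ : DualTotal F E}
    {f : Fin (finrank ℝ EB) → C^∞⟮I, Q; ℝ⟯} {σ : Fin (finrank ℝ F) → Cₛ^∞⟮I; F, E⟯}
    (h : ∀ᶠ μ in 𝓝 κ₀, extChartAt (dualModel I F) κ₀ μ =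
        ∑ j, f j μ.proj • ((finBasis ℝ EB j, 0) : EB × (F →L[ℝ] ℝ)) +
        ∑ i, linearFunction (σ i) μ •
          ((0, ((finBasis ℝ F).coord i).toContinuousLinearMap) : EB × (F →L[ℝ] ℝ))) :
    ∀ᶠ κ in 𝓝 κ₀, ∀ X : TangentSpace (dualModel I F) κ,
      mvfderiv (dualModel I F) (extChartAt (dualModel I F) κ₀) κ X =
        ∑ j, mvfderiv (dualModel I F) (fun μ : DualTotal F E => f j μ.proj) κ X •
          ((finBasis ℝ EB j, 0) : EB × (F →L[ℝ] ℝ)) +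
        ∑ i, mvfderiv (dualModel I F) (linearFunction (σ i) : DualTotal F E → ℝ) κ X •
          ((0, ((finBasis ℝ F).coord i).toContinuousLinearMap) : EB × (F →L[ℝ] ℝ)) := by
  filter_upwards [h.eventually_nhds] with κ hκ X
  rw [mvfderiv_congr_nhds hκ]
  have h2 : ContMDiff (dualModel I F) 𝓘(ℝ, EB × (F →L[ℝ] ℝ)) ∞ (fun μ : DualTotal F E =>
      ∑ j, f j μ.proj • ((finBasis ℝ EB j, 0) : EB × (F →L[ℝ] ℝ))) :=
    contMDiff_finsetSum fun j _ => (contMDiff_comp_proj (f j)).smul contMDiff_const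
  have h3 : ContMDiff (dualModel I F) 𝓘(ℝ, EB × (F →L[ℝ] ℝ)) ∞ (fun μ : DualTotal F E =>
      ∑ i, linearFunction (σ i) μ •
        ((0, ((finBasis ℝ F).coord i).toContinuousLinearMap) : EB × (F →L[ℝ] ℝ))) :=
    contMDiff_finsetSum fun i _ => (contMDiff_linearFunction (σ i)).smul contMDiff_const
  rw [← mvfderiv_sum_smul_const _ _ (fun j => contMDiff_comp_proj (f j)),
    ← mvfderiv_sum_smul_const _ _ (fun i => contMDiff_linearFunction (σ i))]
  exact congrArg (fun L => L X) (mvfderiv_fun_add (h2.mdifferentiable (by simp) κ)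
    (h3.mdifferentiable (by simp) κ))

/-- A tangent vector of the base is determined by its action on global functions that agree near the
point with the coordinates of the chart. -/
theorem base_tangent_ext {q : Q} {w w' : TangentSpace I q}
    {f : Fin (finrank ℝ EB) → C^∞⟮I, Q; ℝ⟯}
    (hf : ∀ᶠ y in 𝓝 q, extChartAt I q y = ∑ j, f j y • finBasis ℝ EB j)
    (h : ∀ j, mvfderiv I (f j) q w = mvfderiv I (f j) q w') : w = w' := by
  have h1 : ∀ w, mvfderiv I (extChartAt I q) q w =
      ∑ j, mvfderiv I (f j) q w • finBasis ℝ EB j := fun w => by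
    rw [mvfderiv_congr_nhds hf, ← mvfderiv_sum_smul_const _ _ (fun j => (f j).contMDiff)]
  refine (isInvertible_mfderiv_extChartAt (I := I) (mem_extChartAt_source q)).injective ?_
  change mvfderiv I (extChartAt I q) q w = mvfderiv I (extChartAt I q) q w'
  rw [h1, h1]
  simp only [h]

/-- The function `(fγ)^` is `(f ∘ τ) γ̂`. -/
theorem mvfderiv_linearFunction_smul (f : C^∞⟮I, Q; ℝ⟯) (γ : Cₛ^∞⟮I; F, E⟯) (κ : DualTotal F E)
    (X : TangentSpace (dualModel I F) κ) :
    mvfderiv (dualModel I F) (linearFunction (f • γ) : DualTotal F E → ℝ) κ X =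
      f κ.proj * mvfderiv (dualModel I F) (linearFunction γ : DualTotal F E → ℝ) κ X +
        mvfderiv (dualModel I F) (fun μ : DualTotal F E => f μ.proj) κ X * κ.2 (γ κ.proj) := by
  have h4 : (linearFunction (f • γ) : DualTotal F E → ℝ) =
      fun μ => f μ.proj * linearFunction γ μ := by
    funext μ
    simp [linearFunction, smulSection_apply]
  rw [h4, mvfderiv_mul_apply (contMDiff_comp_proj f) (contMDiff_linearFunction γ), linearFunction]
  ring

theorem mvfderiv_linearFunction_add (γ γ' : Cₛ^∞⟮I; F, E⟯) (κ : DualTotal F E)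
    (X : TangentSpace (dualModel I F) κ) :
    mvfderiv (dualModel I F) (linearFunction (γ + γ') : DualTotal F E → ℝ) κ X =
      mvfderiv (dualModel I F) (linearFunction γ : DualTotal F E → ℝ) κ X +
        mvfderiv (dualModel I F) (linearFunction γ' : DualTotal F E → ℝ) κ X := by
  rw [← mvfderiv_add_apply (contMDiff_linearFunction γ) (contMDiff_linearFunction γ')]
  congr 2
  funext μ
  simp [linearFunction]

theorem mvfderiv_linearFunction_const_smul (c : ℝ) (γ : Cₛ^∞⟮I; F, E⟯) (κ : DualTotal F E)
    (X : TangentSpace (dualModel I F) κ) :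
    mvfderiv (dualModel I F) (linearFunction (c • γ) : DualTotal F E → ℝ) κ X =
      c * mvfderiv (dualModel I F) (linearFunction γ : DualTotal F E → ℝ) κ X := by
  rw [← mvfderiv_const_mul_apply c (contMDiff_linearFunction γ)]
  congr 2
  funext μ
  simp [linearFunction]

/-- A tangent vector of `E*` is determined by its action on the functions `f ∘ τ` and `γ̂`. -/
theorem tangent_ext {κ : DualTotal F E} {X Y : TangentSpace (dualModel I F) κ}
    (h1 : ∀ f : C^∞⟮I, Q; ℝ⟯, mvfderiv (dualModel I F) (fun μ : DualTotal F E => f μ.proj) κ X =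
      mvfderiv (dualModel I F) (fun μ : DualTotal F E => f μ.proj) κ Y)
    (h2 : ∀ γ : Cₛ^∞⟮I; F, E⟯,
      mvfderiv (dualModel I F) (linearFunction γ : DualTotal F E → ℝ) κ X =
      mvfderiv (dualModel I F) (linearFunction γ : DualTotal F E → ℝ) κ Y) : X = Y := by
  obtain ⟨f, σ, θ, -, -, h⟩ := exists_coordinates I κ
  have h3 := (eventually_mvfderiv_extChartAt h).self_of_nhds
  refine (isInvertible_mfderiv_extChartAt (I := dualModel I F)
    (mem_extChartAt_source κ)).injective ?_
  change mvfderiv (dualModel I F) (extChartAt (dualModel I F) κ) κ X =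
    mvfderiv (dualModel I F) (extChartAt (dualModel I F) κ) κ Y
  rw [h3, h3]
  simp only [h1, h2]

/-- A tangent vector of `E*` with prescribed projection and prescribed action on the functions `γ̂`
exists as soon as the prescription satisfies the Leibniz rule. -/
theorem exists_tangent {κ : DualTotal F E} (w : TangentSpace I κ.proj)
    (L : Cₛ^∞⟮I; F, E⟯ →ₗ[ℝ] ℝ)
    (hL : ∀ (f : C^∞⟮I, Q; ℝ⟯) γ,
      L (f • γ) = f κ.proj * L γ + mvfderiv I f κ.proj w * κ.2 (γ κ.proj)) :
    ∃ X : TangentSpace (dualModel I F) κ, mfderiv (dualModel I F) I (dualProj F E) κ X = w ∧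
      ∀ γ : Cₛ^∞⟮I; F, E⟯,
        mvfderiv (dualModel I F) (linearFunction γ : DualTotal F E → ℝ) κ X = L γ := by
  obtain ⟨f, σ, θ, hθ, hf, h⟩ := exists_coordinates I κ
  have h3 := (eventually_mvfderiv_extChartAt h).self_of_nhds
  obtain ⟨X, hX⟩ := (isInvertible_mfderiv_extChartAt (I := dualModel I F)
    (mem_extChartAt_source κ)).surjective
    (∑ j, mvfderiv I (f j) κ.proj w • ((finBasis ℝ EB j, 0) : EB × (F →L[ℝ] ℝ)) +
      ∑ i, L (σ i) • ((0, ((finBasis ℝ F).coord i).toContinuousLinearMap) : EB × (F →L[ℝ] ℝ)))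
  replace hX := (h3 X).symm.trans hX
  have hX1 : ∀ j, mvfderiv (dualModel I F) (fun μ : DualTotal F E => f j μ.proj) κ X =
      mvfderiv I (f j) κ.proj w := fun j => by
    have := congrArg (fun z => (finBasis ℝ EB).repr z.1 j) hX
    simpa [Prod.fst_sum, Finsupp.single_apply] using this
  have hX2 : ∀ i, mvfderiv (dualModel I F) (linearFunction (σ i) : DualTotal F E → ℝ) κ X =
      L (σ i) := fun i => by
    have := congrArg (fun z => z.2 (finBasis ℝ F i)) hX
    simpa [Prod.snd_sum, Finsupp.single_apply] using this
  have hw : mfderiv (dualModel I F) I (dualProj F E) κ X = w :=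
    base_tangent_ext hf fun j => by rw [← hX1 j, mvfderiv_comp_proj]
  have hXf : ∀ f : C^∞⟮I, Q; ℝ⟯, mvfderiv (dualModel I F)
      (fun μ : DualTotal F E => f μ.proj) κ X = mvfderiv I f κ.proj w := fun f => by
    rw [mvfderiv_comp_proj, hw]
  refine ⟨X, hw, fun γ => ?_⟩
  obtain ⟨χ, hχ, hsupp⟩ := exists_cutoff I hθ
  have hχx : χ κ.proj = 1 := hχ.self_of_nhds
  -- Both sides satisfy the same Leibniz rule and agree on the frame `σᵢ`.
  have hlin : ∀ (f : C^∞⟮I, Q; ℝ⟯) (γ : Cₛ^∞⟮I; F, E⟯),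
      mvfderiv (dualModel I F) (linearFunction (f • γ) : DualTotal F E → ℝ) κ X =
      f κ.proj * mvfderiv (dualModel I F) (linearFunction γ : DualTotal F E → ℝ) κ X +
        mvfderiv I f κ.proj w * κ.2 (γ κ.proj) := fun f γ => by
    rw [mvfderiv_linearFunction_smul, hXf]
  have h5 := cutoff_smul_eq_sum (fun y hy => hsupp hy) γ
  have h6 : (linearFunction (χ • γ) : DualTotal F E → ℝ) =
      fun μ => ∑ i, linearFunction ((χ * pairing (θ i) γ) • σ i) μ := by
    funext μ
    rw [h5]
    simp [linearFunction, sum_section_apply]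
  have h7 : mvfderiv (dualModel I F) (linearFunction (χ • γ) : DualTotal F E → ℝ) κ X =
      L (χ • γ) := by
    rw [h6, mvfderiv_sum_apply _ (fun i => contMDiff_linearFunction _), h5, map_sum]
    exact Finset.sum_congr rfl fun i _ => by rw [hlin, hL, hX2]
  rw [hlin, hL, hχx, one_mul, one_mul] at h7
  exact add_right_cancel h7

/-- A vector field on `E*` is smooth if its action on the functions `f ∘ τ` and `γ̂` is. -/
theorem contMDiffAt_tangent {Y : ∀ κ : DualTotal F E, TangentSpace (dualModel I F) κ}
    {κ₀ : DualTotal F E}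
    (h1 : ∀ f : C^∞⟮I, Q; ℝ⟯, ContMDiffAt (dualModel I F) 𝓘(ℝ, ℝ) ∞
      (fun κ => mvfderiv (dualModel I F) (fun μ : DualTotal F E => f μ.proj) κ (Y κ)) κ₀)
    (h2 : ∀ γ : Cₛ^∞⟮I; F, E⟯, ContMDiffAt (dualModel I F) 𝓘(ℝ, ℝ) ∞
      (fun κ => mvfderiv (dualModel I F) (linearFunction γ : DualTotal F E → ℝ) κ (Y κ)) κ₀) :
    ContMDiffAt (dualModel I F) ((dualModel I F).prod 𝓘(ℝ, EB × (F →L[ℝ] ℝ))) ∞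
      (fun κ => TotalSpace.mk' (EB × (F →L[ℝ] ℝ)) κ (Y κ)) κ₀ := by
  obtain ⟨f, σ, θ, -, -, h⟩ := exists_coordinates I κ₀
  rw [contMDiffAt_section]
  have h3 : ContMDiffAt (dualModel I F) 𝓘(ℝ, EB × (F →L[ℝ] ℝ)) ∞ (fun κ =>
      ∑ j, mvfderiv (dualModel I F) (fun μ : DualTotal F E => f j μ.proj) κ (Y κ) •
          ((finBasis ℝ EB j, 0) : EB × (F →L[ℝ] ℝ)) +
        ∑ i, mvfderiv (dualModel I F) (linearFunction (σ i) : DualTotal F E → ℝ) κ (Y κ) •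
          ((0, ((finBasis ℝ F).coord i).toContinuousLinearMap) : EB × (F →L[ℝ] ℝ))) κ₀ :=
    (contMDiffAt_finsetSum fun j _ => (h1 (f j)).smul contMDiffAt_const).add
      (contMDiffAt_finsetSum fun i _ => (h2 (σ i)).smul contMDiffAt_const)
  refine h3.congr_of_eventuallyEq ?_
  filter_upwards [eventually_mvfderiv_extChartAt h,
    (chartAt (ModelProd H (F →L[ℝ] ℝ)) κ₀).open_source.mem_nhds (mem_chart_source _ κ₀)]
    with κ hκ hs
  have h4 := congrArg (fun L => L (Y κ))
    (TangentBundle.continuousLinearMapAt_trivializationAt (I := dualModel I F) hs)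
  have h5 : κ ∈ (trivializationAt (EB × (F →L[ℝ] ℝ))
      (TangentSpace (dualModel I F) : DualTotal F E → Type _) κ₀).baseSet := hs
  rw [← hκ (Y κ)]
  refine Eq.trans ?_ h4
  simp [Trivialization.coe_linearMapAt_of_mem _ h5]

end DualTotalSpace

/-! ### Lifts and the structure of the left `E`-tangent bundle -/

section Lifts

variable {EB : Type*} [NormedAddCommGroup EB] [NormedSpace ℝ EB] [FiniteDimensional ℝ EB]
  {H : Type*} [TopologicalSpace H] {I : ModelWithCorners ℝ EB H}
  {Q : Type*} [TopologicalSpace Q] [ChartedSpace H Q] [IsManifold I ∞ Q] [T2Space Q]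
  {F : Type*} [NormedAddCommGroup F] [NormedSpace ℝ F] [FiniteDimensional ℝ F]
  {E : Q → Type*} [∀ x, AddCommGroup (E x)] [∀ x, Module ℝ (E x)]
  [∀ x, TopologicalSpace (E x)] [∀ x, IsTopologicalAddGroup (E x)] [∀ x, ContinuousSMul ℝ (E x)]
  [TopologicalSpace (TotalSpace F E)] [FiberBundle F E] [VectorBundle ℝ F E]
  [ContMDiffVectorBundle ∞ F E I] {ρ : AnchorMap I F E} (D : AnchoredConnection ρ)

/-- The tangent vector at `κ` over `ρ(e)` whose action on the functions `γ̂` is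
`γ ↦ κ(D_e γ) + ν(γ)`. -/
theorem exists_lift (κ : DualTotal F E) (e : E κ.proj) (ν : DualBundle E κ.proj) :
    ∃ X : TangentSpace (dualModel I F) κ,
      mfderiv (dualModel I F) I (dualProj F E) κ X = ρ κ.proj e ∧
      ∀ γ : Cₛ^∞⟮I; F, E⟯,
        mvfderiv (dualModel I F) (linearFunction γ : DualTotal F E → ℝ) κ X =
          κ.2 (D.covDeriv γ κ.proj e) + ν (γ κ.proj) :=
  exists_tangent (ρ κ.proj e)
    { toFun := fun γ => κ.2 (D.covDeriv γ κ.proj e) + ν (γ κ.proj)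
      map_add' := fun γ γ' => by simp [D.covDeriv_add]; ring
      map_smul' := fun c γ => by simp [D.covDeriv_const_smul]; ring }
    (fun f γ => by simp [D.covDeriv_smul, smulSection_apply]; ring)

theorem mfderiv_dualProj_eq_iff {κ : DualTotal F E} {X : TangentSpace (dualModel I F) κ}
    {w : TangentSpace I κ.proj} :
    mfderiv (dualModel I F) I (dualProj F E) κ X = w ↔
      ∀ f : C^∞⟮I, Q; ℝ⟯, mvfderiv (dualModel I F) (fun μ : DualTotal F E => f μ.proj) κ X =
        mvfderiv I f κ.proj w := by
  refine ⟨fun h f => by rw [mvfderiv_comp_proj, h], fun h => ?_⟩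
  obtain ⟨f, σ, θ, -, hf, -⟩ := exists_coordinates I κ
  exact base_tangent_ext hf fun j => by rw [← mvfderiv_comp_proj, h]

/-- Variant of `tangent_ext` in terms of the projected vector. -/
theorem tangent_ext' {κ : DualTotal F E} {X Y : TangentSpace (dualModel I F) κ}
    (h1 : mfderiv (dualModel I F) I (dualProj F E) κ X =
      mfderiv (dualModel I F) I (dualProj F E) κ Y)
    (h2 : ∀ γ : Cₛ^∞⟮I; F, E⟯,
      mvfderiv (dualModel I F) (linearFunction γ : DualTotal F E → ℝ) κ X =
      mvfderiv (dualModel I F) (linearFunction γ : DualTotal F E → ℝ) κ Y) : X = Y :=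
  tangent_ext (fun f => by rw [mvfderiv_comp_proj, mvfderiv_comp_proj, h1]) h2

theorem isHorizontalLift_iff {κ : DualTotal F E} {e : E κ.proj}
    {X : TangentSpace (dualModel I F) κ} : IsHorizontalLift D κ e X ↔
      mfderiv (dualModel I F) I (dualProj F E) κ X = ρ κ.proj e ∧
      ∀ γ : Cₛ^∞⟮I; F, E⟯,
        mvfderiv (dualModel I F) (linearFunction γ : DualTotal F E → ℝ) κ X =
          κ.2 (D.covDeriv γ κ.proj e) := by
  rw [mfderiv_dualProj_eq_iff]
  refine and_congr_right fun _ => ⟨fun h γ => ?_, fun h σ γ hσ => ?_⟩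
  · obtain ⟨σ, hσ⟩ := exists_section_apply_eq I F e
    rw [h σ γ hσ, D.conn_apply, hσ]
  · rw [h γ, D.conn_apply, hσ]

theorem existsUnique_isHorizontalLift (κ : DualTotal F E) (e : E κ.proj) :
    ∃! X, IsHorizontalLift D κ e X := by
  obtain ⟨X, hX⟩ := exists_lift D κ e 0
  refine ⟨X, (isHorizontalLift_iff D).2 ⟨hX.1, fun γ => by simp [hX.2]⟩, fun Y hY => ?_⟩
  replace hY := (isHorizontalLift_iff D).1 hY
  exact tangent_ext' (by rw [hX.1, hY.1]) fun γ => by simp [hX.2, hY.2]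

theorem isVerticalLift_iff {κ : DualTotal F E} {ν : DualBundle E κ.proj}
    {X : TangentSpace (dualModel I F) κ} : IsVerticalLift I κ ν X ↔
      mfderiv (dualModel I F) I (dualProj F E) κ X = 0 ∧
      ∀ γ : Cₛ^∞⟮I; F, E⟯,
        mvfderiv (dualModel I F) (linearFunction γ : DualTotal F E → ℝ) κ X = ν (γ κ.proj) := by
  rw [mfderiv_dualProj_eq_iff]
  simp [IsVerticalLift]

theorem existsUnique_isVerticalLift (κ : DualTotal F E) (ν : DualBundle E κ.proj) :
    ∃! X, IsVerticalLift I κ ν X := by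
  obtain ⟨X, hX⟩ := exists_tangent (κ := κ) (0 : TangentSpace I κ.proj)
    { toFun := fun γ : Cₛ^∞⟮I; F, E⟯ => ν (γ κ.proj)
      map_add' := fun γ γ' => by simp
      map_smul' := fun c γ => by simp } (fun f γ => by simp [smulSection_apply])
  refine ⟨X, isVerticalLift_iff.2 ⟨hX.1, hX.2⟩, fun Y hY => ?_⟩
  replace hY := isVerticalLift_iff.1 hY
  exact tangent_ext' (by rw [hX.1, hY.1]) fun γ => by rw [hX.2, hY.2]; rfl

theorem liftsWellDefined : LiftsWellDefined D where
  hlift_unique := existsUnique_isHorizontalLift D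
  vlift_unique := existsUnique_isVerticalLift
  dual_unique := D.existsUnique_isDualDerivative

theorem hlift_spec (κ : DualTotal F E) (e : E κ.proj) : IsHorizontalLift D κ e (hlift D κ e) :=
  Classical.epsilon_spec (existsUnique_isHorizontalLift D κ e).exists

theorem mfderiv_dualProj_hlift (κ : DualTotal F E) (e : E κ.proj) :
    mfderiv (dualModel I F) I (dualProj F E) κ (hlift D κ e) = ρ κ.proj e :=
  ((isHorizontalLift_iff D).1 (hlift_spec D κ e)).1

theorem mvfderiv_linearFunction_hlift (κ : DualTotal F E) (e : E κ.proj) (γ : Cₛ^∞⟮I; F, E⟯) :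
    mvfderiv (dualModel I F) (linearFunction γ : DualTotal F E → ℝ) κ (hlift D κ e) =
      κ.2 (D.covDeriv γ κ.proj e) :=
  ((isHorizontalLift_iff D).1 (hlift_spec D κ e)).2 γ

theorem vlift_spec (κ : DualTotal F E) (ν : DualBundle E κ.proj) :
    IsVerticalLift I κ ν (vlift I κ ν) :=
  Classical.epsilon_spec (existsUnique_isVerticalLift κ ν).exists

namespace LeftTangent

theorem mvfderiv_comp_proj_tan (f : C^∞⟮I, Q; ℝ⟯) {κ : DualTotal F E} (p : LeftTangent ρ κ) :
    mvfderiv (dualModel I F) (fun μ : DualTotal F E => f μ.proj) κ (tan p) =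
      mvfderiv I f κ.proj (ρ κ.proj (vec p)) := by
  rw [mvfderiv_comp_proj, anchor_vec]

theorem exists_vert (κ : DualTotal F E) :
    ∃ φ : LeftTangent ρ κ →L[ℝ] DualBundle E κ.proj, ∀ p (γ : Cₛ^∞⟮I; F, E⟯), φ p (γ κ.proj) =
      mvfderiv (dualModel I F) (linearFunction γ : DualTotal F E → ℝ) κ (tan p) -
        κ.2 (D.covDeriv γ κ.proj (vec p)) := by
  obtain ⟨ℓ, hℓ⟩ := exists_clm_of_tensorial (I := I) (F := F) (V := E) (x := κ.proj)
    (G := LeftTangent ρ κ →L[ℝ] ℝ)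
    { toFun := fun γ =>
        (mvfderiv (dualModel I F) (linearFunction γ : DualTotal F E → ℝ) κ).comp tan -
          (κ.2.comp (D.covDeriv γ κ.proj)).comp vec
      map_add' := fun γ γ' => by
        ext p
        simp [mvfderiv_linearFunction_add, D.covDeriv_add]
        ring
      map_smul' := fun c γ => by
        ext p
        simp [mvfderiv_linearFunction_const_smul, D.covDeriv_const_smul]
        ring }
    (fun f γ => by
      ext p
      simp [mvfderiv_linearFunction_smul, mvfderiv_comp_proj_tan, D.covDeriv_smul]
      ring)
  obtain ⟨φ, hφ⟩ := exists_flip F I ℓ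
  exact ⟨φ, fun p γ => by rw [hφ, ← hℓ]; rfl⟩

/-- The vertical part of `(e, X)`: the element `K` of `E*` with `X = e^{Dh} + K^v`. -/
noncomputable def vert (κ : DualTotal F E) : LeftTangent ρ κ →L[ℝ] DualBundle E κ.proj :=
  (exists_vert D κ).choose

theorem vert_apply {κ : DualTotal F E} (p : LeftTangent ρ κ) (γ : Cₛ^∞⟮I; F, E⟯) :
    vert D κ p (γ κ.proj) =
      mvfderiv (dualModel I F) (linearFunction γ : DualTotal F E → ℝ) κ (tan p) -
        κ.2 (D.covDeriv γ κ.proj (vec p)) :=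
  (exists_vert D κ).choose_spec p γ

theorem ext_vec_vert {κ : DualTotal F E} {p p' : LeftTangent ρ κ} (h : vec p = vec p')
    (h' : vert D κ p = vert D κ p') : p = p' := by
  refine ext_vec_tan h (tangent_ext' ?_ fun γ => ?_)
  · rw [← anchor_vec, ← anchor_vec, h]
  · have h1 := vert_apply D p γ
    rw [h', vert_apply, h] at h1
    linarith

theorem vert_eq_of_tan {κ : DualTotal F E} {p : LeftTangent ρ κ} {ν : DualBundle E κ.proj}
    (h : ∀ γ : Cₛ^∞⟮I; F, E⟯,
      mvfderiv (dualModel I F) (linearFunction γ : DualTotal F E → ℝ) κ (tan p) =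
        κ.2 (D.covDeriv γ κ.proj (vec p)) + ν (γ κ.proj)) : vert D κ p = ν := by
  refine ContinuousLinearMap.ext fun v => ?_
  obtain ⟨γ, rfl⟩ := exists_section_apply_eq I F v
  rw [vert_apply, h]
  ring

/-! Smooth sections of the left `E`-tangent bundle. -/

section Smooth

variable {s : ∀ κ : DualTotal F E, LeftTangent ρ κ} {κ₀ : DualTotal F E}

/-- The topology of the left `E`-tangent bundle is the one in which `(e, X)` varies smoothly exactly
when `e` and `X` do. In the trivialization at `κ₀`, the coordinates of `X` along the base are those of
`ρ(e)`, so only its coordinates along the fibres of `E*` enter. -/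
theorem contMDiffAt_iff_vec_tan :
    ContMDiffAt (dualModel I F) ((dualModel I F).prod 𝓘(ℝ, F × (F →L[ℝ] ℝ))) ∞
      (fun κ => TotalSpace.mk' (F × (F →L[ℝ] ℝ)) κ (s κ)) κ₀ ↔
    ContMDiffAt (dualModel I F) (I.prod 𝓘(ℝ, F)) ∞
      (fun κ : DualTotal F E => TotalSpace.mk' F κ.proj (vec (s κ))) κ₀ ∧
    ContMDiffAt (dualModel I F) ((dualModel I F).prod 𝓘(ℝ, EB × (F →L[ℝ] ℝ))) ∞
      (fun κ => TotalSpace.mk' (EB × (F →L[ℝ] ℝ)) κ (tan (s κ))) κ₀ := by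
  have hU : baseSet I κ₀ ∈ 𝓝 κ₀ := (isOpen_baseSet κ₀).mem_nhds (mem_baseSet I κ₀)
  have h0 : ∀ κ, (trivializationAt (F × (F →L[ℝ] ℝ)) (LeftTangent ρ) κ₀ ⟨κ, s κ⟩).2 =
      coord ρ κ₀ κ (s κ) := fun κ => rfl
  have h1 : ∀ κ ∈ baseSet I κ₀, (trivE κ₀ ⟨κ.proj, vec (s κ)⟩).2 = (coord ρ κ₀ κ (s κ)).1 :=
    fun κ hκ => by
      change _ = (trivE κ₀).continuousLinearMapAt ℝ κ.proj (vec (s κ))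
      simp [Trivialization.coe_linearMapAt_of_mem _ hκ.2.1]
  have h2 : ∀ κ ∈ baseSet I κ₀, (trivT I κ₀ ⟨κ, tan (s κ)⟩).2 =
      (trivT I κ₀).continuousLinearMapAt ℝ κ (tan (s κ)) :=
    fun κ hκ => by
      simp [Trivialization.coe_linearMapAt_of_mem _ hκ.1]
  have h3 : ∀ κ ∈ baseSet I κ₀, (trivT I κ₀ ⟨κ, tan (s κ)⟩).2 =
      (anchorCoord ρ κ₀ κ (coord ρ κ₀ κ (s κ)).1, (coord ρ κ₀ κ (s κ)).2) := fun κ hκ => by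
    have h4 := congrArg Prod.snd (coordInv_coord ρ hκ (s κ))
    have h5 : (trivT I κ₀).symmL ℝ κ
      (anchorCoord ρ κ₀ κ (coord ρ κ₀ κ (s κ)).1, (coord ρ κ₀ κ (s κ)).2) = tan (s κ) := h4
    rw [h2 κ hκ, ← h5]
    exact (trivT I κ₀).continuousLinearMapAt_symmL (R := ℝ) hκ.1 _
  rw [contMDiffAt_section, contMDiffAt_section, contMDiffAt_totalSpace]
  simp only [h0]
  constructor
  · intro h
    have hfst := (ContinuousLinearMap.fst ℝ F (F →L[ℝ] ℝ)).contMDiff.contMDiffAt.comp κ₀ h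
    have hsnd := (ContinuousLinearMap.snd ℝ F (F →L[ℝ] ℝ)).contMDiff.contMDiffAt.comp κ₀ h
    refine ⟨⟨contMDiff_dualProj κ₀, hfst.congr_of_eventuallyEq ?_⟩, ?_⟩
    · filter_upwards [hU] with κ hκ using h1 κ hκ
    · have h6 := ((contMDiffOn_anchorCoord ρ).contMDiffAt hU).clm_apply hfst
      refine (h6.prodMk_space hsnd).congr_of_eventuallyEq ?_
      filter_upwards [hU] with κ hκ using h3 κ hκ
  · rintro ⟨⟨-, hv⟩, ht⟩
    have hsnd := (ContinuousLinearMap.snd ℝ EB (F →L[ℝ] ℝ)).contMDiff.contMDiffAt.comp κ₀ ht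
    refine (hv.prodMk_space hsnd).congr_of_eventuallyEq ?_
    filter_upwards [hU] with κ hκ
    refine Prod.ext (h1 κ hκ).symm ?_
    simp [h3 κ hκ]

variable (hs : ContMDiffAt (dualModel I F) ((dualModel I F).prod 𝓘(ℝ, F × (F →L[ℝ] ℝ))) ∞
      (fun κ => TotalSpace.mk' (F × (F →L[ℝ] ℝ)) κ (s κ)) κ₀)
include hs

theorem contMDiffAt_vec : ContMDiffAt (dualModel I F) (I.prod 𝓘(ℝ, F)) ∞
    (fun κ : DualTotal F E => TotalSpace.mk' F κ.proj (vec (s κ))) κ₀ :=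
  (contMDiffAt_iff_vec_tan.1 hs).1

theorem contMDiffAt_tan :
    ContMDiffAt (dualModel I F) ((dualModel I F).prod 𝓘(ℝ, EB × (F →L[ℝ] ℝ))) ∞
      (fun κ => TotalSpace.mk' (EB × (F →L[ℝ] ℝ)) κ (tan (s κ))) κ₀ :=
  (contMDiffAt_iff_vec_tan.1 hs).2

end Smooth

end LeftTangent

end Lifts

/-! ### Lifted sections -/

section LiftedSections

variable {EB : Type*} [NormedAddCommGroup EB] [NormedSpace ℝ EB] [FiniteDimensional ℝ EB]
  {H : Type*} [TopologicalSpace H] {I : ModelWithCorners ℝ EB H}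
  {Q : Type*} [TopologicalSpace Q] [ChartedSpace H Q] [IsManifold I ∞ Q] [T2Space Q]
  {F : Type*} [NormedAddCommGroup F] [NormedSpace ℝ F] [FiniteDimensional ℝ F]
  {E : Q → Type*} [∀ x, AddCommGroup (E x)] [∀ x, Module ℝ (E x)]
  [∀ x, TopologicalSpace (E x)] [∀ x, IsTopologicalAddGroup (E x)] [∀ x, ContinuousSMul ℝ (E x)]
  [TopologicalSpace (TotalSpace F E)] [FiberBundle F E] [VectorBundle ℝ F E]
  [ContMDiffVectorBundle ∞ F E I] {ρ : AnchorMap I F E} (D : AnchoredConnection ρ)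

open LeftTangent

theorem hliftT_spec (κ : DualTotal F E) (e : E κ.proj) :
    vec (hliftT D κ e) = e ∧ tan (hliftT D κ e) = hlift D κ e :=
  Classical.epsilon_spec
    (p := fun p : LeftTangent ρ κ => vec p = e ∧ tan p = hlift D κ e)
    ⟨⟨(e, hlift D κ e), (mfderiv_dualProj_hlift D κ e).symm⟩, rfl, rfl⟩

theorem vliftT_spec (κ : DualTotal F E) (ν : DualBundle E κ.proj) :
    vec (vliftT ρ κ ν) = 0 ∧ tan (vliftT ρ κ ν) = vlift I κ ν :=
  Classical.epsilon_spec
    (p := fun p : LeftTangent ρ κ => vec p = 0 ∧ tan p = vlift I κ ν)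
    ⟨⟨(0, vlift I κ ν), (map_zero (ρ κ.proj)).trans
      (isVerticalLift_iff.1 (vlift_spec κ ν)).1.symm⟩, rfl, rfl⟩

namespace LeftTangent

variable {κ : DualTotal F E}

theorem vec_hliftT (e : E κ.proj) : vec (hliftT D κ e) = e := (hliftT_spec D κ e).1

theorem vert_hliftT (e : E κ.proj) : vert D κ (hliftT D κ e) = 0 :=
  vert_eq_of_tan D fun γ => by
    rw [(hliftT_spec D κ e).2, (hliftT_spec D κ e).1, mvfderiv_linearFunction_hlift]
    simp

theorem vec_vliftT (ν : DualBundle E κ.proj) : vec (vliftT ρ κ ν) = 0 := (vliftT_spec κ ν).1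

theorem vert_vliftT (ν : DualBundle E κ.proj) : vert D κ (vliftT ρ κ ν) = ν :=
  vert_eq_of_tan D fun γ => by
    rw [(vliftT_spec κ ν).2, (vliftT_spec κ ν).1, (isVerticalLift_iff.1 (vlift_spec κ ν)).2]
    simp

section Smooth

variable {s : ∀ κ : DualTotal F E, LeftTangent ρ κ} {κ₀ : DualTotal F E}

theorem contMDiffAt_comp_proj {G : Type*} [NormedAddCommGroup G] [NormedSpace ℝ G] {V : Q → Type*}
    [∀ x, AddCommGroup (V x)] [∀ x, Module ℝ (V x)] [∀ x, TopologicalSpace (V x)]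
    [TopologicalSpace (TotalSpace G V)] [FiberBundle G V] [VectorBundle ℝ G V]
    (σ : Cₛ^∞⟮I; G, V⟯) : ContMDiffAt (dualModel I F) (I.prod 𝓘(ℝ, G)) ∞
      (fun κ : DualTotal F E => TotalSpace.mk' G κ.proj (σ κ.proj)) κ₀ :=
  ContMDiffAt.comp (f := dualProj F E) (g := fun y => TotalSpace.mk' G y (σ y)) κ₀
      (σ.contMDiff _) (contMDiff_dualProj κ₀)

/-- The derivative of a function on `Q` in the direction of the anchor of a smooth section along
the projection `E* → Q` is smooth. -/
theorem contMDiffAt_mvfderiv_anchor (ρ' : AnchorMap I F E) (f : C^∞⟮I, Q; ℝ⟯)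
    {v : ∀ κ : DualTotal F E, E κ.proj}
    (h : ContMDiffAt (dualModel I F) (I.prod 𝓘(ℝ, F)) ∞
      (fun κ : DualTotal F E => TotalSpace.mk' F κ.proj (v κ)) κ₀) :
    ContMDiffAt (dualModel I F) 𝓘(ℝ, ℝ) ∞
      (fun κ => mvfderiv I f κ.proj (ρ' κ.proj (v κ))) κ₀ := by
  have h3 : ContMDiffAt (dualModel I F) (I.prod 𝓘(ℝ, EB)) ∞
    (fun κ : DualTotal F E => TotalSpace.mk' EB κ.proj (ρ' κ.proj (v κ))) κ₀ :=
    (contMDiffAt_comp_proj ρ').clm_bundle_apply h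
  have h4 : ContMDiff I.tangent 𝓘(ℝ, ℝ).tangent ∞ (tangentMap I 𝓘(ℝ, ℝ) f) :=
    f.contMDiff.contMDiff_tangentMap (by simp)
  have h5 := contMDiff_snd_tangentBundle_modelSpace ℝ 𝓘(ℝ, ℝ) (n := ∞)
  exact ((h5.comp h4).contMDiffAt
    (x := (⟨κ₀.proj, ρ' κ₀.proj (v κ₀)⟩ : TangentBundle I Q))).comp κ₀ h3

theorem contMDiffAt_apply_vert (hs : ContMDiffAt (dualModel I F)
      ((dualModel I F).prod 𝓘(ℝ, F × (F →L[ℝ] ℝ))) ∞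
      (fun κ => TotalSpace.mk' (F × (F →L[ℝ] ℝ)) κ (s κ)) κ₀) (γ : Cₛ^∞⟮I; F, E⟯) :
    ContMDiffAt (dualModel I F) 𝓘(ℝ, ℝ) ∞ (fun κ => vert D κ (s κ) (γ κ.proj)) κ₀ := by
  simp only [vert_apply]
  refine (contMDiffAt_mvfderiv_apply (contMDiff_linearFunction γ) (contMDiffAt_tan hs)).sub ?_
  exact contMDiffAt_form_apply (p := dualProj F E) (ν := fun μ => μ.2) (contMDiff_dualProj κ₀)
    contMDiffAt_id ((contMDiffAt_comp_proj (D.covDeriv γ)).clm_bundle_apply (contMDiffAt_vec hs))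

/-- A section of the left `E`-tangent bundle is smooth if its `E`-component and its vertical part
are. -/
theorem contMDiffAt_of_vec_vert
    (h1 : ContMDiffAt (dualModel I F) (I.prod 𝓘(ℝ, F)) ∞
      (fun κ : DualTotal F E => TotalSpace.mk' F κ.proj (vec (s κ))) κ₀)
    (h2 : ∀ γ : Cₛ^∞⟮I; F, E⟯,
      ContMDiffAt (dualModel I F) 𝓘(ℝ, ℝ) ∞ (fun κ => vert D κ (s κ) (γ κ.proj)) κ₀) :
    ContMDiffAt (dualModel I F) ((dualModel I F).prod 𝓘(ℝ, F × (F →L[ℝ] ℝ))) ∞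
      (fun κ => TotalSpace.mk' (F × (F →L[ℝ] ℝ)) κ (s κ)) κ₀ := by
  refine contMDiffAt_iff_vec_tan.2 ⟨h1, contMDiffAt_tangent (fun f => ?_) fun γ => ?_⟩
  · simp only [mvfderiv_comp_proj_tan]
    exact contMDiffAt_mvfderiv_anchor ρ f h1
  · have h3 : ∀ κ, mvfderiv (dualModel I F) (linearFunction γ : DualTotal F E → ℝ) κ (tan (s κ)) =
        vert D κ (s κ) (γ κ.proj) + κ.2 (D.covDeriv γ κ.proj (vec (s κ))) := fun κ => by
      rw [vert_apply]; ring
    simp only [h3]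
    exact (h2 γ).add (contMDiffAt_form_apply (p := dualProj F E) (ν := fun μ => μ.2)
      (contMDiff_dualProj κ₀) contMDiffAt_id
      ((contMDiffAt_comp_proj (D.covDeriv γ)).clm_bundle_apply h1))

theorem contMDiffAt_hliftT {σ : ∀ κ : DualTotal F E, E κ.proj}
    (h : ContMDiffAt (dualModel I F) (I.prod 𝓘(ℝ, F)) ∞
      (fun κ : DualTotal F E => TotalSpace.mk' F κ.proj (σ κ)) κ₀) :
    ContMDiffAt (dualModel I F) ((dualModel I F).prod 𝓘(ℝ, F × (F →L[ℝ] ℝ))) ∞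
      (fun κ => TotalSpace.mk' (F × (F →L[ℝ] ℝ)) κ (hliftT D κ (σ κ))) κ₀ := by
  refine contMDiffAt_of_vec_vert D ?_ fun γ => ?_
  · simpa only [vec_hliftT] using h
  · simpa only [vert_hliftT] using! contMDiffAt_const (c := (0 : ℝ))

include D in
theorem contMDiffAt_vliftT {ν : ∀ κ : DualTotal F E, DualBundle E κ.proj}
    (h : ∀ γ : Cₛ^∞⟮I; F, E⟯,
      ContMDiffAt (dualModel I F) 𝓘(ℝ, ℝ) ∞ (fun κ => ν κ (γ κ.proj)) κ₀) :
    ContMDiffAt (dualModel I F) ((dualModel I F).prod 𝓘(ℝ, F × (F →L[ℝ] ℝ))) ∞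
      (fun κ => TotalSpace.mk' (F × (F →L[ℝ] ℝ)) κ (vliftT ρ κ (ν κ))) κ₀ := by
  refine contMDiffAt_of_vec_vert D ?_ fun γ => ?_
  · simp only [vec_vliftT]
    exact contMDiffAt_comp_proj (0 : Cₛ^∞⟮I; F, E⟯)
  · simpa only [vert_vliftT] using h γ

end Smooth

end LeftTangent

theorem hSec_spec (σ : Cₛ^∞⟮I; F, E⟯) (κ : DualTotal F E) :
    hSec D σ κ = hliftT D κ (σ κ.proj) :=
  Classical.epsilon_spec (p := fun s : LeftTangentSection ρ => ∀ κ, s κ = hliftT D κ (σ κ.proj))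
    ⟨⟨fun κ => hliftT D κ (σ κ.proj), fun _ => contMDiffAt_hliftT D (contMDiffAt_comp_proj σ)⟩,
      fun _ => rfl⟩ κ

include D in
theorem vSec_spec (ν : Cₛ^∞⟮I; F →L[ℝ] ℝ, DualBundle E⟯) (κ : DualTotal F E) :
    vSec ρ ν κ = vliftT ρ κ (ν κ.proj) :=
  Classical.epsilon_spec (p := fun s : LeftTangentSection ρ => ∀ κ, s κ = vliftT ρ κ (ν κ.proj))
    ⟨⟨fun κ => vliftT ρ κ (ν κ.proj), fun _ => contMDiffAt_vliftT D fun γ =>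
      contMDiff_comp_proj (pairing ν γ) _⟩, fun _ => rfl⟩ κ

include D in
theorem tSec_spec (S : Tensor11 I F E) (κ : DualTotal F E) :
    tSec ρ S κ = vliftT ρ κ (κ.2.comp (S κ.proj)) :=
  Classical.epsilon_spec
    (p := fun s : LeftTangentSection ρ => ∀ κ, s κ = vliftT ρ κ (κ.2.comp (S κ.proj)))
    ⟨⟨fun κ => vliftT ρ κ (κ.2.comp (S κ.proj)), fun κ₀ => contMDiffAt_vliftT D fun γ =>
      contMDiffAt_form_apply (p := dualProj F E) (ν := fun μ => μ.2)
      (contMDiff_dualProj κ₀) contMDiffAt_id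
      ((contMDiffAt_comp_proj S).clm_bundle_apply (contMDiffAt_comp_proj γ))⟩, fun _ => rfl⟩ κ

theorem bundleLiftsWellDefined : BundleLiftsWellDefined D where
  hliftT_eq := hliftT_spec D
  vliftT_eq := vliftT_spec
  hSec_apply := hSec_spec D
  vSec_apply := vSec_spec D
  tSec_apply := tSec_spec D

end LiftedSections

/-! ### The pulled back connection -/

section Pullback

variable {EB : Type*} [NormedAddCommGroup EB] [NormedSpace ℝ EB] [FiniteDimensional ℝ EB]
  {H : Type*} [TopologicalSpace H] {I : ModelWithCorners ℝ EB H}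
  {Q : Type*} [TopologicalSpace Q] [ChartedSpace H Q] [IsManifold I ∞ Q] [T2Space Q]
  {F : Type*} [NormedAddCommGroup F] [NormedSpace ℝ F] [FiniteDimensional ℝ F]
  {E : Q → Type*} [∀ x, AddCommGroup (E x)] [∀ x, Module ℝ (E x)]
  [∀ x, TopologicalSpace (E x)] [∀ x, IsTopologicalAddGroup (E x)] [∀ x, ContinuousSMul ℝ (E x)]
  [TopologicalSpace (TotalSpace F E)] [FiberBundle F E] [VectorBundle ℝ F E]
  [ContMDiffVectorBundle ∞ F E I] {ρ : AnchorMap I F E} (D : AnchoredConnection ρ)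
  {κ : DualTotal F E} {e : E κ.proj} {X : TangentSpace (dualModel I F) κ}

/-- The derivative of a section `v` of `E` along the projection `E* → Q` in the direction of a
tangent vector `X` over `ρ(e)`, for the connection `D`. -/
theorem exists_pullDeriv
    (hX : mfderiv (dualModel I F) I (dualProj F E) κ X = ρ κ.proj e)
    {v : ∀ μ : DualTotal F E, E μ.proj}
    (hv : ∀ ν : Cₛ^∞⟮I; F →L[ℝ] ℝ, DualBundle E⟯,
      ContMDiff (dualModel I F) 𝓘(ℝ, ℝ) ∞ (fun μ : DualTotal F E => ν μ.proj (v μ))) :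
    ∃ w : E κ.proj, ∀ ν : Cₛ^∞⟮I; F →L[ℝ] ℝ, DualBundle E⟯, ν κ.proj w =
      mvfderiv (dualModel I F) (fun μ : DualTotal F E => ν μ.proj (v μ)) κ X -
        D.covDual ν κ.proj e (v κ) := by
  obtain ⟨ℓ, hℓ⟩ := exists_clm_of_tensorial (I := I) (F := F →L[ℝ] ℝ) (V := DualBundle E)
    (x := κ.proj) (G := ℝ)
    { toFun := fun ν =>
        mvfderiv (dualModel I F) (fun μ : DualTotal F E => ν μ.proj (v μ)) κ X -
          D.covDual ν κ.proj e (v κ)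
      map_add' := fun ν ν' => by
        simp only [ContMDiffSection.coe_add, Pi.add_apply, add_apply,
          D.covDual_add]
        rw [mvfderiv_add_apply (hv ν) (hv ν')]
        ring
      map_smul' := fun c ν => by
        simp only [ContMDiffSection.coe_smul, Pi.smul_apply, smul_apply,
          D.covDual_const_smul, smul_eq_mul, RingHom.id_apply]
        rw [mvfderiv_const_mul_apply c (hv ν)]
        ring }
    (fun f ν => by
      simp only [LinearMap.coe_mk, AddHom.coe_mk, smulSection_apply,
        smul_apply, D.covDual_smul, smul_eq_mul]
      rw [mvfderiv_mul_apply (contMDiff_comp_proj f) (hv ν), mvfderiv_comp_proj, hX]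
      ring)
  obtain ⟨w, hw⟩ := exists_forall_form_apply_eq F I (ℓ : DualBundle E κ.proj →ₗ[ℝ] ℝ)
  exact ⟨w, fun ν => by rw [hw]; exact (hℓ ν).symm⟩

/-- The derivative of a section `k` of `E*` along the projection `E* → Q` in the direction of a
tangent vector `X` over `ρ(e)`, for the connection `D`. -/
theorem exists_pullDerivForm
    (hX : mfderiv (dualModel I F) I (dualProj F E) κ X = ρ κ.proj e)
    {k : ∀ μ : DualTotal F E, DualBundle E μ.proj}
    (hk : ∀ γ : Cₛ^∞⟮I; F, E⟯,
      ContMDiff (dualModel I F) 𝓘(ℝ, ℝ) ∞ (fun μ : DualTotal F E => k μ (γ μ.proj))) :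
    ∃ η : DualBundle E κ.proj, ∀ γ : Cₛ^∞⟮I; F, E⟯, η (γ κ.proj) =
      mvfderiv (dualModel I F) (fun μ : DualTotal F E => k μ (γ μ.proj)) κ X -
        k κ (D.covDeriv γ κ.proj e) := by
  obtain ⟨ℓ, hℓ⟩ := exists_clm_of_tensorial (I := I) (F := F) (V := E)
    (x := κ.proj) (G := ℝ)
    { toFun := fun γ =>
        mvfderiv (dualModel I F) (fun μ : DualTotal F E => k μ (γ μ.proj)) κ X -
          k κ (D.covDeriv γ κ.proj e)
      map_add' := fun γ γ' => by
        simp only [ContMDiffSection.coe_add, Pi.add_apply, map_add, D.covDeriv_add]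
        rw [mvfderiv_add_apply (hk γ) (hk γ')]
        ring
      map_smul' := fun c γ => by
        simp only [ContMDiffSection.coe_smul, Pi.smul_apply, map_smul,
          D.covDeriv_const_smul, smul_eq_mul, RingHom.id_apply]
        rw [mvfderiv_const_mul_apply c (hk γ)]
        ring }
    (fun f γ => by
      simp only [LinearMap.coe_mk, AddHom.coe_mk, smulSection_apply, map_smul, map_add,
        D.covDeriv_smul, smul_eq_mul]
      rw [mvfderiv_mul_apply (contMDiff_comp_proj f) (hk γ), mvfderiv_comp_proj, hX]
      ring)
  exact ⟨ℓ, fun γ => (hℓ γ).symm⟩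

end Pullback

/-! ### The anchors of the lifted algebroid -/

section Anchors

variable {EB : Type*} [NormedAddCommGroup EB] [NormedSpace ℝ EB] [FiniteDimensional ℝ EB]
  {H : Type*} [TopologicalSpace H] {I : ModelWithCorners ℝ EB H}
  {Q : Type*} [TopologicalSpace Q] [ChartedSpace H Q] [IsManifold I ∞ Q] [T2Space Q]
  {F : Type*} [NormedAddCommGroup F] [NormedSpace ℝ F] [FiniteDimensional ℝ F]
  {E : Q → Type*} [∀ x, AddCommGroup (E x)] [∀ x, Module ℝ (E x)]
  [∀ x, TopologicalSpace (E x)] [∀ x, IsTopologicalAddGroup (E x)] [∀ x, ContinuousSMul ℝ (E x)]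
  [TopologicalSpace (TotalSpace F E)] [FiberBundle F E] [VectorBundle ℝ F E]
  [ContMDiffVectorBundle ∞ F E I]

open LeftTangent

theorem exists_hliftL {ρ : AnchorMap I F E} (D : AnchoredConnection ρ) (κ : DualTotal F E) :
    ∃ ℓ : E κ.proj →L[ℝ] TangentSpace (dualModel I F) κ, ∀ e, ℓ e = hlift D κ e := by
  obtain ⟨ℓ, hℓ⟩ := exists_clm_of_tensorial (I := I) (F := F) (V := E) (x := κ.proj)
    (G := TangentSpace (dualModel I F) κ)
    { toFun := fun γ => hlift D κ (γ κ.proj)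
      map_add' := fun γ γ' => tangent_ext' (by simp [mfderiv_dualProj_hlift]) fun δ => by
        simp [mvfderiv_linearFunction_hlift]
      map_smul' := fun c γ => tangent_ext' (by simp [mfderiv_dualProj_hlift]) fun δ => by
        simp [mvfderiv_linearFunction_hlift] }
    (fun f γ => tangent_ext' (by simp [mfderiv_dualProj_hlift, smulSection_apply]) fun δ => by
        simp [mvfderiv_linearFunction_hlift, smulSection_apply])
  refine ⟨ℓ, fun e => ?_⟩
  obtain ⟨γ, rfl⟩ := exists_section_apply_eq I F e
  exact (hℓ γ).symm

variable (ρ : AnchorMap I F E) in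
/-- The left anchor `(e, X) ↦ X` of the left `E`-tangent bundle. -/
noncomputable def liftedLeftAnchor :
    AnchorMap (dualModel I F) (F × (F →L[ℝ] ℝ)) (LeftTangent ρ) :=
  ⟨fun _ => tan, fun _ => contMDiffAt_hom_of_local fun _ hs => contMDiffAt_tan hs⟩

variable {ρ ρ' : AnchorMap I F E} (D : AnchoredConnection ρ) (D' : AnchoredConnection ρ')

/-- The value at `κ` of the right anchor `(e, X) ↦ X - e^{Dh} + e^{D'h}`. -/
noncomputable def rightAnchorAt (κ : DualTotal F E) :
    LeftTangent ρ κ →L[ℝ] TangentSpace (dualModel I F) κ :=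
  tan - (exists_hliftL D κ).choose.comp vec + (exists_hliftL D' κ).choose.comp vec

theorem rightAnchorAt_apply {κ : DualTotal F E} (p : LeftTangent ρ κ) :
    rightAnchorAt D D' κ p = tan p - hlift D κ (vec p) + hlift D' κ (vec p) := by
  simp [rightAnchorAt, (exists_hliftL D κ).choose_spec, (exists_hliftL D' κ).choose_spec]

theorem mfderiv_dualProj_rightAnchorAt {κ : DualTotal F E} (p : LeftTangent ρ κ) :
    mfderiv (dualModel I F) I (dualProj F E) κ (rightAnchorAt D D' κ p) =
      ρ' κ.proj (vec p) := by
  rw [rightAnchorAt_apply, map_add, map_sub, mfderiv_dualProj_hlift, mfderiv_dualProj_hlift,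
    ← anchor_vec, sub_self, zero_add]

theorem mvfderiv_linearFunction_rightAnchorAt {κ : DualTotal F E} (p : LeftTangent ρ κ)
    (γ : Cₛ^∞⟮I; F, E⟯) :
    mvfderiv (dualModel I F) (linearFunction γ : DualTotal F E → ℝ) κ (rightAnchorAt D D' κ p) =
      vert D κ p (γ κ.proj) + κ.2 (D'.covDeriv γ κ.proj (vec p)) := by
  rw [rightAnchorAt_apply, map_add, map_sub, mvfderiv_linearFunction_hlift,
    mvfderiv_linearFunction_hlift, vert_apply]

/-- The right anchor `(e, X) ↦ X - e^{Dh} + e^{D'h}` of the left `E`-tangent bundle. -/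
noncomputable def liftedRightAnchor :
    AnchorMap (dualModel I F) (F × (F →L[ℝ] ℝ)) (LeftTangent ρ) :=
  ⟨rightAnchorAt D D', fun κ₀ => contMDiffAt_hom_of_local fun s hs => by
    refine contMDiffAt_tangent (fun f => ?_) fun γ => ?_
    · simp only [mvfderiv_comp_proj, mfderiv_dualProj_rightAnchorAt]
      exact contMDiffAt_mvfderiv_anchor ρ' f (contMDiffAt_vec hs)
    · simp only [mvfderiv_linearFunction_rightAnchorAt]
      exact (contMDiffAt_apply_vert D hs γ).add
        (contMDiffAt_form_apply (p := dualProj F E) (ν := fun μ => μ.2)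
          (contMDiff_dualProj κ₀) contMDiffAt_id
          ((contMDiffAt_comp_proj (D'.covDeriv γ)).clm_bundle_apply (contMDiffAt_vec hs)))⟩

end Anchors

/-! ### The lifted algebroid -/

section LiftedAlgebroid

variable {EB : Type*} [NormedAddCommGroup EB] [NormedSpace ℝ EB] [FiniteDimensional ℝ EB]
  {H : Type*} [TopologicalSpace H] {I : ModelWithCorners ℝ EB H}
  {Q : Type*} [TopologicalSpace Q] [ChartedSpace H Q] [IsManifold I ∞ Q] [T2Space Q]
  {F : Type*} [NormedAddCommGroup F] [NormedSpace ℝ F] [FiniteDimensional ℝ F]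
  {E : Q → Type*} [∀ x, AddCommGroup (E x)] [∀ x, Module ℝ (E x)]
  [∀ x, TopologicalSpace (E x)] [∀ x, IsTopologicalAddGroup (E x)] [∀ x, ContinuousSMul ℝ (E x)]
  [TopologicalSpace (TotalSpace F E)] [FiberBundle F E] [VectorBundle ℝ F E]
  [ContMDiffVectorBundle ∞ F E I]

open LeftTangent

variable {ρ ρ' : AnchorMap I F E} (D : AnchoredConnection ρ) (D' : AnchoredConnection ρ')
  (R : Tensor13 I F E)

theorem contMDiff_form_vec (ν : Cₛ^∞⟮I; F →L[ℝ] ℝ, DualBundle E⟯) (s : LeftTangentSection ρ) :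
    ContMDiff (dualModel I F) 𝓘(ℝ, ℝ) ∞
      (fun κ : DualTotal F E => ν κ.proj (vec (s κ))) := fun κ =>
  contMDiffAt_form_apply (p := dualProj F E) (contMDiff_dualProj κ) (contMDiffAt_comp_proj ν)
    (contMDiffAt_vec (s.contMDiff κ))

theorem contMDiff_vert_section (γ : Cₛ^∞⟮I; F, E⟯) (s : LeftTangentSection ρ) :
    ContMDiff (dualModel I F) 𝓘(ℝ, ℝ) ∞
      (fun κ : DualTotal F E => vert D κ (s κ) (γ κ.proj)) := fun κ =>
  contMDiffAt_apply_vert D (s.contMDiff κ) γ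

/-- The value at `κ` of the lifted bracket of `s = (e, X)` and `s' = (e', X')`. Its `E`-component is
`∇_X e' - ∇'_{Y'} e` and its vertical part is `∇_X k' - ∇'_{Y'} k + κ ∘ R(e, e', ·)`, where
`∇`, `∇'` are the pullbacks of `D`, `D'` along `E* → Q`, `Y'` is the right anchor of `s'`, and `k`,
`k'` are the vertical parts of `s`, `s'`. Both are expressed by pairing with sections. -/
theorem exists_bracketAt (s s' : LeftTangentSection ρ) (κ : DualTotal F E) :
    ∃ t : LeftTangent ρ κ,
      (∀ ν : Cₛ^∞⟮I; F →L[ℝ] ℝ, DualBundle E⟯, ν κ.proj (vec t) =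
        mvfderiv (dualModel I F) (fun μ : DualTotal F E => ν μ.proj (vec (s' μ))) κ (tan (s κ))
          - D.covDual ν κ.proj (vec (s κ)) (vec (s' κ))
          - mvfderiv (dualModel I F) (fun μ : DualTotal F E => ν μ.proj (vec (s μ))) κ
              (rightAnchorAt D D' κ (s' κ))
          + D'.covDual ν κ.proj (vec (s' κ)) (vec (s κ))) ∧
      ∀ γ : Cₛ^∞⟮I; F, E⟯, vert D κ t (γ κ.proj) =
        mvfderiv (dualModel I F) (fun μ : DualTotal F E => vert D μ (s' μ) (γ μ.proj)) κ (tan (s κ))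
          - vert D κ (s' κ) (D.covDeriv γ κ.proj (vec (s κ)))
          - mvfderiv (dualModel I F) (fun μ : DualTotal F E => vert D μ (s μ) (γ μ.proj)) κ
              (rightAnchorAt D D' κ (s' κ))
          + vert D κ (s κ) (D'.covDeriv γ κ.proj (vec (s' κ)))
          + κ.2 (R κ.proj (vec (s κ)) (vec (s' κ)) (γ κ.proj)) := by
  obtain ⟨w, hw⟩ := exists_pullDeriv D (anchor_vec (s κ)).symm fun ν => contMDiff_form_vec ν s'
  obtain ⟨w', hw'⟩ := exists_pullDeriv D' (mfderiv_dualProj_rightAnchorAt D D' (s' κ))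
    fun ν => contMDiff_form_vec ν s
  obtain ⟨η, hη⟩ := exists_pullDerivForm D (anchor_vec (s κ)).symm
    fun γ => contMDiff_vert_section D γ s'
  obtain ⟨η', hη'⟩ := exists_pullDerivForm D' (mfderiv_dualProj_rightAnchorAt D D' (s' κ))
    fun γ => contMDiff_vert_section D γ s
  refine ⟨hliftT D κ (w - w') + vliftT ρ κ
    (η - η' + κ.2.comp (R κ.proj (vec (s κ)) (vec (s' κ)))), fun ν => ?_, fun γ => ?_⟩
  · rw [map_add, vec_hliftT, vec_vliftT, add_zero, map_sub, hw, hw']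
    ring
  · rw [map_add, vert_hliftT, vert_vliftT, zero_add]
    simp only [add_apply, sub_apply, hη, hη', ContinuousLinearMap.comp_apply]
    ring

/-- The value at `κ` of the lifted bracket. -/
noncomputable def bracketAt (s s' : LeftTangentSection ρ) (κ : DualTotal F E) :
    LeftTangent ρ κ := (exists_bracketAt D D' R s s' κ).choose

theorem form_vec_bracketAt (s s' : LeftTangentSection ρ) (κ : DualTotal F E)
    (ν : Cₛ^∞⟮I; F →L[ℝ] ℝ, DualBundle E⟯) :
    ν κ.proj (vec (bracketAt D D' R s s' κ)) =
      mvfderiv (dualModel I F) (fun μ : DualTotal F E => ν μ.proj (vec (s' μ))) κ (tan (s κ))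
        - D.covDual ν κ.proj (vec (s κ)) (vec (s' κ))
        - mvfderiv (dualModel I F) (fun μ : DualTotal F E => ν μ.proj (vec (s μ))) κ
            (rightAnchorAt D D' κ (s' κ))
        + D'.covDual ν κ.proj (vec (s' κ)) (vec (s κ)) :=
  (exists_bracketAt D D' R s s' κ).choose_spec.1 ν

theorem vert_bracketAt (s s' : LeftTangentSection ρ) (κ : DualTotal F E)
    (γ : Cₛ^∞⟮I; F, E⟯) :
    vert D κ (bracketAt D D' R s s' κ) (γ κ.proj) =
      mvfderiv (dualModel I F) (fun μ : DualTotal F E => vert D μ (s' μ) (γ μ.proj)) κ (tan (s κ))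
        - vert D κ (s' κ) (D.covDeriv γ κ.proj (vec (s κ)))
        - mvfderiv (dualModel I F) (fun μ : DualTotal F E => vert D μ (s μ) (γ μ.proj)) κ
            (rightAnchorAt D D' κ (s' κ))
        + vert D κ (s κ) (D'.covDeriv γ κ.proj (vec (s' κ)))
        + κ.2 (R κ.proj (vec (s κ)) (vec (s' κ)) (γ κ.proj)) :=
  (exists_bracketAt D D' R s s' κ).choose_spec.2 γ

/-- An element of the left `E`-tangent bundle is determined by the pairings of its `E`-component and
of its vertical part with smooth sections. -/
theorem leftTangent_ext {κ : DualTotal F E} {p p' : LeftTangent ρ κ}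
    (h : ∀ ν : Cₛ^∞⟮I; F →L[ℝ] ℝ, DualBundle E⟯, ν κ.proj (vec p) = ν κ.proj (vec p'))
    (h' : ∀ γ : Cₛ^∞⟮I; F, E⟯, vert D κ p (γ κ.proj) = vert D κ p' (γ κ.proj)) : p = p' := by
  refine ext_vec_vert D (eq_of_forall_form_apply_eq F I fun η => ?_)
    (ContinuousLinearMap.ext fun v => ?_)
  · obtain ⟨ν, rfl⟩ := exists_section_apply_eq (V := DualBundle E) I (F →L[ℝ] ℝ) η
    exact h ν
  · obtain ⟨γ, rfl⟩ := exists_section_apply_eq I F v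
    exact h' γ

/-- The derivative of a smooth function along a smooth vector field on `E*`. -/
theorem contMDiffAt_mvfderiv_anchor_apply {f : DualTotal F E → ℝ}
    (hf : ContMDiff (dualModel I F) 𝓘(ℝ, ℝ) ∞ f)
    (a : AnchorMap (dualModel I F) (F × (F →L[ℝ] ℝ)) (LeftTangent ρ)) (s : LeftTangentSection ρ)
    (κ : DualTotal F E) :
    ContMDiffAt (dualModel I F) 𝓘(ℝ, ℝ) ∞
      (fun κ => mvfderiv (dualModel I F) f κ (a κ (s κ))) κ :=
  contMDiffAt_mvfderiv_apply hf ((a.contMDiff κ).clm_bundle_apply (s.contMDiff κ))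

theorem contMDiffAt_vert_apply {s : ∀ κ : DualTotal F E, LeftTangent ρ κ} {κ₀ : DualTotal F E}
    (hs : ContMDiffAt (dualModel I F) ((dualModel I F).prod 𝓘(ℝ, F × (F →L[ℝ] ℝ))) ∞
      (fun κ => TotalSpace.mk' (F × (F →L[ℝ] ℝ)) κ (s κ)) κ₀)
    {v : ∀ κ : DualTotal F E, E κ.proj}
    (hv : ContMDiffAt (dualModel I F) (I.prod 𝓘(ℝ, F)) ∞
      (fun κ : DualTotal F E => TotalSpace.mk' F κ.proj (v κ)) κ₀) :
    ContMDiffAt (dualModel I F) 𝓘(ℝ, ℝ) ∞ (fun κ => vert D κ (s κ) (v κ)) κ₀ := by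
  obtain ⟨σ, θ, h⟩ := exists_frame_expansion (F := F) (V := E) I κ₀.proj
  have h1 : ContMDiffAt (dualModel I F) 𝓘(ℝ, ℝ) ∞
      (fun κ : DualTotal F E => ∑ i, θ i κ.proj (v κ) * vert D κ (s κ) (σ i κ.proj)) κ₀ :=
    contMDiffAt_finsetSum fun i _ => (contMDiffAt_form_apply (p := dualProj F E)
      (contMDiff_dualProj κ₀) (contMDiffAt_comp_proj (θ i)) hv).mul
        (contMDiffAt_apply_vert D hs (σ i))
  refine h1.congr_of_eventuallyEq ?_
  filter_upwards [(FiberBundle.continuous_proj (F →L[ℝ] ℝ) (DualBundle E)).continuousAt.eventually h]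
    with κ hκ
  conv_lhs => rw [hκ (v κ)]
  simp

/-- The lifted bracket of two smooth sections, as a smooth section. -/
noncomputable def bracketSection (s s' : LeftTangentSection ρ) : LeftTangentSection ρ :=
  ⟨bracketAt D D' R s s', fun κ => by
    have hs := contMDiffAt_vec (s.contMDiff κ)
    have hs' := contMDiffAt_vec (s'.contMDiff κ)
    refine contMDiffAt_of_vec_vert D
      (contMDiffAt_of_forms (p := dualProj F E) (contMDiff_dualProj κ) fun ν => ?_) fun γ => ?_
    · simp only [form_vec_bracketAt]
      refine (((contMDiffAt_mvfderiv_anchor_apply (contMDiff_form_vec ν s') (liftedLeftAnchor ρ)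
        s κ).sub ?_).sub (contMDiffAt_mvfderiv_anchor_apply (contMDiff_form_vec ν s)
        (liftedRightAnchor D D') s' κ)).add ?_
      · exact contMDiffAt_form_apply (p := dualProj F E) (contMDiff_dualProj κ)
          ((contMDiffAt_comp_proj (D.covDual ν)).clm_bundle_apply hs) hs'
      · exact contMDiffAt_form_apply (p := dualProj F E) (contMDiff_dualProj κ)
          ((contMDiffAt_comp_proj (D'.covDual ν)).clm_bundle_apply hs') hs
    · simp only [vert_bracketAt]
      refine ((((contMDiffAt_mvfderiv_anchor_apply (contMDiff_vert_section D γ s')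
        (liftedLeftAnchor ρ) s κ).sub ?_).sub (contMDiffAt_mvfderiv_anchor_apply
        (contMDiff_vert_section D γ s) (liftedRightAnchor D D') s' κ)).add ?_).add ?_
      · exact contMDiffAt_vert_apply D (s'.contMDiff κ)
          ((contMDiffAt_comp_proj (D.covDeriv γ)).clm_bundle_apply hs)
      · exact contMDiffAt_vert_apply D (s.contMDiff κ)
          ((contMDiffAt_comp_proj (D'.covDeriv γ)).clm_bundle_apply hs')
      · exact contMDiffAt_form_apply (p := dualProj F E) (ν := fun μ => μ.2)
          (contMDiff_dualProj κ) contMDiffAt_id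
          ((((contMDiffAt_comp_proj R).clm_bundle_apply hs).clm_bundle_apply hs').clm_bundle_apply
            (contMDiffAt_comp_proj γ))⟩

theorem bracketAt_add_left (s t s' : LeftTangentSection ρ) (κ : DualTotal F E) :
    bracketAt D D' R (s + t) s' κ = bracketAt D D' R s s' κ + bracketAt D D' R t s' κ := by
  refine leftTangent_ext D (fun ν => ?_) fun γ => ?_
  · simp only [map_add, form_vec_bracketAt, ContMDiffSection.coe_add, Pi.add_apply, add_apply]
    rw [mvfderiv_add_apply (contMDiff_form_vec ν s) (contMDiff_form_vec ν t)]
    ring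
  · simp only [map_add, vert_bracketAt, ContMDiffSection.coe_add, Pi.add_apply, add_apply]
    rw [mvfderiv_add_apply (contMDiff_vert_section D γ s) (contMDiff_vert_section D γ t)]
    ring

theorem bracketAt_add_right (s s' t' : LeftTangentSection ρ) (κ : DualTotal F E) :
    bracketAt D D' R s (s' + t') κ = bracketAt D D' R s s' κ + bracketAt D D' R s t' κ := by
  refine leftTangent_ext D (fun ν => ?_) fun γ => ?_
  · simp only [map_add, form_vec_bracketAt, ContMDiffSection.coe_add, Pi.add_apply, add_apply]
    rw [mvfderiv_add_apply (contMDiff_form_vec ν s') (contMDiff_form_vec ν t')]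
    ring
  · simp only [map_add, vert_bracketAt, ContMDiffSection.coe_add, Pi.add_apply, add_apply]
    rw [mvfderiv_add_apply (contMDiff_vert_section D γ s') (contMDiff_vert_section D γ t')]
    ring

/-- The Leibniz rule of the lifted bracket. -/
theorem bracketAt_smul_smul (f f' : C^∞⟮dualModel I F, DualTotal F E; ℝ⟯)
    (s s' : LeftTangentSection ρ) (κ : DualTotal F E) :
    bracketAt D D' R (f • s) (f' • s') κ =
      (f κ * mvfderiv (dualModel I F) f' κ (tan (s κ))) • s' κ
        - (f' κ * mvfderiv (dualModel I F) f κ (rightAnchorAt D D' κ (s' κ))) • s κ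
        + (f κ * f' κ) • bracketAt D D' R s s' κ := by
  refine leftTangent_ext D (fun ν => ?_) fun γ => ?_
  · simp only [map_add, map_sub, map_smul, form_vec_bracketAt, smulSection_apply, smul_apply,
      smul_eq_mul]
    rw [mvfderiv_mul_apply f.contMDiff (contMDiff_form_vec ν s),
      mvfderiv_mul_apply f'.contMDiff (contMDiff_form_vec ν s')]
    ring
  · simp only [map_add, map_sub, map_smul, vert_bracketAt, smulSection_apply, smul_apply,
      smul_eq_mul, add_apply, sub_apply]
    rw [mvfderiv_mul_apply f.contMDiff (contMDiff_vert_section D γ s),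
      mvfderiv_mul_apply f'.contMDiff (contMDiff_vert_section D γ s')]
    ring

theorem bracketAt_const_smul_left (c : ℝ) (s s' : LeftTangentSection ρ) (κ : DualTotal F E) :
    bracketAt D D' R (c • s) s' κ = c • bracketAt D D' R s s' κ := by
  refine leftTangent_ext D (fun ν => ?_) fun γ => ?_
  · simp only [map_smul, form_vec_bracketAt, ContMDiffSection.coe_smul, Pi.smul_apply,
      smul_apply, smul_eq_mul]
    rw [mvfderiv_const_mul_apply c (contMDiff_form_vec ν s)]
    ring
  · simp only [map_smul, vert_bracketAt, ContMDiffSection.coe_smul, Pi.smul_apply,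
      smul_apply, smul_eq_mul]
    rw [mvfderiv_const_mul_apply c (contMDiff_vert_section D γ s)]
    ring

theorem bracketAt_const_smul_right (c : ℝ) (s s' : LeftTangentSection ρ) (κ : DualTotal F E) :
    bracketAt D D' R s (c • s') κ = c • bracketAt D D' R s s' κ := by
  refine leftTangent_ext D (fun ν => ?_) fun γ => ?_
  · simp only [map_smul, form_vec_bracketAt, ContMDiffSection.coe_smul, Pi.smul_apply,
      smul_apply, smul_eq_mul]
    rw [mvfderiv_const_mul_apply c (contMDiff_form_vec ν s')]
    ring
  · simp only [map_smul, vert_bracketAt, ContMDiffSection.coe_smul, Pi.smul_apply,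
      smul_apply, smul_eq_mul]
    rw [mvfderiv_const_mul_apply c (contMDiff_vert_section D γ s')]
    ring

/-- The algebroid structure on the left `E`-tangent bundle determined by `D`, `D'` and `R`. -/
noncomputable def liftedAlgebroid :
    AlgebroidStructure (dualModel I F) (F × (F →L[ℝ] ℝ)) (LeftTangent ρ) where
  bracket := LinearMap.mk₂ ℝ (bracketSection D D' R)
    (fun s t s' => ContMDiffSection.ext fun κ => bracketAt_add_left D D' R s t s' κ)
    (fun c s s' => ContMDiffSection.ext fun κ => bracketAt_const_smul_left D D' R c s s' κ)
    (fun s s' t' => ContMDiffSection.ext fun κ => bracketAt_add_right D D' R s s' t' κ)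
    (fun c s s' => ContMDiffSection.ext fun κ => bracketAt_const_smul_right D D' R c s s' κ)
  lanchor := liftedLeftAnchor ρ
  ranchor := liftedRightAnchor D D'
  leibniz := bracketAt_smul_smul D D' R

theorem liftedAlgebroid_bracket_apply (s s' : LeftTangentSection ρ) (κ : DualTotal F E) :
    (liftedAlgebroid D D' R).bracket s s' κ = bracketAt D D' R s s' κ := rfl

end LiftedAlgebroid

/-! ### Characterization of the lifted algebroid -/

section Characterization

variable {EB : Type*} [NormedAddCommGroup EB] [NormedSpace ℝ EB] [FiniteDimensional ℝ EB]
  {H : Type*} [TopologicalSpace H] {I : ModelWithCorners ℝ EB H}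
  {Q : Type*} [TopologicalSpace Q] [ChartedSpace H Q] [IsManifold I ∞ Q] [T2Space Q]
  {F : Type*} [NormedAddCommGroup F] [NormedSpace ℝ F] [FiniteDimensional ℝ F]
  {E : Q → Type*} [∀ x, AddCommGroup (E x)] [∀ x, Module ℝ (E x)]
  [∀ x, TopologicalSpace (E x)] [∀ x, IsTopologicalAddGroup (E x)] [∀ x, ContinuousSMul ℝ (E x)]
  [TopologicalSpace (TotalSpace F E)] [FiberBundle F E] [VectorBundle ℝ F E]
  [ContMDiffVectorBundle ∞ F E I]

open LeftTangent

variable {A : AlgebroidStructure I F E} (Dl : AnchoredConnection A.lanchor)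
  (Dr : AnchoredConnection A.ranchor) (R : Tensor13 I F E)

theorem mvfderiv_comp_proj_rightAnchorAt {ρ ρ' : AnchorMap I F E} (D : AnchoredConnection ρ)
    (D' : AnchoredConnection ρ') (f : C^∞⟮I, Q; ℝ⟯) {κ : DualTotal F E} (p : LeftTangent ρ κ) :
    mvfderiv (dualModel I F) (fun μ : DualTotal F E => f μ.proj) κ (rightAnchorAt D D' κ p) =
      mvfderiv I f κ.proj (ρ' κ.proj (vec p)) := by
  rw [mvfderiv_comp_proj, mfderiv_dualProj_rightAnchorAt]

/-- The lifted bracket satisfies the prescribed formulas. Horizontal lifts have vertical part zero and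
vertical lifts have `E`-component zero, so few terms survive; the decomposition of the bracket of `E`
by the two connections enters only for two horizontal lifts. -/
theorem isLiftedAlgebroid_liftedAlgebroid
    (hB : ∀ σ σ', A.bracket σ σ' = Dl.conn σ σ' - Dr.conn σ' σ) :
    IsLiftedAlgebroid A Dl Dr R (liftedAlgebroid Dl Dr R) where
  lanchor_apply _ _ := rfl
  ranchor_apply _ p := rightAnchorAt_apply Dl Dr p
  bracket_hor_hor σ σ' := ContMDiffSection.ext fun κ => by
    rw [liftedAlgebroid_bracket_apply]
    refine leftTangent_ext Dl (fun ν => ?_) fun γ => ?_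
    · simp only [form_vec_bracketAt, hSec_spec, vec_hliftT, ContMDiffSection.coe_add, Pi.add_apply,
        map_add, tSec_spec Dl, vec_vliftT, map_zero, AnchoredConnection.covDual_apply]
      have h1 := mvfderiv_comp_proj_tan (pairing ν σ') (hliftT Dl κ (σ κ.proj))
      have h2 := mvfderiv_comp_proj_rightAnchorAt Dl Dr (pairing ν σ) (hliftT Dl κ (σ' κ.proj))
      simp only [pairing_apply, vec_hliftT] at h1 h2
      rw [h1, h2]
      simp only [hB, ContMDiffSection.coe_sub, Pi.sub_apply, map_sub,
        AnchoredConnection.conn_apply]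
      change mvfderiv I (fun y => ν y (σ' y)) _ _ - _ - mvfderiv I (fun y => ν y (σ y)) _ _ + _ = _
      ring
    · simp only [vert_bracketAt, hSec_spec, vec_hliftT, vert_hliftT, ContMDiffSection.coe_add,
        Pi.add_apply, add_apply, map_add, tSec_spec Dl, vert_vliftT, zero_apply,
        mvfderiv_const]
      simp [Tensor13.eval]
  bracket_hor_ver σ ν := ContMDiffSection.ext fun κ => by
    rw [liftedAlgebroid_bracket_apply]
    refine leftTangent_ext Dl (fun ν' => ?_) fun γ => ?_
    · simp only [form_vec_bracketAt, hSec_spec, vec_hliftT, vSec_spec Dl, vec_vliftT, map_zero,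
        mvfderiv_const]
      have h1 := mvfderiv_comp_proj_rightAnchorAt Dl Dr (pairing ν' σ)
        (vliftT A.lanchor κ (ν κ.proj))
      simp only [pairing_apply, vec_vliftT, map_zero] at h1
      rw [h1]
      simp
    · simp only [vert_bracketAt, hSec_spec, vec_hliftT, vert_hliftT, vSec_spec Dl, vec_vliftT,
        vert_vliftT, zero_apply, map_zero, mvfderiv_const, AnchoredConnection.dual_apply]
      have h1 := mvfderiv_comp_proj_tan (pairing ν γ) (hliftT Dl κ (σ κ.proj))
      simp only [pairing_apply, vec_hliftT] at h1
      rw [h1]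
      change mvfderiv I (fun y => ν y (γ y)) _ _ - _ - _ + _ + _ = _
      simp
  bracket_ver_hor ν σ := ContMDiffSection.ext fun κ => by
    rw [liftedAlgebroid_bracket_apply]
    refine leftTangent_ext Dl (fun ν' => ?_) fun γ => ?_
    · simp only [form_vec_bracketAt, hSec_spec, vec_hliftT, vSec_spec Dl, vec_vliftT, map_zero,
        mvfderiv_const, ContMDiffSection.coe_neg, Pi.neg_apply, map_neg]
      have h1 := mvfderiv_comp_proj_tan (pairing ν' σ) (vliftT A.lanchor κ (ν κ.proj))
      simp only [pairing_apply, vec_vliftT, map_zero] at h1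
      rw [h1]
      simp
    · simp only [vert_bracketAt, hSec_spec, vec_hliftT, vert_hliftT, vSec_spec Dl, vec_vliftT,
        vert_vliftT, zero_apply, map_zero, mvfderiv_const, AnchoredConnection.dual_apply,
        ContMDiffSection.coe_neg, Pi.neg_apply, map_neg, neg_apply]
      have h1 := mvfderiv_comp_proj_rightAnchorAt Dl Dr (pairing ν γ) (hliftT Dl κ (σ κ.proj))
      simp only [pairing_apply, vec_hliftT] at h1
      rw [h1]
      change _ - _ - mvfderiv I (fun y => ν y (γ y)) _ _ + _ + _ = _
      ring
  bracket_ver_ver ν ν' := ContMDiffSection.ext fun κ => by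
    rw [liftedAlgebroid_bracket_apply]
    refine leftTangent_ext Dl (fun η => ?_) fun γ => ?_
    · simp only [form_vec_bracketAt, vSec_spec Dl, vec_vliftT, map_zero,
        mvfderiv_const]
      simp
    · simp only [vert_bracketAt, vSec_spec Dl, vec_vliftT,
        vert_vliftT, map_zero]
      have h1 := mvfderiv_comp_proj_tan (pairing ν' γ) (vliftT A.lanchor κ (ν κ.proj))
      have h2 := mvfderiv_comp_proj_rightAnchorAt Dl Dr (pairing ν γ)
        (vliftT A.lanchor κ (ν' κ.proj))
      simp only [pairing_apply, vec_vliftT, map_zero] at h1 h2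
      rw [h1, h2]
      simp

/-- Lifts of sections span: a `C^∞(E*)`-linear map that vanishes on horizontal and vertical lifts is
zero. -/
theorem eq_zero_of_lifts {ρ : AnchorMap I F E} (D : AnchoredConnection ρ) {κ : DualTotal F E}
    {G : Type*} [AddCommGroup G] [Module ℝ G] (L : LeftTangentSection ρ →ₗ[ℝ] G)
    (hL : ∀ (f : C^∞⟮dualModel I F, DualTotal F E; ℝ⟯) s, L (f • s) = f κ • L s)
    (hh : ∀ σ, L (hSec D σ) = 0) (hv : ∀ ν, L (vSec ρ ν) = 0) (s : LeftTangentSection ρ) :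
    L s = 0 := by
  -- the cut-off is pulled back from `Q`: it is `1` at `κ` and supported where `E` has a frame
  obtain ⟨σ, θ, h⟩ := exists_frame_expansion (F := F) (V := E) I κ.proj
  obtain ⟨χ, h1, hχ⟩ := exists_cutoff I h
  let χ' : C^∞⟮dualModel I F, DualTotal F E; ℝ⟯ := ⟨_, contMDiff_comp_proj χ⟩
  let a (i) : C^∞⟮dualModel I F, DualTotal F E; ℝ⟯ := ⟨_, contMDiff_form_vec (θ i) s⟩
  let b (i) : C^∞⟮dualModel I F, DualTotal F E; ℝ⟯ := ⟨_, contMDiff_vert_section D (σ i) s⟩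
  have key : χ' • s = χ' • ∑ i, (a i • hSec D (σ i) + b i • vSec ρ (θ i)) := by
    ext μ
    rw [smulSection_apply, smulSection_apply]
    by_cases hμ : μ.proj ∈ tsupport χ
    · have hμ' := hχ hμ
      congr 1
      rw [sum_section_apply]
      simp only [ContMDiffSection.coe_add, Pi.add_apply, smulSection_apply, hSec_spec, vSec_spec D]
      refine ext_vec_vert D ?_ ?_
      · simpa [vec_hliftT, vec_vliftT] using! hμ' (vec (s μ))
      · simpa [vert_hliftT, vert_vliftT] using! form_expansion I F hμ' (vert D μ (s μ))
    · have : χ' μ = 0 := image_eq_zero_of_notMem_tsupport (f := χ) hμ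
      rw [this, zero_smul, zero_smul]
  have h2 := congrArg L key
  have h3 : χ' κ = 1 := h1.self_of_nhds
  rw [hL, hL, h3, one_smul, one_smul, map_sum] at h2
  simpa [hL, hh, hv] using h2

/-- The difference of two brackets with the same anchors is linear over `C^∞(E*)` in both arguments,
so it is determined by its values on lifts. -/
theorem IsLiftedAlgebroid.unique
    {𝒜 𝒜' : AlgebroidStructure (dualModel I F) (F × (F →L[ℝ] ℝ)) (LeftTangent A.lanchor)}
    (h : IsLiftedAlgebroid A Dl Dr R 𝒜) (h' : IsLiftedAlgebroid A Dl Dr R 𝒜') : 𝒜' = 𝒜 := by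
  have hl : 𝒜'.lanchor = 𝒜.lanchor := ContMDiffSection.ext fun κ =>
    ContinuousLinearMap.ext fun p => (h'.lanchor_apply κ p).trans (h.lanchor_apply κ p).symm
  have hr : 𝒜'.ranchor = 𝒜.ranchor := ContMDiffSection.ext fun κ =>
    ContinuousLinearMap.ext fun p => (h'.ranchor_apply κ p).trans (h.ranchor_apply κ p).symm
  have hl1 (f : C^∞⟮dualModel I F, DualTotal F E; ℝ⟯) (s s' : LeftTangentSection A.lanchor)
      (κ : DualTotal F E) : 𝒜'.bracket (f • s) s' κ - 𝒜.bracket (f • s) s' κ =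
        f κ • (𝒜'.bracket s s' κ - 𝒜.bracket s s' κ) := by
    rw [𝒜.bracket_smul_left, 𝒜'.bracket_smul_left, hr, smul_sub]
    abel
  have hr1 (f : C^∞⟮dualModel I F, DualTotal F E; ℝ⟯) (s s' : LeftTangentSection A.lanchor)
      (κ : DualTotal F E) : 𝒜'.bracket s (f • s') κ - 𝒜.bracket s (f • s') κ =
        f κ • (𝒜'.bracket s s' κ - 𝒜.bracket s s' κ) := by
    rw [𝒜.bracket_smul_right, 𝒜'.bracket_smul_right, hl, smul_sub]
    abel
  have hbr : 𝒜'.bracket = 𝒜.bracket := by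
    refine LinearMap.ext fun s => LinearMap.ext fun s' => ContMDiffSection.ext fun κ => ?_
    -- the difference of the brackets at `κ`, as a function of either argument
    have left (t' : LeftTangentSection A.lanchor)
        (hh : ∀ σ, 𝒜'.bracket (hSec Dl σ) t' = 𝒜.bracket (hSec Dl σ) t')
        (hv : ∀ ν, 𝒜'.bracket (vSec A.lanchor ν) t' = 𝒜.bracket (vSec A.lanchor ν) t')
        (t : LeftTangentSection A.lanchor) : 𝒜'.bracket t t' κ - 𝒜.bracket t t' κ = 0 :=
      eq_zero_of_lifts Dl (κ := κ)
        { toFun := fun t => 𝒜'.bracket t t' κ - 𝒜.bracket t t' κ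
          map_add' := fun t u => by simp; abel
          map_smul' := fun c t => by simp [smul_sub] }
        (fun f t => hl1 f t t' κ) (fun σ => by simp [hh]) (fun ν => by simp [hv]) t
    have hh (σ) : 𝒜'.bracket s (hSec Dl σ) κ - 𝒜.bracket s (hSec Dl σ) κ = 0 :=
      left _ (fun τ => (h'.bracket_hor_hor τ σ).trans (h.bracket_hor_hor τ σ).symm)
        (fun ν => (h'.bracket_ver_hor ν σ).trans (h.bracket_ver_hor ν σ).symm) s
    have hv (ν) : 𝒜'.bracket s (vSec A.lanchor ν) κ - 𝒜.bracket s (vSec A.lanchor ν) κ = 0 :=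
      left _ (fun τ => (h'.bracket_hor_ver τ ν).trans (h.bracket_hor_ver τ ν).symm)
        (fun μ => (h'.bracket_ver_ver μ ν).trans (h.bracket_ver_ver μ ν).symm) s
    exact sub_eq_zero.1 (eq_zero_of_lifts Dl (κ := κ)
      { toFun := fun t' => 𝒜'.bracket s t' κ - 𝒜.bracket s t' κ
        map_add' := fun t u => by simp; abel
        map_smul' := fun c t => by simp [smul_sub] }
      (fun f t' => hr1 f s t' κ) hh hv s')
  exact AlgebroidStructure.ext' hbr hl hr

end Characterization

/-! ### The Liouville section and the symplectic form -/

section Symplectic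

variable {EB : Type*} [NormedAddCommGroup EB] [NormedSpace ℝ EB] [FiniteDimensional ℝ EB]
  {H : Type*} [TopologicalSpace H] {I : ModelWithCorners ℝ EB H}
  {Q : Type*} [TopologicalSpace Q] [ChartedSpace H Q] [IsManifold I ∞ Q] [T2Space Q]
  {F : Type*} [NormedAddCommGroup F] [NormedSpace ℝ F] [FiniteDimensional ℝ F]
  {E : Q → Type*} [∀ x, AddCommGroup (E x)] [∀ x, Module ℝ (E x)]
  [∀ x, TopologicalSpace (E x)] [∀ x, IsTopologicalAddGroup (E x)] [∀ x, ContinuousSMul ℝ (E x)]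
  [TopologicalSpace (TotalSpace F E)] [FiberBundle F E] [VectorBundle ℝ F E]
  [ContMDiffVectorBundle ∞ F E I]

open LeftTangent

variable (ρ : AnchorMap I F E) in
/-- The Liouville section `λ(κ)(e, X) = κ(e)`. -/
noncomputable def liouville : LeftTangentForm ρ :=
  ⟨fun κ => κ.2.comp vec, fun κ₀ => contMDiffAt_hom_of_local (W := fun _ => ℝ) fun s hs => by
    refine (contMDiffAt_trivial_iff (p := fun z => z) contMDiffAt_id).2 ?_
    exact contMDiffAt_form_apply (p := dualProj F E) (ν := fun μ => μ.2) (contMDiff_dualProj κ₀)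
      contMDiffAt_id (contMDiffAt_vec hs)⟩

theorem liouville_apply {ρ : AnchorMap I F E} (κ : DualTotal F E) (p : LeftTangent ρ κ) :
    liouville ρ κ p = κ.2 (vec p) := rfl

variable {ρ ρ' : AnchorMap I F E} (D : AnchoredConnection ρ) (D' : AnchoredConnection ρ')

theorem exists_symplecticAt (κ : DualTotal F E) :
    ∃ Ω : LeftTangent ρ κ →L[ℝ] LeftTangent ρ κ →L[ℝ] ℝ,
      ∀ u w, Ω u w = vert D κ w (vec u) - vert D κ u (vec w) := by
  have := VectorBundle.finiteDimensional ℝ (F × (F →L[ℝ] ℝ)) (LeftTangent ρ) κ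
  have := FiberBundle.t2Space (F × (F →L[ℝ] ℝ)) (LeftTangent ρ) κ
  let b : LeftTangent ρ κ →ₗ[ℝ] LeftTangent ρ κ →ₗ[ℝ] ℝ :=
    LinearMap.mk₂ ℝ (fun u w => vert D κ w (vec u) - vert D κ u (vec w))
      (fun u v w => by simp; ring) (fun c u w => by simp; ring)
      (fun u v w => by simp; ring) (fun c u w => by simp; ring)
  exact ⟨LinearMap.toContinuousLinearMap
    ((LinearMap.toContinuousLinearMap : (LeftTangent ρ κ →ₗ[ℝ] ℝ) ≃ₗ[ℝ] _).toLinearMap ∘ₗ b),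
    fun u w => rfl⟩

/-- The tensor `Ω((e, X), (e', X')) = k'(e) - k(e')`, where `k`, `k'` are the vertical parts. -/
noncomputable def symplecticForm : LeftTangentTensor02 ρ :=
  ⟨fun κ => (exists_symplecticAt D κ).choose, fun κ₀ =>
    contMDiffAt_hom_of_local (W := DualBundle (LeftTangent ρ)) fun s hs =>
      contMDiffAt_hom_of_local (W := fun _ => ℝ) fun s' hs' => by
    refine (contMDiffAt_trivial_iff (p := fun z => z) contMDiffAt_id).2 ?_
    simp only [(exists_symplecticAt D _).choose_spec]
    exact (contMDiffAt_vert_apply D hs' (contMDiffAt_vec hs)).sub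
      (contMDiffAt_vert_apply D hs (contMDiffAt_vec hs'))⟩

theorem symplecticForm_apply {κ : DualTotal F E} (u w : LeftTangent ρ κ) :
    symplecticForm D κ u w = vert D κ w (vec u) - vert D κ u (vec w) :=
  (exists_symplecticAt D κ).choose_spec u w

/-- The derivative of the function `μ ↦ μ(v)`, for a section `v` of `E` along `E* → Q`, in the
direction of a tangent vector `X` with vertical part `K` relative to `D`. -/
theorem mvfderiv_apply_section {κ : DualTotal F E} {e : E κ.proj}
    {X : TangentSpace (dualModel I F) κ}
    (hX : mfderiv (dualModel I F) I (dualProj F E) κ X = ρ κ.proj e) {K : DualBundle E κ.proj}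
    (hK : ∀ γ : Cₛ^∞⟮I; F, E⟯,
      mvfderiv (dualModel I F) (linearFunction γ : DualTotal F E → ℝ) κ X =
        K (γ κ.proj) + κ.2 (D.covDeriv γ κ.proj e))
    {v : ∀ μ : DualTotal F E, E μ.proj}
    (hv : ∀ ν : Cₛ^∞⟮I; F →L[ℝ] ℝ, DualBundle E⟯,
      ContMDiff (dualModel I F) 𝓘(ℝ, ℝ) ∞ (fun μ : DualTotal F E => ν μ.proj (v μ)))
    {ν : Cₛ^∞⟮I; F →L[ℝ] ℝ, DualBundle E⟯} (hν : ν κ.proj = κ.2) :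
    mvfderiv (dualModel I F) (fun μ : DualTotal F E => μ.2 (v μ)) κ X =
      mvfderiv (dualModel I F) (fun μ : DualTotal F E => ν μ.proj (v μ)) κ X
        - D.covDual ν κ.proj e (v κ) + K (v κ) := by
  obtain ⟨σ, θ, h⟩ := exists_frame_expansion (F := F) (V := E) I κ.proj
  have h' := (FiberBundle.continuous_proj (F →L[ℝ] ℝ) (DualBundle E)).continuousAt.eventually h
  have hσ (η : DualBundle E κ.proj) : η (v κ) = ∑ i, θ i κ.proj (v κ) * η (σ i κ.proj) := by
    conv_lhs => rw [h.self_of_nhds (v κ)]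
    simp
  have h1 : ∀ᶠ μ in 𝓝 κ, μ.2 (v μ) = ∑ i, θ i μ.proj (v μ) * linearFunction (σ i) μ := by
    filter_upwards [h'] with μ hμ
    conv_lhs => rw [hμ (v μ)]
    simp [linearFunction]
  have h2 : ∀ᶠ μ in 𝓝 κ, ν μ.proj (v μ) =
      ∑ i, θ i μ.proj (v μ) * pairing ν (σ i) μ.proj := by
    filter_upwards [h'] with μ hμ
    conv_lhs => rw [hμ (v μ)]
    simp [pairing_apply]
  have h3 (i) : D.covDual ν κ.proj e (σ i κ.proj) =
      mvfderiv (dualModel I F) (fun μ : DualTotal F E => pairing ν (σ i) μ.proj) κ X -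
        κ.2 (D.covDeriv (σ i) κ.proj e) := by
    rw [D.covDual_apply, mvfderiv_comp_proj, hX, hν]
    rfl
  rw [mvfderiv_congr_nhds h1, mvfderiv_congr_nhds h2,
    mvfderiv_sum_apply (f := fun i μ => θ i μ.proj (v μ) * linearFunction (σ i) μ) _
      fun i => (hv (θ i)).mul (contMDiff_linearFunction (σ i)),
    mvfderiv_sum_apply (f := fun i μ => θ i μ.proj (v μ) * pairing ν (σ i) μ.proj) _
      fun i => (hv (θ i)).mul (contMDiff_comp_proj (pairing ν (σ i))),
    hσ (D.covDual ν κ.proj e), hσ K, ← Finset.sum_sub_distrib, ← Finset.sum_add_distrib]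
  refine Finset.sum_congr rfl fun i _ => ?_
  rw [mvfderiv_mul_apply (hv (θ i)) (contMDiff_linearFunction (σ i)),
    mvfderiv_mul_apply (hv (θ i)) (contMDiff_comp_proj (pairing ν (σ i))), hK, h3,
    pairing_apply, hν, linearFunction]
  ring

/-- The differential of the Liouville section: the terms of `d^{lr}λ(s, s')` that involve derivatives
of the `E`-components cancel against `λ` of the bracket. -/
theorem dlr_liouville (R : Tensor13 I F E) (s s' : LeftTangentSection ρ) (κ : DualTotal F E) :
    (liftedAlgebroid D D' R).dlr (liouville ρ) s s' κ =
      vert D κ (s κ) (vec (s' κ)) - vert D κ (s' κ) (vec (s κ)) := by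
  obtain ⟨ν, hν⟩ := exists_section_apply_eq (V := DualBundle E) I (F →L[ℝ] ℝ) κ.2
  have h1 := mvfderiv_apply_section D (anchor_vec (s κ)).symm (K := vert D κ (s κ))
    (fun γ => by rw [vert_apply]; ring) (fun η => contMDiff_form_vec η s') hν
  have h2 := mvfderiv_apply_section D' (mfderiv_dualProj_rightAnchorAt D D' (s' κ))
    (mvfderiv_linearFunction_rightAnchorAt D D' (s' κ)) (fun η => contMDiff_form_vec η s) hν
  have h3 := form_vec_bracketAt D D' R s s' κ ν
  rw [hν] at h3
  change mvfderiv (dualModel I F) (fun μ : DualTotal F E => μ.2 (vec (s' μ))) κ (tan (s κ))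
    - mvfderiv (dualModel I F) (fun μ : DualTotal F E => μ.2 (vec (s μ))) κ
      (rightAnchorAt D D' κ (s' κ)) - κ.2 (vec (bracketAt D D' R s s' κ)) = _
  rw [h1, h2, h3]
  ring

/-- Nondegeneracy is tested on vertical lifts, which detect the `E`-component, and on horizontal
lifts, which detect the vertical part. -/
theorem isExactSymplecticForm (R : Tensor13 I F E) :
    (liftedAlgebroid D D' R).IsExactSymplecticForm (liouville ρ) (symplecticForm D) where
  eq_neg_dlr s s' κ := by
    rw [symplecticForm_apply, dlr_liouville]
    ring
  skew κ u w := by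
    rw [symplecticForm_apply, symplecticForm_apply]
    ring
  nondegenerate κ u h := by
    refine ext_vec_vert D (eq_of_forall_form_apply_eq F I fun η => ?_)
      (ContinuousLinearMap.ext fun e => ?_)
    · have := h (vliftT ρ κ η)
      rw [symplecticForm_apply, vert_vliftT, vec_vliftT, map_zero, sub_zero] at this
      simpa using this
    · have := h (hliftT D κ e)
      rw [symplecticForm_apply, vert_hliftT, vec_hliftT] at this
      simpa using this

end Symplectic

/-! ### Lifted local frames -/

section Frames

/-- The coefficients of a smooth section in a local frame are smooth. -/
theorem contMDiffAt_localFrame_coeff {EB : Type*} [NormedAddCommGroup EB] [NormedSpace ℝ EB]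
    {H : Type*} [TopologicalSpace H] {I : ModelWithCorners ℝ EB H}
    {M : Type*} [TopologicalSpace M] [ChartedSpace H M] [IsManifold I ∞ M]
    {F : Type*} [NormedAddCommGroup F] [NormedSpace ℝ F] [FiniteDimensional ℝ F]
    {V : M → Type*} [∀ x, AddCommGroup (V x)] [∀ x, Module ℝ (V x)] [∀ x, TopologicalSpace (V x)]
    [TopologicalSpace (TotalSpace F V)] [FiberBundle F V] [VectorBundle ℝ F V]
    [ContMDiffVectorBundle ∞ F V I]
    {ι : Type*} [Fintype ι] {s : ι → ∀ x, V x} {U : Set M} (hs : IsLocalFrameOn I F ∞ s U)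
    (hU : IsOpen U) {x : M} (hx : x ∈ U) {t : ∀ x, V x}
    (ht : ContMDiffAt I (I.prod 𝓘(ℝ, F)) ∞ (fun y => TotalSpace.mk' F y (t y)) x) (i : ι) :
    ContMDiffAt I 𝓘(ℝ, ℝ) ∞ (fun y => hs.coeff i y (t y)) x := by
  -- the frame, read in a trivialization, is a smooth family of isomorphisms `ℝ^ι ≃ F`
  let e := trivializationAt F V x
  let Φ : M → (ι → ℝ) →L[ℝ] F := fun y =>
    ∑ j, (ContinuousLinearMap.proj (R := ℝ) (φ := fun _ : ι => ℝ) j).smulRight (e ⟨y, s j y⟩).2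
  have hΦ : ContMDiffAt I 𝓘(ℝ, (ι → ℝ) →L[ℝ] F) ∞ Φ x := by
    refine contMDiffAt_finsetSum fun j _ => ?_
    have h1 := (contMDiffAt_section _).1 (hs.contMDiffAt hU hx j)
    exact (ContinuousLinearMap.smulRightL ℝ (ι → ℝ) F
      (ContinuousLinearMap.proj (R := ℝ) (φ := fun _ : ι => ℝ) j)).contMDiff.contMDiffAt.comp x h1
  have key : ∀ y ∈ U ∩ e.baseSet, ∃ E : (ι → ℝ) ≃L[ℝ] F, (E : (ι → ℝ) →L[ℝ] F) = Φ y ∧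
      ∀ v, E.symm (e ⟨y, v⟩).2 = fun i => hs.coeff i y v := fun y hy => by
    let E : (ι → ℝ) ≃ₗ[ℝ] F :=
      (hs.toBasisAt hy.1).equivFun.symm.trans (e.linearEquivAt ℝ y hy.2)
    refine ⟨E.toContinuousLinearEquiv, ContinuousLinearMap.ext fun c => ?_, fun v => ?_⟩
    · change e.linearEquivAt ℝ y hy.2 ((hs.toBasisAt hy.1).equivFun.symm c) = Φ y c
      simp [Φ, Basis.equivFun_symm_apply]
    · change (hs.toBasisAt hy.1).equivFun ((e.linearEquivAt ℝ y hy.2).symm (e ⟨y, v⟩).2) = _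
      have : (e.linearEquivAt ℝ y hy.2).symm (e ⟨y, v⟩).2 = v :=
        (e.linearEquivAt ℝ y hy.2).symm_apply_apply v
      rw [this]
      ext i
      simp [IsLocalFrameOn.coeff, hy.1]
  have hx' : x ∈ U ∩ e.baseSet := ⟨hx, mem_baseSet_trivializationAt F V x⟩
  obtain ⟨E, hE, -⟩ := key x hx'
  have h2 : ContMDiffAt I 𝓘(ℝ, F →L[ℝ] (ι → ℝ)) ∞ (fun y => (Φ y).inverse) x := by
    have := contDiffAt_map_inverse (n := ∞) E
    rw [hE] at this
    exact this.contMDiffAt.comp x hΦ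
  have h3 := h2.clm_apply ((contMDiffAt_section _).1 ht)
  have h4 := (ContinuousLinearMap.proj (R := ℝ) (φ := fun _ : ι => ℝ) i).contMDiff.contMDiffAt.comp
    x h3
  refine h4.congr_of_eventuallyEq ?_
  filter_upwards [(hU.inter e.open_baseSet).mem_nhds hx'] with y hy
  obtain ⟨E, hE, hE'⟩ := key y hy
  have h5 := congrFun (hE' (t y)) i
  simp only [Function.comp_apply, ← hE, ContinuousLinearMap.inverse_equiv]
  exact h5.symm

variable {EB : Type*} [NormedAddCommGroup EB] [NormedSpace ℝ EB] [FiniteDimensional ℝ EB]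
  {H : Type*} [TopologicalSpace H] {I : ModelWithCorners ℝ EB H}
  {Q : Type*} [TopologicalSpace Q] [ChartedSpace H Q] [IsManifold I ∞ Q] [T2Space Q]
  {F : Type*} [NormedAddCommGroup F] [NormedSpace ℝ F] [FiniteDimensional ℝ F]
  {E : Q → Type*} [∀ x, AddCommGroup (E x)] [∀ x, Module ℝ (E x)]
  [∀ x, TopologicalSpace (E x)] [∀ x, IsTopologicalAddGroup (E x)] [∀ x, ContinuousSMul ℝ (E x)]
  [TopologicalSpace (TotalSpace F E)] [FiberBundle F E] [VectorBundle ℝ F E]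
  [ContMDiffVectorBundle ∞ F E I] {ρ : AnchorMap I F E} (D : AnchoredConnection ρ)

open LeftTangent

variable {n : ℕ} {U : Set Q} {s : Fin n → (x : Q) → E x} {ν : Fin n → (x : Q) → DualBundle E x}

theorem coeff_eq_of_dual (hs : IsLocalFrameOn I F ∞ s U) {x : Q} (hx : x ∈ U)
    (hν : ∀ i j, ν i x (s j x) = if i = j then 1 else 0) (i : Fin n) (v : E x) :
    hs.coeff i x v = ν i x v := by
  have h1 : v = ∑ j, (hs.toBasisAt hx).repr v j • s j x := by
    simpa using ((hs.toBasisAt hx).sum_repr v).symm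
  conv_rhs => rw [h1]
  simp [hν, IsLocalFrameOn.coeff, hx]

theorem eq_sum_of_dual (hs : IsLocalFrameOn I F ∞ s U) {x : Q} (hx : x ∈ U)
    (hν : ∀ i j, ν i x (s j x) = if i = j then 1 else 0) (v : E x) :
    v = ∑ j, ν j x v • s j x := by
  simpa [← coeff_eq_of_dual hs hx hν, IsLocalFrameOn.coeff, hx] using
    ((hs.toBasisAt hx).sum_repr v).symm

/-- The coefficients of `p` in the lifted frame are the coefficients of its `E`-component in the frame
`s` and the values of its vertical part on that frame. -/
theorem eq_sum_liftedFamily (hs : IsLocalFrameOn I F ∞ s U) {κ : DualTotal F E}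
    (hx : κ.proj ∈ U) (hν : ∀ i j, ν i κ.proj (s j κ.proj) = if i = j then 1 else 0)
    (p : LeftTangent ρ κ) :
    p = ∑ j, Sum.elim (fun i => ν i κ.proj (vec p)) (fun i => vert D κ p (s i κ.proj)) j •
      liftedFamily D s ν j κ := by
  rw [Fintype.sum_sum_type]
  simp only [Sum.elim_inl, Sum.elim_inr, liftedFamily]
  refine ext_vec_vert D ?_ (ContinuousLinearMap.ext fun v => ?_)
  · simpa [vec_hliftT, vec_vliftT] using eq_sum_of_dual hs hx hν (vec p)
  · conv_lhs => rw [eq_sum_of_dual hs hx hν v]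
    simp [vert_hliftT, vert_vliftT, mul_comm]

theorem isLocalFrameOn_liftedFamily (hU : IsOpen U) (hs : IsLocalFrameOn I F ∞ s U)
    (hν : ∀ x ∈ U, ∀ i j, ν i x (s j x) = if i = j then 1 else 0) :
    IsLocalFrameOn (dualModel I F) (F × (F →L[ℝ] ℝ)) ∞ (liftedFamily D s ν)
      (dualProj F E ⁻¹' U) where
  linearIndependent {κ} hκ := by
    have hκ' : κ.proj ∈ U := hκ
    rw [Fintype.linearIndependent_iff]
    intro g hg
    rw [Fintype.sum_sum_type] at hg
    simp only [liftedFamily, Sum.elim_inl, Sum.elim_inr] at hg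
    rintro (i | i)
    · have := congrArg (fun p => ν i κ.proj (vec p)) hg
      simpa [vec_hliftT, vec_vliftT, hν _ hκ'] using this
    · have := congrArg (fun p => vert D κ p (s i κ.proj)) hg
      simpa [vert_hliftT, vert_vliftT, hν _ hκ'] using this
  generating {κ} hκ := fun p _ => by
    rw [eq_sum_liftedFamily D hs hκ (hν _ hκ) p]
    exact Submodule.sum_mem _ fun j _ =>
      Submodule.smul_mem _ _ (Submodule.subset_span (mem_range_self j))
  contMDiffOn := by
    rintro (i | i) κ hκ
    · refine (contMDiffAt_hliftT D (σ := fun κ => s i κ.proj) ?_).contMDiffWithinAt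
      exact ContMDiffAt.comp (f := dualProj F E) (g := fun y => TotalSpace.mk' F y (s i y)) κ
        (hs.contMDiffAt hU hκ i) (contMDiff_dualProj κ)
    · refine (contMDiffAt_vliftT D (ν := fun κ => ν i κ.proj) fun γ => ?_).contMDiffWithinAt
      have h1 : ContMDiffAt I 𝓘(ℝ, ℝ) ∞ (fun y => ν i y (γ y)) κ.proj := by
        refine (contMDiffAt_localFrame_coeff hs hU hκ (γ.contMDiff _) i).congr_of_eventuallyEq ?_
        filter_upwards [hU.mem_nhds hκ] with y hy using (coeff_eq_of_dual hs hy (hν y hy) i _).symm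
      exact h1.comp κ (contMDiff_dualProj κ)

theorem coeff_liftedFamily (hs : IsLocalFrameOn I F ∞ s U)
    (h : IsLocalFrameOn (dualModel I F) (F × (F →L[ℝ] ℝ)) ∞ (liftedFamily D s ν)
      (dualProj F E ⁻¹' U)) {κ : DualTotal F E} (hκ : κ.proj ∈ U)
    (hν : ∀ i j, ν i κ.proj (s j κ.proj) = if i = j then 1 else 0) (p : LeftTangent ρ κ)
    (j : Fin n ⊕ Fin n) :
    h.coeff j κ p =
      Sum.elim (fun i => ν i κ.proj (vec p)) (fun i => vert D κ p (s i κ.proj)) j := by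
  have hκ' : κ ∈ dualProj F E ⁻¹' U := hκ
  have h1 := eq_sum_liftedFamily D hs hκ hν p
  simp only [← h.toBasisAt_coe hκ'] at h1
  have h2 : h.coeff j κ p = (h.toBasisAt hκ').repr p j := by simp [IsLocalFrameOn.coeff, hκ]
  rw [h2]
  conv_lhs => rw [h1]
  rw [Basis.repr_sum_self]

end Frames

end LRAlgebroid

theorem mainTheorem1
    {EB : Type*} [NormedAddCommGroup EB] [NormedSpace ℝ EB] [FiniteDimensional ℝ EB]
    {H : Type*} [TopologicalSpace H] {I : ModelWithCorners ℝ EB H} [I.Boundaryless]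
    {Q : Type*} [TopologicalSpace Q] [ChartedSpace H Q] [IsManifold I ∞ Q]
    [T2Space Q] [SigmaCompactSpace Q]
    {F : Type*} [NormedAddCommGroup F] [NormedSpace ℝ F] [FiniteDimensional ℝ F]
    {E : Q → Type*} [∀ x, AddCommGroup (E x)] [∀ x, Module ℝ (E x)]
    [∀ x, TopologicalSpace (E x)] [∀ x, IsTopologicalAddGroup (E x)]
    [∀ x, ContinuousSMul ℝ (E x)] [TopologicalSpace (Bundle.TotalSpace F E)] [FiberBundle F E]
    [VectorBundle ℝ F E] [ContMDiffVectorBundle ∞ F E I]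
    (A : AlgebroidStructure I F E) :
    (∃ 𝒜 : AlgebroidStructure (dualModel I F) (F × (F →L[ℝ] ℝ)) (LeftTangent A.lanchor),
      𝒜.IsExactSymplectic) ∧
    (∃ (Dl : AnchoredConnection A.lanchor) (Dr : AnchoredConnection A.ranchor),
      ∀ σ σ', A.bracket σ σ' = Dl.conn σ σ' - Dr.conn σ' σ) ∧
    ∀ (Dl : AnchoredConnection A.lanchor) (Dr : AnchoredConnection A.ranchor),
      (∀ σ σ', A.bracket σ σ' = Dl.conn σ σ' - Dr.conn σ' σ) →
      LiftsWellDefined Dl ∧ LiftsWellDefined Dr ∧ BundleLiftsWellDefined Dl ∧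
      ∀ R : Tensor13 I F E,
        ∃ 𝒜 : AlgebroidStructure (dualModel I F) (F × (F →L[ℝ] ℝ)) (LeftTangent A.lanchor),
          IsLiftedAlgebroid A Dl Dr R 𝒜 ∧
          (∀ 𝒜' : AlgebroidStructure (dualModel I F) (F × (F →L[ℝ] ℝ)) (LeftTangent A.lanchor),
            IsLiftedAlgebroid A Dl Dr R 𝒜' → 𝒜' = 𝒜) ∧
          ∃ (lam : LeftTangentForm A.lanchor) (Ω : LeftTangentTensor02 A.lanchor),
            IsLiouvilleSection lam ∧ 𝒜.IsExactSymplecticForm lam Ω ∧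
            ∀ (n : ℕ) (U : Set Q) (s : Fin n → (x : Q) → E x)
              (ν : Fin n → (x : Q) → DualBundle E x),
              IsOpen U → IsLocalFrameOn I F ∞ s U →
              (∀ x ∈ U, ∀ i j, ν i x (s j x) = if i = j then 1 else 0) →
              ∃ h : IsLocalFrameOn (dualModel I F) (F × (F →L[ℝ] ℝ)) ∞ (liftedFamily Dl s ν)
                  (dualProj F E ⁻¹' U),
                ∀ κ : DualTotal F E, κ.proj ∈ U → ∀ u w : LeftTangent A.lanchor κ,
                  Ω κ u w = ∑ i,
                    (h.coeff (Sum.inl i) κ u * h.coeff (Sum.inr i) κ w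
                      - h.coeff (Sum.inr i) κ u * h.coeff (Sum.inl i) κ w) := by
  have h2 := A.exists_connections
  refine ⟨?_, h2, fun Dl Dr hB => ⟨liftsWellDefined Dl, liftsWellDefined Dr,
    bundleLiftsWellDefined Dl, fun R => ⟨liftedAlgebroid Dl Dr R,
      isLiftedAlgebroid_liftedAlgebroid Dl Dr R hB, fun 𝒜' h' => IsLiftedAlgebroid.unique Dl Dr R
        (isLiftedAlgebroid_liftedAlgebroid Dl Dr R hB) h', liouville A.lanchor, symplecticForm Dl,
      liouville_apply, isExactSymplecticForm Dl Dr R, fun n U s ν hU hs hν =>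
        ⟨isLocalFrameOn_liftedFamily Dl hU hs hν, fun κ hκ u w => ?_⟩⟩⟩⟩
  · obtain ⟨Dl, Dr, -⟩ := h2
    let R : Tensor13 I F E :=
      ⟨fun _ => 0, contMDiff_zeroSection ℝ (fun x => E x →L[ℝ] E x →L[ℝ] E x →L[ℝ] E x)⟩
    exact ⟨_, _, _, isExactSymplecticForm Dl Dr R⟩
  · have expand (η : DualBundle E κ.proj) (v : E κ.proj) :
        η v = ∑ i, ν i κ.proj v * η (s i κ.proj) := by
      conv_lhs => rw [eq_sum_of_dual hs hκ (hν _ hκ) v]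
      simp
    simp only [coeff_liftedFamily Dl hs _ hκ (hν _ hκ), Sum.elim_inl, Sum.elim_inr]
    rw [symplecticForm_apply, expand _ (LeftTangent.vec u), expand _ (LeftTangent.vec w),
      ← Finset.sum_sub_distrib]
    exact Finset.sum_congr rfl fun i _ => by ring
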